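/- Let $T>0$, and let $f=(f_1,\dots,f_n):\mathbb{R}^n\times[0,T]\to\mathbb{R}^n$ be such that the components $f_k$ and their partial derivatives in $x$ of order at most two exist for each $t$, are Lebesgue measurable on $\mathbb{R}^n\times[0,T]$, and are bounded. Put $$\delta_f(t)=\tfrac12\sup_{x\in\mathbb{R}^n}\Bigl|\sum_{i=1}^n\frac{\partial f_i}{\partial x_i}(x,t)\Bigr|,\qquad A(x,t)u=\sum_{i=1}^n f_i(x,t)\frac{\partial u}{\partial x_i},\qquad A^*(x,t)u=-\sum_{i=1}^n\frac{\partial}{\partial x_i}\bigl(f_i(x,t)u\bigr).$$ Then $\delta_f$ is integrable on $[0,T]$. Write $H^0=L_2(\mathbb{R}^n)$, $H^1=W_2^1(\mathbb{R}^n)$, and give $C([s,T];H^0)$ the supremum norm. (a) For each $\varphi\in L^2([0,T];H^1)$ the problem $$\frac{\partial v}{\partial t}+A(x,t)v=-\varphi,\qquad v(x,T)=0,\tag{1.1}$$ has exactly one solution $v\in C([0,T];H^0)\cap L^2([0,T];H^1)$, i.e. exactly one such $v$ with $v(t)=\int_t^T\bigl(A(\cdot,\tau)v(\tau)+\varphi(\tau)\bigr)\,d\tau$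 in $H^0$ for all $t\in[0,T]$. The map $L:\varphi\mapsto v$ extends uniquely to a continuous linear operator $L:L^1([0,T];H^0)\to C([0,T];H^0)$, and $\|L\|\le\exp\int_0^T\delta_f(t)\,dt$. (b) Let $s\in[0,T]$. For each $\rho\in H^1$ the problem $$\frac{\partial p}{\partial t}=A^*(x,t)p,\qquad p(x,s)=\rho(x),\tag{1.3}$$ has exactly one solution $p\in C([s,T];H^0)\cap L^2([s,T];H^1)$, i.e. exactly one such $p$ with $p(t)=\rho+\int_s^tA^*(\cdot,\tau)p(\tau)\,d\tau$ in $H^0$ for all $t\in[s,T]$. The map $\mathcal{L}_s^*:\rho\mapsto p$ extends uniquely to a continuous linear operator $\mathcal{L}_s^*:H^0\to C([s,T];H^0)$, and $\|\mathcal{L}_s^*\|\le\exp\int_s^T\delta_f(t)\,dt$. -/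

import Mathlib

open MeasureTheory Set
open scoped ContDiff ENNReal

noncomputable section

namespace Transport

/-- `ℝⁿ` with its Euclidean norm and Lebesgue measure. -/
abbrev E (n : ℕ) := EuclideanSpace ℝ (Fin n)

/-- The classical partial derivative `∂g/∂x_i` at `x`. -/
def pd {n : ℕ} (i : Fin n) (g : E n → ℝ) (x : E n) : ℝ :=
  lineDeriv ℝ g x (EuclideanSpace.single i 1)

/-- The partial derivative `∂g/∂x_i` exists at `x`. -/
def HasPd {n : ℕ} (i : Fin n) (g : E n → ℝ) (x : E n) : Prop :=
  LineDifferentiableAt ℝ g x (EuclideanSpace.single i 1)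

/-- The standing assumptions on the vector field `f(x, t)`, `x ∈ ℝⁿ`, `t ∈ [0, T]`: the components
of `f` and their `x`-partial derivatives of order at most two exist for each `t`, are Lebesgue
measurable on `ℝⁿ × [0, T]`, and are bounded. -/
structure IsAdmissible (n : ℕ) (T : ℝ) (f : E n → ℝ → E n) : Prop where
  measurable_f : ∀ k : Fin n, AEMeasurable (fun z : E n × ℝ => f z.1 z.2 k)
    ((volume : Measure (E n × ℝ)).restrict (univ ×ˢ Icc 0 T))
  measurable_d1 : ∀ k i : Fin n, AEMeasurable
    (fun z : E n × ℝ => pd i (fun y => f y z.2 k) z.1)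
    ((volume : Measure (E n × ℝ)).restrict (univ ×ˢ Icc 0 T))
  measurable_d2 : ∀ k i j : Fin n, AEMeasurable
    (fun z : E n × ℝ => pd j (pd i (fun y => f y z.2 k)) z.1)
    ((volume : Measure (E n × ℝ)).restrict (univ ×ˢ Icc 0 T))
  exists_d1 : ∀ t ∈ Icc 0 T, ∀ (x : E n) (k i : Fin n), HasPd i (fun y => f y t k) x
  exists_d2 : ∀ t ∈ Icc 0 T, ∀ (x : E n) (k i j : Fin n), HasPd j (pd i (fun y => f y t k)) x
  bounded : ∃ C : ℝ, ∀ t ∈ Icc 0 T, ∀ (x : E n) (k i j : Fin n),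
    |f x t k| ≤ C ∧ |pd i (fun y => f y t k) x| ≤ C ∧ |pd j (pd i (fun y => f y t k)) x| ≤ C

/-- `div_x f(x, t) = ∑ᵢ ∂fᵢ/∂xᵢ (x, t)`. -/
def divx {n : ℕ} (f : E n → ℝ → E n) (x : E n) (t : ℝ) : ℝ :=
  ∑ i : Fin n, pd i (fun y => f y t i) x

/-- `δ_f(t) = ½ sup_x |div_x f(x, t)|`. -/
def delta {n : ℕ} (f : E n → ℝ → E n) (t : ℝ) : ℝ :=
  (1 / 2) * ⨆ x : E n, |divx f x t|

/-- `H⁰ = L₂(ℝⁿ)`. -/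
abbrev H0 (n : ℕ) := Lp ℝ 2 (volume : Measure (E n))

/-- `w` is the weak partial derivative `∂u/∂x_i` (for `u`, `w` in `L₂`): integration by parts
against all smooth compactly supported test functions. -/
def HasWeakPd {n : ℕ} (i : Fin n) (u w : H0 n) : Prop :=
  ∀ η : E n → ℝ, ContDiff ℝ ∞ η → HasCompactSupport η →
    ∫ x, u x * pd i η x = -∫ x, w x * η x

lemma pd_continuous {n : ℕ} (i : Fin n) {η : E n → ℝ} (h : ContDiff ℝ ∞ η) :
    Continuous (pd i η) := by
  have e : pd i η = fun x => fderiv ℝ η x (EuclideanSpace.single i 1) := by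
    funext x
    exact (h.differentiable (by simp) x).lineDeriv_eq_fderiv
  rw [e]
  exact (h.continuous_fderiv (by simp)).clm_apply continuous_const

lemma pd_compactSupport {n : ℕ} (i : Fin n) {η : E n → ℝ} (h : ContDiff ℝ ∞ η)
    (hc : HasCompactSupport η) : HasCompactSupport (pd i η) := by
  have e : pd i η = fun x => fderiv ℝ η x (EuclideanSpace.single i 1) := by
    funext x
    exact (h.differentiable (by simp) x).lineDeriv_eq_fderiv
  rw [e]
  exact (hc.fderiv (𝕜 := ℝ)).comp_left (g := fun l : E n →L[ℝ] ℝ => l (EuclideanSpace.single i 1))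
    (by simp)

lemma integrable_mul_test {n : ℕ} (u : H0 n) {g : E n → ℝ} (h : Continuous g)
    (hc : HasCompactSupport g) : Integrable (fun x => u x * g x) :=
  (Lp.memLp u).integrable_mul (p := 2) (q := 2) (h.memLp_of_hasCompactSupport hc)

lemma HasWeakPd.add {n : ℕ} {i : Fin n} {u w u' w' : H0 n} (h : HasWeakPd i u w)
    (h' : HasWeakPd i u' w') : HasWeakPd i (u + u') (w + w') := by
  intro η hη hc
  have a : ∫ x, (u + u') x * pd i η x = ∫ x, (u x * pd i η x + u' x * pd i η x) :=
    integral_congr_ae (by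
      filter_upwards [Lp.coeFn_add u u'] with x hx
      rw [hx, Pi.add_apply, add_mul])
  have b : ∫ x, (w + w') x * η x = ∫ x, (w x * η x + w' x * η x) :=
    integral_congr_ae (by
      filter_upwards [Lp.coeFn_add w w'] with x hx
      rw [hx, Pi.add_apply, add_mul])
  rw [a, b, integral_add (integrable_mul_test u (pd_continuous i hη) (pd_compactSupport i hη hc))
      (integrable_mul_test u' (pd_continuous i hη) (pd_compactSupport i hη hc)),
    integral_add (integrable_mul_test w hη.continuous hc)
      (integrable_mul_test w' hη.continuous hc), h η hη hc, h' η hη hc]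
  ring

lemma HasWeakPd.smul {n : ℕ} {i : Fin n} {u w : H0 n} (c : ℝ) (h : HasWeakPd i u w) :
    HasWeakPd i (c • u) (c • w) := by
  intro η hη hc
  have a : ∫ x, (c • u) x * pd i η x = ∫ x, c * (u x * pd i η x) :=
    integral_congr_ae (by
      filter_upwards [Lp.coeFn_smul c u] with x hx
      rw [hx, Pi.smul_apply, smul_eq_mul, mul_assoc])
  have b : ∫ x, (c • w) x * η x = ∫ x, c * (w x * η x) :=
    integral_congr_ae (by
      filter_upwards [Lp.coeFn_smul c w] with x hx
      rw [hx, Pi.smul_apply, smul_eq_mul, mul_assoc])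
  rw [a, b, integral_const_mul, integral_const_mul, h η hη hc]
  ring

lemma HasWeakPd.zero {n : ℕ} (i : Fin n) : HasWeakPd i (0 : H0 n) 0 := by
  intro η _ _
  have a : ∫ x, (0 : H0 n) x * pd i η x = ∫ _ : E n, (0 : ℝ) :=
    integral_congr_ae (by
      filter_upwards [Lp.coeFn_zero ℝ 2 (volume : Measure (E n))] with x hx
      rw [hx]; simp)
  have b : ∫ x, (0 : H0 n) x * η x = ∫ _ : E n, (0 : ℝ) :=
    integral_congr_ae (by
      filter_upwards [Lp.coeFn_zero ℝ 2 (volume : Measure (E n))] with x hx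
      rw [hx]; simp)
  rw [a, b]
  simp

/-- The Sobolev space `H¹ = W₂¹(ℝⁿ)`. An element is a tuple `z` of `L₂` functions, where
`z none = u` and `z (some i)` is the weak derivative `∂u/∂x_i` (which `u` determines); the norm is
`(‖u‖² + ∑ᵢ ‖∂u/∂x_i‖²)^{1/2}`. -/
def H1 (n : ℕ) : Submodule ℝ (PiLp 2 (fun _ : Option (Fin n) => H0 n)) where
  carrier := {z | ∀ i : Fin n, HasWeakPd i (z none) (z (some i))}
  add_mem' := fun ha hb i => (ha i).add (hb i)
  zero_mem' := fun i => HasWeakPd.zero i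
  smul_mem' := fun c _ h i => (h i).smul c

/-- The embedding `H¹ → H⁰`. -/
def toH0 {n : ℕ} : H1 n →L[ℝ] H0 n :=
  (PiLp.proj 2 (fun _ : Option (Fin n) => H0 n) none : _ →L[ℝ] H0 n).comp (H1 n).subtypeL

/-- The weak derivative `∂/∂x_i : H¹ → H⁰`. -/
def wpd {n : ℕ} (i : Fin n) : H1 n →L[ℝ] H0 n :=
  (PiLp.proj 2 (fun _ : Option (Fin n) => H0 n) (some i) : _ →L[ℝ] H0 n).comp (H1 n).subtypeL

/-- `C([s, T] → H⁰)` with the supremum norm. -/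
abbrev C0 (n : ℕ) (s T : ℝ) := C(Icc s T, H0 n)

/-- `L¹([s, T] → H⁰)` (Bochner). -/
abbrev X01 (n : ℕ) (s T : ℝ) := Lp (H0 n) 1 ((volume : Measure ℝ).restrict (Icc s T))

/-- `L²([s, T] → H¹)` (Bochner). -/
abbrev X1 (n : ℕ) (s T : ℝ) := Lp (H1 n) 2 ((volume : Measure ℝ).restrict (Icc s T))

lemma memLp_incl {n : ℕ} {s T : ℝ} (φ : X1 n s T) :
    MemLp (fun t => toH0 (φ t)) 1 ((volume : Measure ℝ).restrict (Icc s T)) :=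
  ((toH0 (n := n)).comp_memLp' (Lp.memLp φ)).mono_exponent (by norm_num)

/-- The inclusion `L²([s, T] → H¹) ⊂ L¹([s, T] → H⁰)`. -/
def incl {n : ℕ} {s T : ℝ} (φ : X1 n s T) : X01 n s T := (memLp_incl φ).toLp

/-- `g = A(·, t) u`, where `A(x, t) u = ∑ᵢ fᵢ(x, t) ∂u/∂xᵢ`, for `u ∈ H¹`. -/
def IsA {n : ℕ} (f : E n → ℝ → E n) (t : ℝ) (u : H1 n) (g : H0 n) : Prop :=
  ∀ᵐ x, g x = ∑ i : Fin n, f x t i * wpd i u x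

/-- `g = A*(·, t) u`, where `A*(x, t) u = -∑ᵢ ∂/∂xᵢ (fᵢ(x, t) u)`, for `u ∈ H¹`: here `z i` is
the product `fᵢ(·, t) u` as an element of `H¹`. -/
def IsAstar {n : ℕ} (f : E n → ℝ → E n) (t : ℝ) (u : H1 n) (g : H0 n) : Prop :=
  ∃ z : Fin n → H1 n, (∀ i, ∀ᵐ x, toH0 (z i) x = f x t i * toH0 u x) ∧ g = -∑ i, wpd i (z i)

/-- `v ∈ C([0, T] → H⁰) ∩ L²([0, T] → H¹)` solves `∂v/∂t + A v = -φ`, `v(T) = 0` on `[0, T]`: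
`v` is the `H⁰`-valued absolutely continuous function `v(t) = ∫_t^T (A v + φ)`. Here `w` is `v` as
an element of `L²([0, T] → H¹)` and `g` is `A v`. -/
def SolvesBackward {n : ℕ} {T : ℝ} (f : E n → ℝ → E n) (φ : X01 n 0 T) (v : C0 n 0 T) : Prop :=
  ∃ (w : X1 n 0 T) (g : X01 n 0 T),
    (∀ᵐ t ∂((volume : Measure ℝ).restrict (Icc 0 T)), ∀ ht : t ∈ Icc 0 T,
      v ⟨t, ht⟩ = toH0 (w t)) ∧
    (∀ᵐ t ∂((volume : Measure ℝ).restrict (Icc 0 T)), IsA f t (w t) (g t)) ∧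
    ∀ t : Icc 0 T, v t = ∫ τ in (t : ℝ)..T, (g τ + φ τ)

/-- `p ∈ C([s, T] → H⁰) ∩ L²([s, T] → H¹)` solves `∂p/∂t = A* p`, `p(s) = ρ` on `[s, T]`:
`p` is the `H⁰`-valued absolutely continuous function `p(t) = ρ + ∫_s^t A* p`. Here `w` is `p` as
an element of `L²([s, T] → H¹)` and `g` is `A* p`. -/
def SolvesForward {n : ℕ} {s T : ℝ} (f : E n → ℝ → E n) (ρ : H0 n) (p : C0 n s T) : Prop :=
  ∃ (w : X1 n s T) (g : X01 n s T),
    (∀ᵐ t ∂((volume : Measure ℝ).restrict (Icc s T)), ∀ ht : t ∈ Icc s T,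
      p ⟨t, ht⟩ = toH0 (w t)) ∧
    (∀ᵐ t ∂((volume : Measure ℝ).restrict (Icc s T)), IsAstar f t (w t) (g t)) ∧
    ∀ t : Icc s T, p t = ρ + ∫ τ in s..(t : ℝ), g τ

end Transport

end

open Transport

/-!
The proof is the energy method for first order equations `∂u/∂t = ∑ᵢ bᵢ ∂ᵢu + c u + φ`, whose
coefficients are bounded together with their first derivatives (`IsMultiplier`), so that
multiplication by them acts on `H¹`. The forward problem has `b = -f`, `c = -div f`; the backward
problem, after reversing time, has `b = f`, `c = 0`.

*A priori bound and uniqueness.* Integration by parts gives `⟪u, f · ∇u⟫ = -½ ⟪u, (div f) u⟫`, so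
both `A` and `A*` satisfy `⟪u, P u⟫ ≤ δ_f ‖u‖²` (`inner_firstOrderOp_self_le`). A solution is a
primitive of an integrable `L₂`-valued function, hence `‖u‖²` is absolutely continuous and satisfies
the energy identity (`norm_sq_primitive`); Gronwall's inequality (`gronwall_sq`) turns this into
`‖u(t)‖ ≤ exp (∫ δ_f) (‖u(a)‖ + ∫ ‖φ‖)` (`evolution_norm_le`).

*Existence.* Replacing `∂ᵢ` by central difference quotients, `firstOrderOp` becomes a bounded
operator `approxOp` on `H¹`, and the equation is solved by a contraction argument
(`exists_linear_evolution`). The central difference quotient is skew-adjoint and commutes with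
multipliers up to a bounded error, so that the approximations are quasi-dissipative on `H¹`
uniformly in the step (`inner_approxOp_le`), and the approximate solutions are bounded in `H¹`. A
weak limit in `L²([a, b] → H¹)` solves the equation, because the adjoints of the approximations
converge strongly on the dense subspace `H¹` of `L₂` (`exists_evolution`, `exists_transport`). The
underlying description of weak derivatives is that `∂ᵢu` is the derivative of `s ↦ u(· + s eᵢ)` in
`L₂` (`hasWeakPd_iff_hasDerivAt`).

*Extension.* `H¹` is dense in `L₂` and `L²([0, T] → H¹)` is dense in `L¹([0, T] → L₂)`, so the bound
extends the solution operators (`existsUnique_and_exists_extension`).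

The function `δ_f` is measurable since `div f` is Lipschitz in `x`: this makes `div f(x, ·)`
measurable for every single `x` (`aemeasurable_of_lipschitz`), and reduces the supremum to a
countable one.
-/

namespace Transport

open Filter Topology
open scoped RealInnerProductSpace

/-! ### Energy identity and Gronwall inequality -/

section Energy

/-- Absolute continuity passes to a function whose increments are controlled by those of an
absolutely continuous function. -/
lemma absolutelyContinuousOnInterval_of_dist_le {X Y : Type*} [PseudoMetricSpace X]
    [PseudoMetricSpace Y] {u : ℝ → X} {w : ℝ → Y} {a b C : ℝ}
    (h : ∀ x ∈ uIcc a b, ∀ y ∈ uIcc a b, dist (w x) (w y) ≤ C * dist (u x) (u y))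
    (hu : AbsolutelyContinuousOnInterval u a b) : AbsolutelyContinuousOnInterval w a b := by
  unfold AbsolutelyContinuousOnInterval at hu ⊢
  have h0 := hu.const_mul C
  rw [mul_zero] at h0
  apply squeeze_zero' ?_ ?_ h0
  · exact Filter.Eventually.of_forall fun _ ↦ Finset.sum_nonneg fun i hi ↦ dist_nonneg
  rw [eventually_inf_principal]
  refine Filter.Eventually.of_forall fun I hI => ?_
  rw [Finset.mul_sum]
  exact Finset.sum_le_sum fun i hi => h _ (hI.1 i hi).1 _ (hI.1 i hi).2

variable {K : Type*} [NormedAddCommGroup K] [InnerProductSpace ℝ K] [CompleteSpace K]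

/-- The energy identity for a Hilbert-space valued primitive. -/
lemma norm_sq_primitive {a b : ℝ} (hab : a ≤ b) {g u : ℝ → K} {u0 : K}
    (hg : IntervalIntegrable g volume a b)
    (hu : ∀ t ∈ Icc a b, u t = u0 + ∫ τ in a..t, g τ) {t : ℝ} (ht : t ∈ Icc a b) :
    ‖u t‖ ^ 2 = ‖u0‖ ^ 2 + 2 * ∫ τ in a..t, ⟪u τ, g τ⟫ := by
  set U : ℝ → K := fun t => u0 + ∫ τ in a..t, g τ with hU
  have hsub : uIcc a t ⊆ uIcc a b := by
    rw [uIcc_of_le hab, uIcc_of_le ht.1]; exact Icc_subset_Icc le_rfl ht.2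
  have hgt : IntervalIntegrable g volume a t := hg.mono_set hsub
  have hN : AbsolutelyContinuousOnInterval (fun t => ∫ τ in a..t, ‖g τ‖) a t :=
    hgt.norm.absolutelyContinuousOnInterval_intervalIntegral (c := a) (by simp)
  have hUN : ∀ x ∈ uIcc a t, ∀ y ∈ uIcc a t,
      dist (U x) (U y) ≤ 1 * dist (∫ τ in a..x, ‖g τ‖) (∫ τ in a..y, ‖g τ‖) := by
    intro x hx y hy
    have hax : IntervalIntegrable g volume a x := hgt.mono_set (uIcc_subset_uIcc_left hx)
    have hay : IntervalIntegrable g volume a y := hgt.mono_set (uIcc_subset_uIcc_left hy)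
    rw [hU, dist_add_left, dist_eq_norm, dist_eq_norm,
      intervalIntegral.integral_interval_sub_left hax hay,
      intervalIntegral.integral_interval_sub_left hax.norm hay.norm, one_mul, Real.norm_eq_abs]
    exact intervalIntegral.norm_integral_le_abs_integral_norm
  have hAC : AbsolutelyContinuousOnInterval U a t :=
    absolutelyContinuousOnInterval_of_dist_le hUN hN
  obtain ⟨R, hR⟩ := hAC.exists_bound
  have hR0 : 0 ≤ R := (norm_nonneg _).trans (hR a (by simp))
  have hAC2 : AbsolutelyContinuousOnInterval (fun t => ‖U t‖ ^ 2) a t := by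
    refine absolutelyContinuousOnInterval_of_dist_le (C := 2 * R) (fun x hx y hy => ?_) hAC
    have h1 := hR x hx
    have h2 := hR y hy
    rw [Real.dist_eq, dist_eq_norm, sq_sub_sq, abs_mul]
    refine mul_le_mul ?_ (abs_norm_sub_norm_le _ _) (abs_nonneg _) (by positivity)
    rw [abs_of_nonneg (by positivity)]; linarith
  have hFTC := hAC2.integral_deriv_eq_sub
  have hUa : U a = u0 := by simp [hU]
  have hUt : U t = u t := (hu t ht).symm
  have key : ∫ τ in a..t, deriv (fun t => ‖U t‖ ^ 2) τ = ∫ τ in a..t, 2 * ⟪u τ, g τ⟫ := by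
    apply intervalIntegral.integral_congr_ae
    filter_upwards [hgt.ae_hasDerivAt_integral] with τ hτ hmem
    have hmem' : τ ∈ uIcc a t := uIoc_subset_uIcc hmem
    have h1 : HasDerivAt U (g τ) τ := (hτ hmem' a (by simp)).const_add u0
    have h2 : U τ = u τ := by
      have := hsub hmem'
      rw [uIcc_of_le hab] at this
      exact (hu τ this).symm
    have h3 : HasDerivAt (fun t => ‖U t‖ ^ 2) (2 * ⟪U τ, g τ⟫) τ := h1.norm_sq
    rw [h3.deriv, h2]
  rw [key, intervalIntegral.integral_const_mul, hUa, hUt] at hFTC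
  linarith

/-- A Gronwall inequality for quadratic quantities, with an integrable growth rate `δ` and an
integrable source `ψ`: the resulting bound for `y` is linear in the source. -/
lemma gronwall_sq {a b : ℝ} (hab : a ≤ b) {y δ ψ : ℝ → ℝ} {r : ℝ} (hr : 0 ≤ r)
    (hy : ContinuousOn y (Icc a b)) (hy0 : ∀ t, 0 ≤ y t)
    (hδ : IntervalIntegrable δ volume a b) (hδ0 : ∀ t, 0 ≤ δ t)
    (hψ : IntervalIntegrable ψ volume a b) (hψ0 : ∀ t, 0 ≤ ψ t)
    (h : ∀ t ∈ Icc a b, y t ^ 2 ≤ r ^ 2 + 2 * ∫ τ in a..t, (δ τ * y τ ^ 2 + ψ τ * y τ))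
    {t : ℝ} (ht : t ∈ Icc a b) :
    y t ≤ Real.exp (∫ τ in a..t, δ τ) * (r + ∫ τ in a..t, ψ τ) := by
  set D : ℝ → ℝ := fun t => ∫ τ in a..t, δ τ with hD
  set P : ℝ → ℝ := fun t => ∫ τ in a..t, ψ τ with hP
  have hu : uIcc a b = Icc a b := uIcc_of_le hab
  have hDac : AbsolutelyContinuousOnInterval D a b :=
    hδ.absolutelyContinuousOnInterval_intervalIntegral (c := a) (by simp)
  have hPac : AbsolutelyContinuousOnInterval P a b :=
    hψ.absolutelyContinuousOnInterval_intervalIntegral (c := a) (by simp)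
  have hD0 : ∀ t ∈ Icc a b, 0 ≤ D t := fun t ht =>
    intervalIntegral.integral_nonneg ht.1 fun τ _ => hδ0 τ
  have hP0 : ∀ t ∈ Icc a b, 0 ≤ P t := fun t ht =>
    intervalIntegral.integral_nonneg ht.1 fun τ _ => hψ0 τ
  have hEac : AbsolutelyContinuousOnInterval (fun t => Real.exp (D t)) a b := by
    obtain ⟨R, hR⟩ := hDac.exists_bound
    obtain ⟨C, hC⟩ := (Real.contDiff_exp (n := 1)).contDiffOn.exists_lipschitzOnWith
      (by decide) (convex_Icc (-R) R) isCompact_Icc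
    exact absolutelyContinuousOnInterval_of_dist_le (fun x hx y hy =>
      hC.dist_le_mul _ (abs_le.1 (hR x hx)) _ (abs_le.1 (hR y hy))) hDac
  -- The room `ε` makes the comparison function `z` below strictly larger than `y` at time `a`.
  suffices hε : ∀ ε > 0, y t ≤ Real.exp (D t) * (r + ε + P t) by
    have hlim : Tendsto (fun ε : ℝ => Real.exp (D t) * (r + ε + P t)) (𝓝[>] 0)
        (𝓝 (Real.exp (D t) * (r + 0 + P t))) := by
      have : Continuous fun ε : ℝ => Real.exp (D t) * (r + ε + P t) := by fun_prop
      exact (this.tendsto 0).mono_left nhdsWithin_le_nhds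
    rw [add_zero] at hlim
    exact ge_of_tendsto hlim (by filter_upwards [self_mem_nhdsWithin] with ε hε' using hε ε hε')
  intro ε hε
  set z : ℝ → ℝ := fun t => Real.exp (D t) * (r + ε + P t) with hz
  have hzac : AbsolutelyContinuousOnInterval z a b :=
    hEac.fun_mul
      ((LipschitzWith.const (r + ε)).lipschitzOnWith.absolutelyContinuousOnInterval.fun_add hPac)
  have hzc : ContinuousOn z (Icc a b) := hu ▸ hzac.continuousOn
  have hz0 : ∀ t ∈ Icc a b, 0 < z t := fun t ht => by
    have := hP0 t ht; simp only [hz]; positivity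
  have hza : z a = r + ε := by simp [hz, hD, hP]
  -- `z` satisfies the integral inequality with equality, up to the larger source `exp (D) ψ`.
  have hzint : ∀ s ∈ Icc a b, z s ^ 2 = (r + ε) ^ 2 +
      2 * ∫ τ in a..s, (δ τ * z τ ^ 2 + Real.exp (D τ) * ψ τ * z τ) := by
    intro s hs
    have hsub : uIcc a s ⊆ uIcc a b := by
      rw [uIcc_of_le hab, uIcc_of_le hs.1]; exact Icc_subset_Icc le_rfl hs.2
    have hF := ((hzac.fun_mul hzac).mono hsub).integral_deriv_eq_sub
    have key : ∫ τ in a..s, deriv (fun t => z t * z t) τ =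
        ∫ τ in a..s, 2 * (δ τ * z τ ^ 2 + Real.exp (D τ) * ψ τ * z τ) := by
      apply intervalIntegral.integral_congr_ae
      filter_upwards [hδ.ae_hasDerivAt_integral, hψ.ae_hasDerivAt_integral] with τ h1 h2 hmem
      have hm : τ ∈ uIcc a b := hsub (uIoc_subset_uIcc hmem)
      have d1 : HasDerivAt D (δ τ) τ := h1 hm a (by simp)
      have d2 : HasDerivAt P (ψ τ) τ := h2 hm a (by simp)
      have d3 : HasDerivAt z _ τ := d1.exp.mul (d2.const_add (r + ε))
      rw [(d3.fun_mul d3).deriv]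
      simp only [hz]; ring
    rw [key, intervalIntegral.integral_const_mul, hza] at hF
    rw [sq (z s)]; linarith
  -- Otherwise there is a first time `m` with `z m ≤ y m`; before `m`, the integrand for `y` is at
  -- most that for `z`, which gives `y m < z m`.
  by_contra hcon
  push Not at hcon
  set S : Set ℝ := Icc a b ∩ {s | z s ≤ y s} with hS
  have hSc : IsClosed S := by
    have := (hy.sub hzc).preimage_isClosed_of_isClosed isClosed_Icc (isClosed_Ici (a := (0 : ℝ)))
    convert this using 1
    ext s; simp [hS]
  have hSne : S.Nonempty := ⟨t, ht, hcon.le⟩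
  have hSb : BddBelow S := ⟨a, fun s hs => hs.1.1⟩
  obtain ⟨hm1, hm2⟩ := hSc.csInf_mem hSne hSb
  set m := sInf S with hm
  have hlt : ∀ τ ∈ Ico a m, y τ < z τ := fun τ hτ => by
    by_contra hc
    push Not at hc
    exact absurd (csInf_le hSb ⟨⟨hτ.1, hτ.2.le.trans hm1.2⟩, hc⟩) (not_le.2 hτ.2)
  have hsub : uIcc a m ⊆ uIcc a b := by
    rw [uIcc_of_le hab, uIcc_of_le hm1.1]; exact Icc_subset_Icc le_rfl hm1.2
  have hδm := hδ.mono_set hsub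
  have hψm := hψ.mono_set hsub
  have hsub' : uIcc a m ⊆ Icc a b := hu ▸ hsub
  have hEc : ContinuousOn (fun t => Real.exp (D t)) (Icc a b) := hu ▸ hEac.continuousOn
  have hle : ∫ τ in a..m, (δ τ * y τ ^ 2 + ψ τ * y τ) ≤
      ∫ τ in a..m, (δ τ * z τ ^ 2 + Real.exp (D τ) * ψ τ * z τ) := by
    refine intervalIntegral.integral_mono_on_of_le_Ioo hm1.1
      ((hδm.mul_continuousOn ((hy.mono hsub').pow 2)).add (hψm.mul_continuousOn (hy.mono hsub')))
      ((hδm.mul_continuousOn ((hzc.mono hsub').pow 2)).add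
        ((hψm.continuousOn_mul (hEc.mono hsub')).mul_continuousOn (hzc.mono hsub'))) ?_
    intro τ hτ
    have h1 := (hlt τ ⟨hτ.1.le, hτ.2⟩).le
    have hτ' : τ ∈ Icc a b := ⟨hτ.1.le, hτ.2.le.trans hm1.2⟩
    have h2 : 1 ≤ Real.exp (D τ) := Real.one_le_exp (hD0 τ hτ')
    have h3 : ψ τ ≤ Real.exp (D τ) * ψ τ := le_mul_of_one_le_left (hψ0 τ) h2
    have := hy0 τ
    have := hδ0 τ
    have := hψ0 τ
    gcongr
  have h1 := h m hm1
  have h2 := hzint m hm1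
  have h3 : z m ^ 2 ≤ y m ^ 2 := pow_le_pow_left₀ (hz0 m hm1).le hm2 2
  nlinarith

/-- Pointwise application of a strongly measurable family of operators preserves strong
measurability. -/
lemma aestronglyMeasurable_clm_apply {α : Type*} [MeasurableSpace α] {μ : Measure α}
    {V W : Type*} [NormedAddCommGroup V] [NormedSpace ℝ V] [NormedAddCommGroup W]
    [NormedSpace ℝ W] {B : α → V →L[ℝ] W}
    (hB : ∀ v, AEStronglyMeasurable (fun t => B t v) μ) {w : α → V}
    (hw : AEStronglyMeasurable w μ) : AEStronglyMeasurable (fun t => B t (w t)) μ := by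
  obtain ⟨w', hw', hww'⟩ := hw
  have hs : ∀ s : SimpleFunc α V, AEStronglyMeasurable (fun t => B t (s t)) μ := by
    intro s
    have : (fun t => B t (s t)) =
        fun t => ∑ c ∈ s.range, (s ⁻¹' {c}).indicator (fun t => B t c) t := by
      funext t
      rw [Finset.sum_eq_single (s t)]
      · simp
      · intro c _ hc
        rw [indicator_of_notMem]
        simpa using hc.symm
      · intro h
        exact absurd (s.mem_range_self t) h
    rw [this]
    exact Finset.aestronglyMeasurable_fun_sum _ fun c _ =>
      (hB c).indicator (s.measurableSet_fiber c)
  refine AEStronglyMeasurable.congr (f := fun t => B t (w' t)) ?_ (by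
    filter_upwards [hww'] with t ht
    rw [ht])
  exact aestronglyMeasurable_of_tendsto_ae atTop (fun n => hs (hw'.approx n))
    (Eventually.of_forall fun t => ((B t).continuous.tendsto _).comp (hw'.tendsto_approx t))

end Energy

/-! ### Linear evolution equations with bounded operators -/

section LinearODE

lemma intervalIntegrable_of_integrable_Icc {V : Type*} [NormedAddCommGroup V] {a b : ℝ}
    (hab : a ≤ b) {g : ℝ → V} (hg : Integrable g (volume.restrict (Icc a b))) :
    IntervalIntegrable g volume a b :=
  (intervalIntegrable_iff_integrableOn_Icc_of_le hab).2 hg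

lemma intervalIntegrable_left {V : Type*} [NormedAddCommGroup V] {a b t : ℝ} {g : ℝ → V}
    (hg : Integrable g (volume.restrict (Icc a b))) (ht : t ∈ Icc a b) :
    IntervalIntegrable g volume a t :=
  (intervalIntegrable_iff_integrableOn_Icc_of_le ht.1).2
    (IntegrableOn.mono_set hg (Icc_subset_Icc le_rfl ht.2))

lemma ae_restrict_Icc_of_ae_uIoc {a b : ℝ} {p : ℝ → Prop}
    (h : ∀ᵐ t ∂(volume.restrict (Icc a b)), p t) {s t : ℝ} (hs : s ∈ Icc a b) (ht : t ∈ Icc a b) :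
    ∀ᵐ τ, τ ∈ uIoc s t → p τ := by
  rw [ae_restrict_iff' measurableSet_Icc] at h
  filter_upwards [h] with τ hτ hm
  exact hτ (uIcc_subset_Icc hs ht (uIoc_subset_uIcc hm))

variable {V : Type*} [NormedAddCommGroup V] [NormedSpace ℝ V] [CompleteSpace V]

/-- Existence for linear evolution equations with bounded, strongly measurable coefficients. -/
lemma exists_linear_evolution {a b : ℝ} (hab : a ≤ b) {A : ℝ → V →L[ℝ] V} {C : ℝ}
    (hAm : ∀ v, AEStronglyMeasurable (fun t => A t v) (volume.restrict (Icc a b)))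
    (hAb : ∀ᵐ t ∂(volume.restrict (Icc a b)), ‖A t‖ ≤ C) (F : C(Icc a b, V)) :
    ∃ u : C(Icc a b, V), ∀ t : Icc a b,
      u t = F t + ∫ τ in a..t, A τ (u (projIcc a b hab τ)) := by
  wlog hC : 0 ≤ C generalizing C
  · exact this (hAb.mono fun t ht => ht.trans (le_max_left C 0)) (le_max_right C 0)
  have : Nonempty (Icc a b) := ⟨⟨a, left_mem_Icc.2 hab⟩⟩
  -- The weight `exp (-m (t - a))` turns the integral equation into a contraction.
  set m : ℝ := 2 * C + 1 with hm
  have hm0 : 0 < m := by positivity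
  let G : C(Icc a b, V) → ℝ → V := fun v τ =>
    Real.exp (m * (τ - a)) • A τ (v (projIcc a b hab τ))
  have hG : ∀ v, Integrable (G v) (volume.restrict (Icc a b)) := by
    intro v
    have hmeas : AEStronglyMeasurable (G v) (volume.restrict (Icc a b)) := by
      refine AEStronglyMeasurable.smul ?_ (aestronglyMeasurable_clm_apply hAm ?_)
      · exact (by fun_prop : Continuous fun τ : ℝ => Real.exp (m * (τ - a))).aestronglyMeasurable
      · exact (v.continuous.comp continuous_projIcc).aestronglyMeasurable
    refine Integrable.mono' (g := fun _ => Real.exp (m * (b - a)) * (C * ‖v‖))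
      (integrable_const _) hmeas ?_
    filter_upwards [hAb, ae_restrict_mem measurableSet_Icc] with τ h1 h2
    rw [norm_smul, Real.norm_eq_abs, abs_of_pos (Real.exp_pos _)]
    refine mul_le_mul (Real.exp_le_exp.2 ?_) ?_ (norm_nonneg _) (Real.exp_pos _).le
    · exact mul_le_mul_of_nonneg_left (by linarith [h2.2]) hm0.le
    · exact (A τ).le_of_opNorm_le_of_le h1 (v.norm_coe_le_norm _)
  have hGi : ∀ v, ∀ t ∈ Icc a b, IntervalIntegrable (G v) volume a t := fun v t ht =>
    intervalIntegrable_left (hG v) ht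
  let Φ : C(Icc a b, V) → C(Icc a b, V) := fun v =>
    ⟨fun t => Real.exp (-(m * (t - a))) • (F t + ∫ τ in a..(t : ℝ), G v τ), by
      have h1 : ContinuousOn (fun t => ∫ τ in a..t, G v τ) (Icc a b) := by
        have := intervalIntegral.continuousOn_primitive_interval (a := a) (b := b) (f := G v)
          (μ := volume) (by rw [uIcc_of_le hab]; exact hG v)
        rwa [uIcc_of_le hab] at this
      have h2 : Continuous fun t : Icc a b => ∫ τ in a..(t : ℝ), G v τ :=
        continuousOn_iff_continuous_domRestrict.1 h1
      exact (by fun_prop : Continuous fun t : Icc a b => Real.exp (-(m * ((t : ℝ) - a)))).smul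
        (F.continuous.add h2)⟩
  have hΦ : ContractingWith (1 / 2) Φ := by
    refine ⟨by norm_num, LipschitzWith.of_dist_le_mul fun v w => ?_⟩
    rw [ContinuousMap.dist_le (by positivity)]
    intro t
    have hint : ‖∫ τ in a..(t : ℝ), (G v τ - G w τ)‖ ≤
        ∫ τ in a..(t : ℝ), Real.exp (m * (τ - a)) * (C * dist v w) := by
      refine intervalIntegral.norm_integral_le_of_norm_le t.2.1 ?_
        ((by fun_prop : Continuous fun τ : ℝ =>
          Real.exp (m * (τ - a)) * (C * dist v w)).intervalIntegrable _ _)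
      have := ae_restrict_Icc_of_ae_uIoc hAb (left_mem_Icc.2 hab) t.2
      rw [uIoc_of_le t.2.1] at this
      filter_upwards [this] with τ h1 h2
      have : G v τ - G w τ = Real.exp (m * (τ - a)) • A τ ((v - w) (projIcc a b hab τ)) := by
        simp [G, smul_sub]
      rw [this, norm_smul, Real.norm_eq_abs, abs_of_pos (Real.exp_pos _), dist_eq_norm]
      exact mul_le_mul_of_nonneg_left
        ((A τ).le_of_opNorm_le_of_le (h1 h2) ((v - w).norm_coe_le_norm _)) (Real.exp_pos _).le
    have hexp : ∫ τ in a..(t : ℝ), Real.exp (m * (τ - a)) * (C * dist v w) =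
        (Real.exp (m * (t - a)) - 1) / m * (C * dist v w) := by
      rw [intervalIntegral.integral_mul_const]
      congr 1
      have hd : ∀ x ∈ uIcc a (t : ℝ), HasDerivAt (fun τ => Real.exp (m * (τ - a)) / m)
          (Real.exp (m * (x - a))) x := by
        intro x _
        have := ((((hasDerivAt_id x).sub_const a).const_mul m).exp).div_const m
        convert! this using 1
        simp only [id]
        field_simp
      rw [intervalIntegral.integral_eq_sub_of_hasDerivAt hd
        ((by fun_prop : Continuous fun τ : ℝ => Real.exp (m * (τ - a))).intervalIntegrable _ _)]
      simp [sub_div]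
    have hsub : Φ v t - Φ w t =
        Real.exp (-(m * (t - a))) • ∫ τ in a..(t : ℝ), (G v τ - G w τ) := by
      rw [intervalIntegral.integral_sub (hGi v t t.2) (hGi w t t.2)]
      simp only [Φ, ContinuousMap.coe_mk, ← smul_sub]
      congr 1
      abel
    rw [dist_eq_norm, hsub, norm_smul, Real.norm_eq_abs, abs_of_pos (Real.exp_pos _)]
    calc Real.exp (-(m * (t - a))) * ‖∫ τ in a..(t : ℝ), (G v τ - G w τ)‖
        ≤ Real.exp (-(m * (t - a))) * ((Real.exp (m * (t - a)) - 1) / m * (C * dist v w)) := by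
          rw [← hexp]; gcongr
      _ = (1 - Real.exp (-(m * (t - a)))) * (C / m) * dist v w := by
          rw [Real.exp_neg]
          have := Real.exp_pos (m * (t - a))
          field_simp
      _ ≤ 1 * (1 / 2) * dist v w := by
          have h1 : C / m ≤ 1 / 2 := by rw [div_le_div_iff₀ hm0 two_pos]; linarith
          have h2 := Real.exp_pos (-(m * (t - a)))
          have h3 : 0 ≤ C / m := by positivity
          gcongr
          linarith
      _ = _ := by norm_num
  obtain ⟨v, hv⟩ : ∃ v, Φ v = v := ⟨_, hΦ.fixedPoint_isFixedPt⟩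
  refine ⟨⟨fun t => Real.exp (m * (t - a)) • v t, by fun_prop⟩, fun t => ?_⟩
  have h1 : v t = Real.exp (-(m * (t - a))) • (F t + ∫ τ in a..(t : ℝ), G v τ) := by
    conv_lhs => rw [← hv]
    rfl
  simp only [ContinuousMap.coe_mk]
  rw [h1, smul_smul, ← Real.exp_add, add_neg_cancel, Real.exp_zero, one_smul]
  congr 1
  refine intervalIntegral.integral_congr fun τ hτ => ?_
  have hτ' : τ ∈ Icc a b := uIcc_subset_Icc (left_mem_Icc.2 hab) t.2 hτ
  simp only [G]
  rw [map_smul, projIcc_of_mem hab hτ']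

end LinearODE

/-! ### Evolution equations with unbounded operators -/

section WeakConvergence

/-- Bounded sequences in a separable Hilbert space have weakly convergent subsequences. -/
lemma exists_weak_subseq_limit {X : Type*} [NormedAddCommGroup X] [InnerProductSpace ℝ X]
    [CompleteSpace X] [SecondCountableTopology X] {w : ℕ → X} {R : ℝ} (hw : ∀ k, ‖w k‖ ≤ R) :
    ∃ x : X, ∃ σ : ℕ → ℕ, StrictMono σ ∧
      ∀ y, Tendsto (fun k => ⟪w (σ k), y⟫) atTop (𝓝 ⟪x, y⟫) := by
  obtain ⟨l, -, σ, hσ, hl⟩ := WeakDual.isSeqCompact_closedBall ℝ X (0 : StrongDual ℝ X) R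
    (x := fun k => StrongDual.toWeakDual (InnerProductSpace.toDual ℝ X (w k)))
    (fun k => by simpa using hw k)
  refine ⟨(InnerProductSpace.toDual ℝ X).symm (WeakDual.toStrongDual l), σ, hσ, fun y => ?_⟩
  have := (WeakDual.eval_continuous (𝕜 := ℝ) y).tendsto l |>.comp hl
  rw [InnerProductSpace.toDual_symm_apply]
  exact this

lemma tendsto_inner_of_weak_of_strong {X : Type*} [NormedAddCommGroup X] [InnerProductSpace ℝ X]
    {w y : ℕ → X} {x z : X} {R : ℝ} (hw : ∀ k, ‖w k‖ ≤ R)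
    (hx : ∀ y, Tendsto (fun k => ⟪w k, y⟫) atTop (𝓝 ⟪x, y⟫)) (hy : Tendsto y atTop (𝓝 z)) :
    Tendsto (fun k => ⟪w k, y k⟫) atTop (𝓝 ⟪x, z⟫) := by
  have h1 : Tendsto (fun k => ⟪w k, y k - z⟫) atTop (𝓝 0) := by
    refine squeeze_zero_norm (a := fun k => R * ‖y k - z‖) (fun k => ?_) ?_
    · exact (norm_inner_le_norm _ _).trans (mul_le_mul_of_nonneg_right (hw k) (norm_nonneg _))
    · simpa using (tendsto_iff_norm_sub_tendsto_zero.1 hy).const_mul R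
  simpa [inner_sub_right] using h1.add (hx z)

/-- Bounded convergence in `L²` of a finite measure. -/
lemma tendsto_toLp_two {α : Type*} [MeasurableSpace α] {μ : Measure α} [IsFiniteMeasure μ]
    {K : Type*} [NormedAddCommGroup K] [InnerProductSpace ℝ K] {f : ℕ → α → K} {g : α → K} {M : ℝ}
    (hf : ∀ k, MemLp (f k) 2 μ) (hg : MemLp g 2 μ) (hM : ∀ k, ∀ᵐ t ∂μ, ‖f k t‖ ≤ M)
    (hlim : ∀ᵐ t ∂μ, Tendsto (fun k => f k t) atTop (𝓝 (g t))) :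
    Tendsto (fun k => (hf k).toLp) atTop (𝓝 hg.toLp) := by
  have hgM : ∀ᵐ t ∂μ, ‖g t‖ ≤ M := by
    filter_upwards [hlim, ae_all_iff.2 hM] with t h1 h2
    exact le_of_tendsto h1.norm (Eventually.of_forall h2)
  have hsq : ∀ k, ‖(hf k).toLp - hg.toLp‖ ^ 2 = ∫ t, ‖f k t - g t‖ ^ 2 ∂μ := by
    intro k
    rw [← real_inner_self_eq_norm_sq, L2.inner_def]
    refine integral_congr_ae ?_
    filter_upwards [(hf k).coeFn_toLp, hg.coeFn_toLp, Lp.coeFn_sub (hf k).toLp hg.toLp]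
      with t h1 h2 h3
    rw [h3, Pi.sub_apply, h1, h2, real_inner_self_eq_norm_sq]
  have hlim2 : Tendsto (fun k => ∫ t, ‖f k t - g t‖ ^ 2 ∂μ) atTop (𝓝 (∫ _, (0 : ℝ) ∂μ)) := by
    refine tendsto_integral_of_dominated_convergence (fun _ => (M + M) ^ 2)
      (fun k => ((hf k).1.sub hg.1).norm.pow 2) (integrable_const _) (fun k => ?_) ?_
    · filter_upwards [hM k, hgM] with t h1 h2
      rw [Real.norm_eq_abs, abs_of_nonneg (by positivity)]
      exact pow_le_pow_left₀ (norm_nonneg _) ((norm_sub_le _ _).trans (add_le_add h1 h2)) 2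
    · filter_upwards [hlim] with t ht
      simpa using ((tendsto_iff_norm_sub_tendsto_zero.1 ht).pow 2)
  rw [integral_zero] at hlim2
  rw [tendsto_iff_norm_sub_tendsto_zero]
  have := (hlim2.congr fun k => (hsq k).symm).sqrt
  simpa [Real.sqrt_sq (norm_nonneg _)] using this

end WeakConvergence

section Existence

variable {H K : Type*} [NormedAddCommGroup H] [InnerProductSpace ℝ H] [CompleteSpace H]
  [NormedAddCommGroup K] [InnerProductSpace ℝ K] [CompleteSpace K]

/-- The a priori estimate: a quasi-dissipative evolution grows at most like the exponential of its
growth rate. -/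
lemma evolution_norm_le {a b : ℝ} (hab : a ≤ b) {u g : ℝ → K} {u0 : K} {δ ψ : ℝ → ℝ}
    (hδ : IntervalIntegrable δ volume a b) (hδ0 : ∀ t, 0 ≤ δ t)
    (hψ : IntervalIntegrable ψ volume a b) (hψ0 : ∀ t, 0 ≤ ψ t)
    (hg : IntervalIntegrable g volume a b) (hu : ∀ t ∈ Icc a b, u t = u0 + ∫ τ in a..t, g τ)
    (hdis : ∀ᵐ t ∂(volume.restrict (Icc a b)), ⟪u t, g t⟫ ≤ δ t * ‖u t‖ ^ 2 + ψ t * ‖u t‖)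
    {t : ℝ} (ht : t ∈ Icc a b) :
    ‖u t‖ ≤ Real.exp (∫ τ in a..t, δ τ) * (‖u0‖ + ∫ τ in a..t, ψ τ) := by
  have huc : ContinuousOn u (Icc a b) := by
    have h1 := intervalIntegral.continuousOn_primitive_interval (a := a) (b := b) (f := g)
      (μ := volume) (by
        rw [uIcc_of_le hab]; exact (intervalIntegrable_iff_integrableOn_Icc_of_le hab).1 hg)
    rw [uIcc_of_le hab] at h1
    exact (continuousOn_const.add h1).congr hu
  refine gronwall_sq hab (norm_nonneg u0) huc.norm (fun t => norm_nonneg _) hδ hδ0 hψ hψ0 ?_ ht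
  intro s hs
  rw [norm_sq_primitive hab hg hu hs]
  have hsub : uIcc a s ⊆ uIcc a b := by
    rw [uIcc_of_le hab, uIcc_of_le hs.1]; exact Icc_subset_Icc le_rfl hs.2
  have huc' : ContinuousOn u (uIcc a s) := huc.mono (uIcc_of_le hab ▸ hsub)
  have hgs := hg.mono_set hsub
  have i1 : IntervalIntegrable (fun τ => ⟪u τ, g τ⟫) volume a s := by
    rw [intervalIntegrable_iff_integrableOn_Icc_of_le hs.1] at hgs ⊢
    rw [uIcc_of_le hs.1] at huc'
    obtain ⟨R, hR⟩ := isCompact_Icc.exists_bound_of_continuousOn huc'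
    refine Integrable.mono' (hgs.norm.const_mul R)
      ((huc'.aestronglyMeasurable measurableSet_Icc).inner hgs.1) ?_
    filter_upwards [ae_restrict_mem measurableSet_Icc] with τ hτ
    exact (norm_inner_le_norm _ _).trans (mul_le_mul_of_nonneg_right (hR τ hτ) (norm_nonneg _))
  have i2 : IntervalIntegrable (fun τ => δ τ * ‖u τ‖ ^ 2 + ψ τ * ‖u τ‖) volume a s :=
    ((hδ.mono_set hsub).mul_continuousOn (huc'.norm.pow 2)).add
      ((hψ.mono_set hsub).mul_continuousOn huc'.norm)
  have : ∫ τ in a..s, ⟪u τ, g τ⟫ ≤ ∫ τ in a..s, (δ τ * ‖u τ‖ ^ 2 + ψ τ * ‖u τ‖) := by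
    refine intervalIntegral.integral_mono_ae_restrict hs.1 i1 i2 ?_
    exact ae_restrict_of_ae_restrict_of_subset (Icc_subset_Icc le_rfl hs.2) hdis
  linarith

/-- Existence for an evolution equation driven by unbounded operators `B t`, with domain `H` inside
`K`, from approximations `A k t` that are bounded and uniformly quasi-dissipative on `H`. Only the
adjoints of the approximations have to converge. -/
theorem exists_evolution [SecondCountableTopology H] {a b : ℝ} (hab : a ≤ b) {J : H →L[ℝ] K}
    (hJ : DenseRange J) {B : ℝ → H →L[ℝ] K} {A : ℕ → ℝ → H →L[ℝ] H} {C l : ℝ}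
    (hBm : ∀ v, AEStronglyMeasurable (fun t => B t v) (volume.restrict (Icc a b)))
    (hBb : ∀ᵐ t ∂(volume.restrict (Icc a b)), ‖B t‖ ≤ C)
    (hAm : ∀ k v, AEStronglyMeasurable (fun t => A k t v) (volume.restrict (Icc a b)))
    (hAb : ∀ k, ∃ C, ∀ᵐ t ∂(volume.restrict (Icc a b)), ‖A k t‖ ≤ C) (hl : 0 ≤ l)
    (hAd : ∀ k, ∀ᵐ t ∂(volume.restrict (Icc a b)), ∀ u, ⟪u, A k t u⟫ ≤ l * ‖u‖ ^ 2)
    (hadj : ∀ ζ : H, ∃ (M : ℝ) (y : ℕ → ℝ → K) (y' : ℝ → K),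
      (∀ k, AEStronglyMeasurable (y k) (volume.restrict (Icc a b))) ∧
      (∀ k, ∀ᵐ t ∂(volume.restrict (Icc a b)), ‖y k t‖ ≤ M) ∧
      (∀ᵐ t ∂(volume.restrict (Icc a b)), Tendsto (fun k => y k t) atTop (𝓝 (y' t))) ∧
      (∀ k, ∀ᵐ t ∂(volume.restrict (Icc a b)), ∀ u, ⟪J (A k t u), J ζ⟫ = ⟪J u, y k t⟫) ∧
      (∀ᵐ t ∂(volume.restrict (Icc a b)), ∀ u, ⟪B t u, J ζ⟫ = ⟪J u, y' t⟫))
    (ρ : H) {φ : ℝ → H} (hφ : MemLp φ 2 (volume.restrict (Icc a b))) :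
    ∃ w : ℝ → H, MemLp w 2 (volume.restrict (Icc a b)) ∧
      ∀ᵐ t ∂(volume.restrict (Icc a b)),
        J (w t) = J ρ + ∫ τ in a..t, (B τ (w τ) + J (φ τ)) := by
  set μ : Measure ℝ := volume.restrict (Icc a b) with hμ
  have ha : a ∈ Icc a b := left_mem_Icc.2 hab
  have hφi : Integrable φ μ := hφ.integrable (by norm_num)
  have hφI : IntervalIntegrable φ volume a b := intervalIntegrable_of_integrable_Icc hab hφi
  -- Bounded approximate solutions.
  have hF : Continuous fun t : Icc a b => ρ + ∫ τ in a..(t : ℝ), φ τ := by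
    have := intervalIntegral.continuousOn_primitive_interval (a := a) (b := b) (f := φ)
      (μ := volume) (by rw [uIcc_of_le hab]; exact hφi)
    rw [uIcc_of_le hab] at this
    exact continuous_const.add (continuousOn_iff_continuous_domRestrict.1 this)
  have hsol : ∀ k, ∃ u : C(Icc a b, H), ∀ t : Icc a b,
      u t = (ρ + ∫ τ in a..(t : ℝ), φ τ) + ∫ τ in a..t, A k τ (u (projIcc a b hab τ)) := fun k => by
    obtain ⟨C, hC⟩ := hAb k
    exact exists_linear_evolution hab (hAm k) hC ⟨_, hF⟩
  choose u₀ hu₀ using hsol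
  set u : ℕ → ℝ → H := fun k t => u₀ k (projIcc a b hab t) with hudef
  have huc : ∀ k, Continuous (u k) := fun k => (u₀ k).continuous.comp continuous_projIcc
  have hAi : ∀ k, Integrable (fun τ => A k τ (u k τ)) μ := fun k => by
    obtain ⟨C, hC⟩ := hAb k
    refine Integrable.mono' (g := fun _ => C * ‖u₀ k‖) (integrable_const _)
      (aestronglyMeasurable_clm_apply (hAm k) (huc k).aestronglyMeasurable) ?_
    filter_upwards [hC] with t ht
    exact (A k t).le_of_opNorm_le_of_le ht ((u₀ k).norm_coe_le_norm _)
  have hu : ∀ k, ∀ t ∈ Icc a b, u k t = ρ + ∫ τ in a..t, (A k τ (u k τ) + φ τ) := by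
    intro k t ht
    rw [intervalIntegral.integral_add (intervalIntegrable_left (hAi k) ht)
      (intervalIntegrable_left hφi ht)]
    have := hu₀ k ⟨t, ht⟩
    simp only [hudef]
    rw [projIcc_of_mem hab ht, this]
    abel
  set R : ℝ := Real.exp (l * (b - a)) * (‖ρ‖ + ∫ τ in a..b, ‖φ τ‖) with hR
  have huR : ∀ k, ∀ t ∈ Icc a b, ‖u k t‖ ≤ R := by
    intro k t ht
    refine (evolution_norm_le hab (δ := fun _ => l) (ψ := fun t => ‖φ t‖)
      intervalIntegrable_const (fun _ => hl) hφI.norm (fun _ => norm_nonneg _)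
      (intervalIntegrable_of_integrable_Icc hab ((hAi k).add hφi)) (hu k) ?_ ht).trans ?_
    · filter_upwards [hAd k] with t ht
      simp only [Pi.add_apply]
      rw [inner_add_right]
      refine add_le_add (ht _) ((real_inner_le_norm _ _).trans_eq (mul_comm _ _))
    · have h1 : ∫ τ in a..t, ‖φ τ‖ ≤ ∫ τ in a..b, ‖φ τ‖ :=
        intervalIntegral.integral_mono_interval le_rfl ht.1 ht.2
          (Eventually.of_forall fun _ => norm_nonneg _) hφI.norm
      have h2 : 0 ≤ ∫ τ in a..t, ‖φ τ‖ :=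
        intervalIntegral.integral_nonneg ht.1 fun _ _ => norm_nonneg _
      have h3 : ∫ τ in a..t, l ≤ l * (b - a) := by
        rw [intervalIntegral.integral_const, smul_eq_mul, mul_comm]
        exact mul_le_mul_of_nonneg_left (by linarith [ht.2]) hl
      rw [hR]
      gcongr
  have huM : ∀ k, MemLp (u k) 2 μ := fun k => MemLp.of_bound (huc k).aestronglyMeasurable R (by
    filter_upwards [ae_restrict_mem measurableSet_Icc] with t ht using huR k t ht)
  have : Fact ((2 : ℝ≥0∞) ≠ ⊤) := ⟨by norm_num⟩
  obtain ⟨w, σ, hσ, hw⟩ := exists_weak_subseq_limit (w := fun k => (huM k).toLp)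
    (R := (measureUnivNNReal μ : ℝ) ^ (2 : ℝ≥0∞).toReal⁻¹ * R) (fun k =>
      Lp.norm_le_of_ae_bound ((norm_nonneg _).trans (huR k a ha)) (by
        filter_upwards [(huM k).coeFn_toLp, ae_restrict_mem measurableSet_Icc] with t h1 h2
        rw [h1]; exact huR k t h2))
  refine ⟨w, Lp.memLp w, ?_⟩
  have hBw : Integrable (fun τ => B τ (w τ)) μ := by
    refine Integrable.mono' (((Lp.memLp w).integrable (by norm_num)).norm.const_mul C)
      (aestronglyMeasurable_clm_apply hBm (Lp.aestronglyMeasurable w)) ?_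
    filter_upwards [hBb] with t ht
    exact (B t).le_of_opNorm_le ht _
  have hJw : Integrable (fun τ => J (w τ)) μ :=
    J.integrable_comp ((Lp.memLp w).integrable (by norm_num))
  have hJφ : Integrable (fun τ => J (φ τ)) μ := J.integrable_comp hφi
  have hBJ : Integrable (fun τ => B τ (w τ) + J (φ τ)) μ := hBw.add hJφ
  set v : ℝ → K := fun t => J ρ + ∫ τ in a..t, (B τ (w τ) + J (φ τ)) with hv
  -- The image in `L²(K)` of the weak convergence.
  have hweak : ∀ y : ℕ → Lp K 2 μ, ∀ z : Lp K 2 μ, Tendsto y atTop (𝓝 z) →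
      Tendsto (fun k => ∫ t, ⟪J (u (σ k) t), y k t⟫ ∂μ) atTop (𝓝 (∫ t, ⟪J (w t), z t⟫ ∂μ)) := by
    intro y z hyz
    have h1 := tendsto_inner_of_weak_of_strong
      (R := (measureUnivNNReal μ : ℝ) ^ (2 : ℝ≥0∞).toReal⁻¹ * R)
      (fun k => Lp.norm_le_of_ae_bound ((norm_nonneg _).trans (huR (σ k) a ha)) (by
        filter_upwards [(huM (σ k)).coeFn_toLp, ae_restrict_mem measurableSet_Icc] with t h1 h2
        rw [h1]; exact huR (σ k) t h2)) hw
      (((J.compLpL 2 μ).adjoint.continuous.tendsto z).comp hyz)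
    have h2 : ∀ (f : Lp H 2 μ) (y : Lp K 2 μ),
        ⟪f, (J.compLpL 2 μ).adjoint y⟫ = ∫ t, ⟪J (f t), y t⟫ ∂μ := by
      intro f y
      rw [ContinuousLinearMap.adjoint_inner_right, L2.inner_def]
      refine integral_congr_ae ?_
      filter_upwards [J.coeFn_compLpL f] with t ht
      rw [ht]
    rw [h2] at h1
    refine h1.congr fun k => ?_
    rw [Function.comp_apply, h2]
    refine integral_congr_ae ?_
    filter_upwards [(huM (σ k)).coeFn_toLp] with t ht
    rw [ht]
  -- Weak convergence of the generators, tested against `J ζ` on a measurable set.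
  have hgen : ∀ (Q : Set ℝ), MeasurableSet Q → ∀ ζ : H,
      Tendsto (fun k => ∫ t in Q, ⟪J (A (σ k) t (u (σ k) t)), J ζ⟫ ∂μ) atTop
        (𝓝 (∫ t in Q, ⟪B t (w t), J ζ⟫ ∂μ)) := by
    intro Q hQ ζ
    obtain ⟨M, y, y', hym, hyM, hylim, hyA, hyB⟩ := hadj ζ
    have hy'm : AEStronglyMeasurable y' μ := aestronglyMeasurable_of_tendsto_ae atTop hym hylim
    have hy'M : ∀ᵐ t ∂μ, ‖y' t‖ ≤ M := by
      filter_upwards [hylim, ae_all_iff.2 hyM] with t h1 h2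
      exact le_of_tendsto h1.norm (Eventually.of_forall h2)
    have hI : ∀ {f : ℝ → K}, AEStronglyMeasurable f μ → (∀ᵐ t ∂μ, ‖f t‖ ≤ M) →
        MemLp (Q.indicator f) 2 μ := fun h1 h2 => (MemLp.of_bound h1 M h2).indicator hQ
    have hlim := tendsto_toLp_two (M := M) (fun k => hI (hym (σ k)) (hyM (σ k))) (hI hy'm hy'M)
      (fun k => by
        filter_upwards [hyM (σ k)] with t ht
        exact (norm_indicator_le_norm_self _ _).trans ht) (by
        filter_upwards [hylim] with t ht
        by_cases htQ : t ∈ Q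
        · simp only [htQ, indicator_of_mem]
          exact ht.comp hσ.tendsto_atTop
        · simp [htQ])
    have := hweak _ _ hlim
    have e1 : ∀ k, ∫ t in Q, ⟪J (A (σ k) t (u (σ k) t)), J ζ⟫ ∂μ =
        ∫ t, ⟪J (u (σ k) t),
          ((hI (hym (σ k)) (hyM (σ k))).toLp (Q.indicator (y (σ k))) : Lp K 2 μ) t⟫ ∂μ := by
      intro k
      rw [← integral_indicator hQ]
      refine integral_congr_ae ?_
      filter_upwards [hyA (σ k), (hI (hym (σ k)) (hyM (σ k))).coeFn_toLp] with t h1 h2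
      rw [h2]
      by_cases htQ : t ∈ Q
      · simp [htQ, h1]
      · simp [htQ]
    have e2 : ∫ t in Q, ⟪B t (w t), J ζ⟫ ∂μ =
        ∫ t, ⟪J (w t), ((hI hy'm hy'M).toLp (Q.indicator y') : Lp K 2 μ) t⟫ ∂μ := by
      rw [← integral_indicator hQ]
      refine integral_congr_ae ?_
      filter_upwards [hyB, (hI hy'm hy'M).coeFn_toLp] with t h1 h2
      rw [h2]
      by_cases htQ : t ∈ Q
      · simp [htQ, h1]
      · simp [htQ]
    rw [e2]
    exact this.congr fun k => (e1 k).symm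
  have hIoc : ∀ {t : ℝ}, t ∈ Icc a b → ∀ f : ℝ → ℝ,
      ∫ τ in a..t, f τ = ∫ τ in Ioc a t, f τ ∂μ := by
    intro t ht f
    rw [intervalIntegral.integral_of_le ht.1, hμ, Measure.restrict_restrict measurableSet_Ioc,
      inter_eq_left.2 (Ioc_subset_Icc_self.trans (Icc_subset_Icc le_rfl ht.2))]
  -- Pointwise in time, the approximate solutions converge to `v` against `J ζ`.
  have hpt : ∀ t ∈ Icc a b, ∀ ζ : H,
      Tendsto (fun k => ⟪J (u (σ k) t), J ζ⟫) atTop (𝓝 ⟪v t, J ζ⟫) := by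
    intro t ht ζ
    have hin : ∀ {g : ℝ → K}, Integrable g μ →
        ⟪∫ τ in a..t, g τ, J ζ⟫ = ∫ τ in a..t, ⟪g τ, J ζ⟫ := by
      intro g hg
      have := (innerSL ℝ (J ζ)).intervalIntegral_comp_comm (intervalIntegrable_left hg ht)
      simp only [innerSL_apply_apply] at this
      rw [real_inner_comm, ← this]
      exact intervalIntegral.integral_congr fun τ _ => real_inner_comm _ _
    have hint : ∀ {g : ℝ → K}, Integrable g μ →
        IntervalIntegrable (fun τ => ⟪g τ, J ζ⟫) volume a t := fun hg =>
      intervalIntegrable_left (hg.inner_const (𝕜 := ℝ) (J ζ)) ht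
    have e1 : ∀ k, ⟪J (u k t), J ζ⟫ = ⟪J ρ, J ζ⟫ +
        ((∫ τ in Ioc a t, ⟪J (A k τ (u k τ)), J ζ⟫ ∂μ) + ∫ τ in a..t, ⟪J (φ τ), J ζ⟫) := by
      intro k
      have hs : Integrable (fun τ => A k τ (u k τ) + φ τ) μ := (hAi k).add hφi
      have hJs : Integrable (fun τ => J (A k τ (u k τ)) + J (φ τ)) μ :=
        (J.integrable_comp (hAi k)).add hJφ
      have h1 : J (∫ τ in a..t, (A k τ (u k τ) + φ τ)) =
          ∫ τ in a..t, (J (A k τ (u k τ)) + J (φ τ)) := by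
        rw [← J.intervalIntegral_comp_comm (intervalIntegrable_left hs ht)]
        simp
      rw [hu k t ht, map_add, h1, inner_add_left,
        hin hJs, ← hIoc ht,
        ← intervalIntegral.integral_add (hint (J.integrable_comp (hAi k))) (hint hJφ)]
      simp [inner_add_left]
    have e2 : ⟪v t, J ζ⟫ = ⟪J ρ, J ζ⟫ +
        ((∫ τ in Ioc a t, ⟪B τ (w τ), J ζ⟫ ∂μ) + ∫ τ in a..t, ⟪J (φ τ), J ζ⟫) := by
      rw [hv, inner_add_left, hin hBJ, ← hIoc ht,
        ← intervalIntegral.integral_add (hint hBw) (hint hJφ)]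
      simp [inner_add_left]
    rw [e2]
    refine Tendsto.congr (fun k => (e1 (σ k)).symm) ?_
    exact (((hgen _ measurableSet_Ioc ζ).add_const _).const_add _)
  have hvi : Integrable v μ := by
    refine ContinuousOn.integrableOn_Icc (continuousOn_const.add ?_)
    have := intervalIntegral.continuousOn_primitive_interval (a := a) (b := b)
      (f := fun τ => B τ (w τ) + J (φ τ)) (μ := volume)
      (by rw [uIcc_of_le hab]; exact hBw.add hJφ)
    rwa [uIcc_of_le hab] at this
  -- `J ∘ w` and `v` are both the limit of `J ∘ u (σ k)`, tested against `J ζ` on measurable sets.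
  change (fun t => J (w t)) =ᵐ[μ] v
  refine hJw.ae_eq_of_forall_setIntegral_eq _ _ hvi fun Q hQ _ => ?_
  refine hJ.eq_of_inner_left ℝ fun ζ => ?_
  have hin : ∀ {g : ℝ → K}, Integrable g μ →
      ⟪∫ τ in Q, g τ ∂μ, J ζ⟫ = ∫ τ in Q, ⟪g τ, J ζ⟫ ∂μ := by
    intro g hg
    have := (innerSL ℝ (J ζ)).integral_comp_comm (hg.restrict (s := Q))
    simp only [innerSL_apply_apply] at this
    rw [real_inner_comm, ← this]
    exact integral_congr_ae (Eventually.of_forall fun τ => real_inner_comm _ _)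
  rw [hin hJw, hin hvi]
  have l1 : Tendsto (fun k => ∫ t in Q, ⟪J (u (σ k) t), J ζ⟫ ∂μ) atTop
      (𝓝 (∫ t in Q, ⟪v t, J ζ⟫ ∂μ)) := by
    refine tendsto_integral_of_dominated_convergence (fun _ => ‖J‖ * R * ‖J ζ‖)
      (fun k => ((J.continuous.comp (huc (σ k))).inner continuous_const).aestronglyMeasurable)
      (integrable_const _) (fun k => ?_) ?_
    · refine ae_restrict_of_ae ?_
      filter_upwards [ae_restrict_mem measurableSet_Icc] with t ht
      refine (norm_inner_le_norm _ _).trans (mul_le_mul_of_nonneg_right ?_ (norm_nonneg _))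
      exact J.le_opNorm_of_le (huR _ t ht)
    · refine ae_restrict_of_ae ?_
      filter_upwards [ae_restrict_mem measurableSet_Icc] with t ht using hpt t ht ζ
  have l2 := hweak (fun _ => indicatorConstLp 2 hQ (measure_ne_top μ Q) (J ζ)) _ tendsto_const_nhds
  have e3 : ∀ g : ℝ → K, ∫ t, ⟪g t, indicatorConstLp 2 hQ (measure_ne_top μ Q) (J ζ) t⟫ ∂μ =
      ∫ t in Q, ⟪g t, J ζ⟫ ∂μ := by
    intro g
    rw [← integral_indicator hQ]
    refine integral_congr_ae ?_
    filter_upwards [indicatorConstLp_coeFn (p := 2) (hs := hQ) (hμs := measure_ne_top μ Q)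
      (c := J ζ)] with t ht
    rw [ht]
    by_cases htQ : t ∈ Q <;> simp [htQ]
  rw [e3] at l2
  exact tendsto_nhds_unique (l2.congr fun k => e3 _) l1

end Existence

/-! ### Translations and weak derivatives -/

noncomputable section Translations

variable {n : ℕ}

/-- The `i`-th coordinate direction of `ℝⁿ`. -/
abbrev dir (i : Fin n) : E n := EuclideanSpace.single i 1

lemma norm_dir (i : Fin n) : ‖dir i‖ = 1 := by simp

/-- The translation `u ↦ u(· + s eᵢ)` on `L₂(ℝⁿ)`. -/
def shift (i : Fin n) (s : ℝ) : H0 n →ₗᵢ[ℝ] H0 n :=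
  Lp.compMeasurePreservingₗᵢ ℝ (fun x => x + s • dir i)
    (measurePreserving_add_right (volume : Measure (E n)) (s • dir i))

lemma coeFn_shift (i : Fin n) (s : ℝ) (u : H0 n) :
    shift i s u =ᵐ[volume] fun x => u (x + s • dir i) :=
  Lp.coeFn_compMeasurePreserving u (measurePreserving_add_right volume (s • dir i))

lemma quasiMeasurePreserving_shift (i : Fin n) (s : ℝ) :
    Measure.QuasiMeasurePreserving (fun x : E n => x + s • dir i) volume volume :=
  (measurePreserving_add_right (volume : Measure (E n)) (s • dir i)).quasiMeasurePreserving

lemma shift_add (i : Fin n) (s t : ℝ) (u : H0 n) :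
    shift i (s + t) u = shift i s (shift i t u) := by
  refine Lp.ext ?_
  filter_upwards [coeFn_shift i s (shift i t u), coeFn_shift i (s + t) u,
    (quasiMeasurePreserving_shift i s).ae (coeFn_shift i t u)] with x h1 h2 h3
  rw [h1, h2, h3, add_smul, add_assoc]

lemma shift_zero (i : Fin n) (u : H0 n) : shift i 0 u = u := by
  refine Lp.ext ?_
  filter_upwards [coeFn_shift i 0 u] with x h1
  rw [h1, zero_smul, add_zero]

lemma shift_neg_shift (i : Fin n) (s : ℝ) (u : H0 n) : shift i (-s) (shift i s u) = u := by
  rw [← shift_add, neg_add_cancel, shift_zero]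

lemma inner_shift_left (i : Fin n) (s : ℝ) (u v : H0 n) :
    ⟪shift i s u, v⟫ = ⟪u, shift i (-s) v⟫ := by
  rw [← (shift i (-s)).inner_map_map, shift_neg_shift]

lemma continuous_shift (i : Fin n) (u : H0 n) : Continuous fun s => shift i s u := by
  have hg : Continuous fun s : ℝ =>
      (⟨fun x => x + s • dir i, by fun_prop⟩ : C(E n, E n)) := by
    refine ContinuousMap.continuous_of_continuous_uncurry _ ?_
    simp only [Function.uncurry_def, ContinuousMap.coe_mk]
    fun_prop
  exact Continuous.compMeasurePreservingLp (f := fun _ => u) continuous_const hg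
    (fun s => measurePreserving_add_right volume (s • dir i)) (by norm_num)

lemma hasDerivAt_line {i : Fin n} {g : E n → ℝ} (h : ∀ x, HasPd i g x) (x : E n) (s : ℝ) :
    HasDerivAt (fun s : ℝ => g (x + s • dir i)) (pd i g (x + s • dir i)) s := by
  have h1 : HasDerivAt (fun t : ℝ => g (x + s • dir i + t • dir i)) (pd i g (x + s • dir i))
      (s - s) := by
    rw [sub_self]; exact (h (x + s • dir i)).hasLineDerivAt
  have h2 := h1.comp_sub_const s s
  refine h2.congr_of_eventuallyEq (Eventually.of_forall fun t => ?_)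
  simp only [sub_smul]
  congr 1
  abel

lemma hasPd_of_contDiff (i : Fin n) {η : E n → ℝ} (h : ContDiff ℝ ∞ η) (x : E n) :
    HasPd i η x :=
  ((h.differentiable (by simp)) x).lineDifferentiableAt

/-- A test function as an element of `L₂`. -/
def test (η : E n → ℝ) (h : Continuous η) (hc : HasCompactSupport η) : H0 n :=
  (h.memLp_of_hasCompactSupport hc (p := 2)).toLp

lemma inner_test (u : H0 n) {η : E n → ℝ} (h : Continuous η) (hc : HasCompactSupport η) :
    ⟪u, test η h hc⟫ = ∫ x, u x * η x := by
  rw [L2.inner_def]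
  refine integral_congr_ae ?_
  filter_upwards [(h.memLp_of_hasCompactSupport (μ := volume) hc (p := 2)).coeFn_toLp] with x hx
  rw [test, hx]
  simp [mul_comm]

lemma hasWeakPd_iff (i : Fin n) (u w : H0 n) : HasWeakPd i u w ↔
    ∀ (η : E n → ℝ) (h : ContDiff ℝ ∞ η) (hc : HasCompactSupport η),
      ⟪u, test (pd i η) (pd_continuous i h) (pd_compactSupport i h hc)⟫ =
        -⟪w, test η h.continuous hc⟫ := by
  simp only [inner_test]
  rfl

lemma dense_test : Dense {u : H0 n | ∃ (η : E n → ℝ) (h : ContDiff ℝ ∞ η)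
    (hc : HasCompactSupport η), u = test η h.continuous hc} := by
  refine (Lp.dense_hasCompactSupport_contDiff (F := ℝ) (μ := (volume : Measure (E n)))
    (p := 2) (by norm_num)).mono ?_
  rintro u ⟨η, h1, h2, h3⟩
  refine ⟨η, h3, h2, Lp.ext ?_⟩
  exact h1.trans (h3.continuous.memLp_of_hasCompactSupport h2).coeFn_toLp.symm

lemma eq_of_inner_test {u w : H0 n} (huw : ∀ (η : E n → ℝ) (h : ContDiff ℝ ∞ η)
    (hc : HasCompactSupport η), ⟪u, test η h.continuous hc⟫ = ⟪w, test η h.continuous hc⟫) :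
    u = w := by
  refine dense_test.eq_of_inner_left ℝ fun v hv => ?_
  obtain ⟨η, h, hc, rfl⟩ := hv
  exact huw η h hc

lemma contDiff_translate {η : E n → ℝ} (h : ContDiff ℝ ∞ η) (y : E n) :
    ContDiff ℝ ∞ fun x => η (x + y) := h.comp (by fun_prop)

lemma hasCompactSupport_translate {η : E n → ℝ} (hc : HasCompactSupport η) (y : E n) :
    HasCompactSupport fun x => η (x + y) :=
  hc.comp_homeomorph (Homeomorph.addRight y)

lemma shift_test (i : Fin n) (s : ℝ) {η : E n → ℝ} (h : Continuous η) (hc : HasCompactSupport η) :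
    shift i s (test η h hc) = test (fun x => η (x + s • dir i)) (h.comp (by fun_prop))
      (hasCompactSupport_translate hc _) := by
  refine Lp.ext ?_
  have h1 := (h.memLp_of_hasCompactSupport (μ := volume) hc (p := 2)).coeFn_toLp
  filter_upwards [coeFn_shift i s (test η h hc),
    ((h.comp (by fun_prop : Continuous fun x => x + s • dir i)).memLp_of_hasCompactSupport
      (μ := volume) (hasCompactSupport_translate hc _) (p := 2)).coeFn_toLp,
    (quasiMeasurePreserving_shift i s).ae h1] with x h2 h3 h4
  rw [h2]
  exact h4.trans h3.symm

lemma pd_translate (i : Fin n) (η : E n → ℝ) (y x : E n) :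
    pd i (fun x => η (x + y)) x = pd i η (x + y) := by
  simp only [pd, lineDeriv]
  congr 1
  funext t
  rw [add_right_comm]

/-- Weak derivatives commute with translations. -/
lemma HasWeakPd.shift {i : Fin n} {u w : H0 n} (h : HasWeakPd i u w) (j : Fin n) (s : ℝ) :
    HasWeakPd i (shift j s u) (shift j s w) := by
  rw [hasWeakPd_iff] at h ⊢
  intro η hη hc
  rw [inner_shift_left, inner_shift_left, shift_test, shift_test]
  rw [← h _ (contDiff_translate hη _) (hasCompactSupport_translate hc _)]
  congr 2
  funext x
  exact (pd_translate i η _ x).symm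

/-- Along translations, pairings with a test function are differentiable. -/
lemma hasDerivAt_inner_shift_test (i : Fin n) (u : H0 n) {η : E n → ℝ} (h : ContDiff ℝ ∞ η)
    (hc : HasCompactSupport η) :
    HasDerivAt (fun s => ⟪u, shift i s (test η h.continuous hc)⟫)
      ⟪u, test (pd i η) (pd_continuous i h) (pd_compactSupport i h hc)⟫ 0 := by
  obtain ⟨R, hR⟩ := (pd_compactSupport i h hc).isCompact.isBounded.subset_closedBall (0 : E n)
  obtain ⟨M, hM⟩ := (pd_continuous i h).bounded_above_of_compact_support (pd_compactSupport i h hc)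
  have hM0 : 0 ≤ M := (norm_nonneg _).trans (hM 0)
  simp only [shift_test, inner_test]
  have key := hasDerivAt_integral_of_dominated_loc_of_deriv_le (μ := (volume : Measure (E n)))
    (F := fun s x => u x * η (x + s • dir i)) (F' := fun s x => u x * pd i η (x + s • dir i))
    (x₀ := (0 : ℝ)) (s := Metric.ball 0 1)
    (bound := fun x => |u x * (Metric.closedBall (0 : E n) (R + 1)).indicator (fun _ => M) x|)
    (Metric.ball_mem_nhds _ one_pos) ?_ ?_ ?_ ?_ ?_ ?_
  · simpa using key.2
  · refine Eventually.of_forall fun s => ?_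
    exact (Lp.aestronglyMeasurable u).mul
      (h.continuous.comp (by fun_prop : Continuous fun x => x + s • dir i)).aestronglyMeasurable
  · exact integrable_mul_test u (h.continuous.comp (by fun_prop))
      (hasCompactSupport_translate hc _)
  · exact (Lp.aestronglyMeasurable u).mul ((pd_continuous i h).comp
      (by fun_prop : Continuous fun x => x + (0 : ℝ) • dir i)).aestronglyMeasurable
  · refine Eventually.of_forall fun x s hs => ?_
    rw [norm_mul, abs_mul, Real.norm_eq_abs]
    refine mul_le_mul_of_nonneg_left ?_ (abs_nonneg _)
    by_cases hx : x ∈ Metric.closedBall (0 : E n) (R + 1)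
    · rw [indicator_of_mem hx, abs_of_nonneg hM0]
      exact hM _
    · rw [indicator_of_notMem hx, abs_zero]
      have : x + s • dir i ∉ tsupport (pd i η) := fun hmem => hx (by
        have h1 := hR hmem
        rw [mem_closedBall_zero_iff] at h1 ⊢
        have h2 : ‖s • dir i‖ ≤ 1 := by
          rw [norm_smul, norm_dir, mul_one]
          exact (mem_ball_zero_iff.1 hs).le
        calc ‖x‖ = ‖(x + s • dir i) - s • dir i‖ := by rw [add_sub_cancel_right]
          _ ≤ R + 1 := (norm_sub_le _ _).trans (add_le_add h1 h2))
      rw [image_eq_zero_of_notMem_tsupport this, norm_zero]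
  · have : MemLp ((Metric.closedBall (0 : E n) (R + 1)).indicator (fun _ => M)) 2 volume :=
      memLp_indicator_const 2 measurableSet_closedBall M (Or.inr measure_closedBall_lt_top.ne)
    exact ((Lp.memLp u).integrable_mul this).abs
  · refine Eventually.of_forall fun x s _ => ?_
    exact (hasDerivAt_line (hasPd_of_contDiff i h) x s).const_mul (u x)

/-- The increment of `u` along a translation is the integral of the translated weak derivative. -/
lemma HasWeakPd.shift_sub {i : Fin n} {u w : H0 n} (h : HasWeakPd i u w) (s : ℝ) :
    Transport.shift i s u - u = ∫ t in 0..s, Transport.shift i t w := by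
  refine eq_of_inner_test fun η hη hc => ?_
  set T := test η hη.continuous hc with hT
  have hd : ∀ t, HasDerivAt (fun t => ⟪Transport.shift i t u, T⟫)
      ⟪Transport.shift i t w, T⟫ t := by
    intro t
    have h1 := hasDerivAt_inner_shift_test i (Transport.shift i t u) hη hc
    rw [(hasWeakPd_iff _ _ _).1 (h.shift i t) η hη hc] at h1
    have h2 : HasDerivAt (fun r => t - r) (-1 : ℝ) t := by
      simpa using (hasDerivAt_id t).const_sub t
    have h3 := HasDerivAt.scomp (x := t) (h := fun r => t - r)
      (g₁ := fun r => ⟪Transport.shift i t u, Transport.shift i r T⟫) (by simpa using h1) h2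
    simp only [neg_smul, one_smul, neg_neg] at h3
    refine h3.congr_of_eventuallyEq (Eventually.of_forall fun r => ?_)
    simp only [Function.comp_apply]
    rw [inner_shift_left, inner_shift_left, ← shift_add]
    congr 3
    ring
  have hcont : Continuous fun t => ⟪Transport.shift i t w, T⟫ :=
    (continuous_shift i w).inner continuous_const
  have h1 := intervalIntegral.integral_eq_sub_of_hasDerivAt (a := 0) (b := s)
    (fun t _ => hd t) (hcont.intervalIntegrable _ _)
  have h2 := (innerSL ℝ T).intervalIntegral_comp_comm
    ((continuous_shift i w).intervalIntegrable (μ := volume) 0 s)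
  simp only [innerSL_apply_apply] at h2
  rw [inner_sub_left, real_inner_comm, real_inner_comm _ (∫ t in 0..s, Transport.shift i t w), ← h2]
  rw [shift_zero] at h1
  rw [real_inner_comm, ← h1]
  exact intervalIntegral.integral_congr fun t _ => real_inner_comm _ _

/-- A weak derivative of an `L₂` function is the derivative of its orbit under translations. -/
lemma hasWeakPd_iff_hasDerivAt (i : Fin n) (u w : H0 n) :
    HasWeakPd i u w ↔ HasDerivAt (fun s => shift i s u) w 0 := by
  refine ⟨fun h => ?_, fun h => ?_⟩
  · have h1 : (fun s => shift i s u) = fun s => u + ∫ t in 0..s, shift i t w := by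
      funext s
      rw [← h.shift_sub, add_sub_cancel]
    rw [h1]
    have := intervalIntegral.integral_hasDerivAt_right
      ((continuous_shift i w).intervalIntegrable (μ := volume) 0 0)
      ((continuous_shift i w).stronglyMeasurableAtFilter _ _) (continuous_shift i w).continuousAt
    rw [shift_zero] at this
    exact this.const_add u
  · rw [hasWeakPd_iff]
    intro η hη hc
    have h1 := hasDerivAt_inner_shift_test i u hη hc
    have h2 : HasDerivAt (fun s : ℝ => shift i (-s) u) (-w) 0 := by
      have := HasDerivAt.scomp (x := (0 : ℝ)) (h := fun r => -r) (g₁ := fun s => shift i s u)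
        (by simpa using h) (hasDerivAt_neg 0)
      rw [neg_one_smul] at this
      exact this
    have h3 := (innerSL ℝ (test η hη.continuous hc)).hasFDerivAt.comp_hasDerivAt 0 h2
    rw [h1.unique (h3.congr_of_eventuallyEq (Eventually.of_forall fun s => ?_))]
    · rw [innerSL_apply_apply, inner_neg_right, real_inner_comm]
    · simp only [Function.comp_apply, innerSL_apply_apply]
      rw [real_inner_comm (shift i (-s) u), inner_shift_left, neg_neg]

lemma HasWeakPd.norm_shift_sub_le {i : Fin n} {u w : H0 n} (h : HasWeakPd i u w) (s : ℝ) :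
    ‖Transport.shift i s u - u‖ ≤ ‖w‖ * |s| := by
  rw [h.shift_sub]
  simpa using intervalIntegral.norm_integral_le_of_norm_le_const (a := (0 : ℝ)) (b := s) (C := ‖w‖)
    (f := fun t => Transport.shift i t w) fun t _ => ((Transport.shift i t).norm_map w).le

/-- Integration by parts for pairs of weakly differentiable functions: translations are unitary, so
`⟪u(· + s eᵢ), u'(· + s eᵢ)⟫` does not depend on `s`. -/
lemma HasWeakPd.inner_eq_neg {i : Fin n} {u w u' w' : H0 n} (h : HasWeakPd i u w)
    (h' : HasWeakPd i u' w') : ⟪w, u'⟫ = -⟪u, w'⟫ := by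
  rw [hasWeakPd_iff_hasDerivAt] at h h'
  have h1 := h.inner ℝ h'
  simp only [LinearIsometry.inner_map_map, shift_zero] at h1
  have := h1.unique (hasDerivAt_const (0 : ℝ) ⟪u, u'⟫)
  linarith

end Translations

/-! ### The Sobolev space `H¹` -/

noncomputable section Sobolev

variable {n : ℕ}

lemma hasWeakPd_wpd (i : Fin n) (u : H1 n) : HasWeakPd i (toH0 u) (wpd i u) := u.2 i

lemma H1.inner_eq (u v : H1 n) :
    ⟪u, v⟫ = ⟪toH0 u, toH0 v⟫ + ∑ i, ⟪wpd i u, wpd i v⟫ := by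
  rw [Submodule.coe_inner, PiLp.inner_apply, Fintype.sum_option]
  rfl

lemma H1.norm_sq_eq (u : H1 n) : ‖u‖ ^ 2 = ‖toH0 u‖ ^ 2 + ∑ i, ‖wpd i u‖ ^ 2 := by
  simp only [← real_inner_self_eq_norm_sq, H1.inner_eq]

lemma norm_toH0_le (u : H1 n) : ‖toH0 u‖ ≤ ‖u‖ := by
  refine le_of_sq_le_sq ?_ (norm_nonneg u)
  rw [H1.norm_sq_eq]
  exact le_add_of_nonneg_right (Finset.sum_nonneg fun _ _ => sq_nonneg _)

lemma norm_wpd_le (i : Fin n) (u : H1 n) : ‖wpd i u‖ ≤ ‖u‖ := by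
  refine le_of_sq_le_sq ?_ (norm_nonneg u)
  rw [H1.norm_sq_eq]
  have := Finset.single_le_sum (f := fun i => ‖wpd i u‖ ^ 2) (fun _ _ => sq_nonneg _)
    (Finset.mem_univ i)
  nlinarith [sq_nonneg ‖toH0 u‖]

lemma H1.norm_le (u : H1 n) : ‖u‖ ≤ ‖toH0 u‖ + ∑ i, ‖wpd i u‖ := by
  have hs : 0 ≤ ∑ i, ‖wpd i u‖ := Finset.sum_nonneg fun _ _ => norm_nonneg _
  refine le_of_sq_le_sq ?_ (by positivity)
  rw [H1.norm_sq_eq]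
  have := Finset.sum_sq_le_sq_sum_of_nonneg (s := Finset.univ) (f := fun i => ‖wpd i u‖)
    fun _ _ => norm_nonneg _
  nlinarith [mul_nonneg (norm_nonneg (toH0 u)) hs]

lemma isClosed_H1 : IsClosed (H1 n : Set (PiLp 2 (fun _ : Option (Fin n) => H0 n))) := by
  have : (H1 n : Set (PiLp 2 (fun _ : Option (Fin n) => H0 n))) =
      ⋂ (i : Fin n) (η : E n → ℝ) (h : ContDiff ℝ ∞ η) (hc : HasCompactSupport η),
        {z | ⟪z none, test (pd i η) (pd_continuous i h) (pd_compactSupport i h hc)⟫ =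
          -⟪z (some i), test η h.continuous hc⟫} := by
    ext z
    simp only [mem_iInter]
    exact forall_congr' fun i => hasWeakPd_iff i _ _
  rw [this]
  refine isClosed_iInter fun i => isClosed_iInter fun η => isClosed_iInter fun h =>
    isClosed_iInter fun hc => isClosed_eq ?_ ?_
  · exact (PiLp.continuous_apply 2 _ none).inner continuous_const
  · exact ((PiLp.continuous_apply 2 _ (some i)).inner continuous_const).neg

instance : CompleteSpace (H1 n) := isClosed_H1.completeSpace_coe

instance : Fact ((2 : ℝ≥0∞) ≠ ⊤) := ⟨by norm_num⟩

instance : SecondCountableTopology (PiLp 2 (fun _ : Option (Fin n) => H0 n)) :=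
  (PiLp.homeomorph 2 (fun _ : Option (Fin n) => H0 n)).secondCountableTopology

instance : SecondCountableTopology (H1 n) :=
  TopologicalSpace.Subtype.secondCountableTopology _

/-- A continuous linear map into `H¹` from its components: the function and its derivatives. -/
def H1.lift {V : Type*} [NormedAddCommGroup V] [NormedSpace ℝ V] (P : V →L[ℝ] H0 n)
    (Q : Fin n → V →L[ℝ] H0 n) (h : ∀ v i, HasWeakPd i (P v) (Q i v)) : V →L[ℝ] H1 n :=
  ContinuousLinearMap.codRestrict
    ((PiLp.continuousLinearEquiv 2 ℝ (fun _ : Option (Fin n) => H0 n)).symm.toContinuousLinearMap ∘L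
      ContinuousLinearMap.pi fun o => o.elim P Q) (H1 n) (fun v i => h v i)

lemma denseRange_toH0 : DenseRange (toH0 : H1 n →L[ℝ] H0 n) := by
  refine dense_test.mono ?_
  rintro u ⟨η, h, hc, rfl⟩
  refine ⟨⟨WithLp.toLp 2 fun o => o.elim (test η h.continuous hc)
    fun i => test (pd i η) (pd_continuous i h) (pd_compactSupport i h hc), fun i => ?_⟩, rfl⟩
  change HasWeakPd i (test η h.continuous hc)
    (test (pd i η) (pd_continuous i h) (pd_compactSupport i h hc))
  -- Both sides pair with a test function as in the derivative of the constant
  -- `s ↦ ⟪η(· + s eᵢ), θ(· + s eᵢ)⟫`.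
  rw [hasWeakPd_iff]
  intro θ hθ hθc
  have h1 := hasDerivAt_inner_shift_test i (test η h.continuous hc) hθ hθc
  have h2 := hasDerivAt_inner_shift_test i (test θ hθ.continuous hθc) h hc
  have h3 : HasDerivAt (fun s : ℝ => ⟪test η h.continuous hc,
      shift i s (test θ hθ.continuous hθc)⟫)
      (-⟪test θ hθ.continuous hθc,
        test (pd i η) (pd_continuous i h) (pd_compactSupport i h hc)⟫) 0 := by
    have := HasDerivAt.scomp (x := (0 : ℝ)) (h := fun r => -r)
      (g₁ := fun s => ⟪test θ hθ.continuous hθc, shift i s (test η h.continuous hc)⟫)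
      (by simpa using h2) (hasDerivAt_neg 0)
    rw [neg_one_smul] at this
    refine this.congr_of_eventuallyEq (Eventually.of_forall fun s => ?_)
    simp only [Function.comp_apply]
    rw [real_inner_comm, inner_shift_left]
  rw [h1.unique h3, real_inner_comm]

end Sobolev

/-! ### Multiplication operators -/

noncomputable section Multiplication

variable {n : ℕ}

/-- Multiplication by a bounded measurable function, as an operator on `L₂(ℝⁿ)`. The value is `0`
for all other functions. -/
def mulOp (g : E n → ℝ) : H0 n →L[ℝ] H0 n :=
  open Classical in
  if h : Measurable g ∧ ∃ C, ∀ x, |g x| ≤ C then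
    (ContinuousLinearMap.mul ℝ ℝ).holderL volume ⊤ 2 2
      (MemLp.toLp g (memLp_top_of_bound h.1.aestronglyMeasurable h.2.choose
        (Eventually.of_forall h.2.choose_spec)))
  else 0

lemma coeFn_mulOp {g : E n → ℝ} {C : ℝ} (hm : Measurable g) (hb : ∀ x, |g x| ≤ C) (u : H0 n) :
    mulOp g u =ᵐ[volume] fun x => g x * u x := by
  have h : Measurable g ∧ ∃ C, ∀ x, |g x| ≤ C := ⟨hm, C, hb⟩
  have hL : MemLp g ⊤ (volume : Measure (E n)) :=
    memLp_top_of_bound hm.aestronglyMeasurable C (Eventually.of_forall hb)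
  rw [mulOp, dif_pos h]
  filter_upwards [(ContinuousLinearMap.mul ℝ ℝ).coeFn_holder (r := 2) hL.toLp u, hL.coeFn_toLp]
    with x h1 h2
  refine Eq.trans h1 ?_
  rw [h2]
  rfl

lemma norm_mulOp_le {g : E n → ℝ} {C : ℝ} (hm : Measurable g) (hb : ∀ x, |g x| ≤ C) (u : H0 n) :
    ‖mulOp g u‖ ≤ C * ‖u‖ := by
  refine Lp.norm_le_mul_norm_of_ae_le_mul ?_
  filter_upwards [coeFn_mulOp hm hb u] with x hx
  rw [hx, norm_mul]
  exact mul_le_mul_of_nonneg_right (hb x) (norm_nonneg _)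

lemma inner_mulOp_left {g : E n → ℝ} {C : ℝ} (hm : Measurable g) (hb : ∀ x, |g x| ≤ C)
    (u v : H0 n) : ⟪mulOp g u, v⟫ = ⟪u, mulOp g v⟫ := by
  rw [L2.inner_def, L2.inner_def]
  refine integral_congr_ae ?_
  filter_upwards [coeFn_mulOp hm hb u, coeFn_mulOp hm hb v] with x h1 h2
  rw [h1, h2]
  simp only [RCLike.inner_apply, conj_trivial]
  ring

lemma mulOp_neg {g : E n → ℝ} {C : ℝ} (hm : Measurable g) (hb : ∀ x, |g x| ≤ C) (u : H0 n) :
    mulOp (fun x => -g x) u = -mulOp g u := by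
  refine Lp.ext ?_
  filter_upwards [coeFn_mulOp hm hb u,
    coeFn_mulOp hm.neg (C := C) (fun x => by simpa using hb x) u, Lp.coeFn_neg (mulOp g u)]
    with x h1 h2 h3
  rw [h3, Pi.neg_apply, h1]
  exact h2.trans (neg_mul _ _)

lemma mulOp_zero (u : H0 n) : mulOp (fun _ => 0) u = 0 := by
  have := norm_mulOp_le (C := 0) (g := fun _ : E n => (0 : ℝ)) measurable_const (by simp) u
  simpa using this

lemma mulOp_sum {ι : Type*} [Fintype ι] {g : ι → E n → ℝ} {C : ℝ} (hm : ∀ i, Measurable (g i))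
    (hb : ∀ i x, |g i x| ≤ C) (u : H0 n) :
    mulOp (fun x => ∑ i, g i x) u = ∑ i, mulOp (g i) u := by
  refine Lp.ext ?_
  have h1 : ∀ᵐ x, ∀ i, mulOp (g i) u x = g i x * u x :=
    ae_all_iff.2 fun i => coeFn_mulOp (hm i) (hb i) u
  have h2 := coeFn_mulOp (g := fun x => ∑ i, g i x) (C := ∑ _ : ι, C)
    (Finset.measurable_fun_sum _ fun i _ => hm i)
    (fun x => (Finset.abs_sum_le_sum_abs _ _).trans (Finset.sum_le_sum fun i _ => hb i x)) u
  filter_upwards [h1, h2, Lp.coeFn_finsetSum Finset.univ fun i => mulOp (g i) u] with x h1 h2 h3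
  rw [h2, h3, Finset.sum_apply, Finset.sum_mul]
  exact Finset.sum_congr rfl fun i _ => (h1 i).symm

/-- Bounded pointwise convergence of multipliers implies strong convergence. -/
lemma tendsto_mulOp {ι : Type*} {l : Filter ι} [l.IsCountablyGenerated] {g : ι → E n → ℝ}
    {g' : E n → ℝ} {C : ℝ} (hm : ∀ᶠ k in l, Measurable (g k)) (hb : ∀ᶠ k in l, ∀ x, |g k x| ≤ C)
    (hm' : Measurable g') (hb' : ∀ x, |g' x| ≤ C)
    (hlim : ∀ x, Tendsto (fun k => g k x) l (𝓝 (g' x))) (u : H0 n) :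
    Tendsto (fun k => mulOp (g k) u) l (𝓝 (mulOp g' u)) := by
  have hC : 0 ≤ C := (abs_nonneg _).trans (hb' 0)
  have hsq : ∀ᶠ k in l, ‖mulOp (g k) u - mulOp g' u‖ ^ 2 = ∫ x, ((g k x - g' x) * u x) ^ 2 := by
    filter_upwards [hm, hb] with k h1 h2
    rw [← real_inner_self_eq_norm_sq, L2.inner_def]
    refine integral_congr_ae ?_
    filter_upwards [coeFn_mulOp h1 h2 u, coeFn_mulOp hm' hb' u,
      Lp.coeFn_sub (mulOp (g k) u) (mulOp g' u)] with x e1 e2 e3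
    rw [e3, Pi.sub_apply, e1, e2, real_inner_self_eq_norm_sq, Real.norm_eq_abs, sq_abs]
    ring
  have hlim2 : Tendsto (fun k => ∫ x, ((g k x - g' x) * u x) ^ 2) l (𝓝 (∫ _ : E n, (0 : ℝ))) := by
    refine tendsto_integral_filter_of_dominated_convergence
      (fun x => (2 * C) ^ 2 * (u x) ^ 2) ?_ ?_ ?_ ?_
    · filter_upwards [hm] with k h1
      exact ((h1.sub hm').aestronglyMeasurable.mul (Lp.aestronglyMeasurable u)).pow 2
    · filter_upwards [hb] with k h2
      refine Eventually.of_forall fun x => ?_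
      rw [Real.norm_eq_abs, abs_of_nonneg (sq_nonneg _), mul_pow]
      refine mul_le_mul_of_nonneg_right ?_ (sq_nonneg _)
      rw [← sq_abs]
      refine pow_le_pow_left₀ (abs_nonneg _) ?_ 2
      exact (abs_sub _ _).trans (by linarith [h2 x, hb' x])
    · exact ((Lp.memLp u).integrable_sq).const_mul _
    · refine Eventually.of_forall fun x => ?_
      have := (((hlim x).sub_const (g' x)).mul_const (u x)).pow 2
      simpa using this
  rw [integral_zero] at hlim2
  rw [tendsto_iff_norm_sub_tendsto_zero]
  have := (hlim2.congr' (hsq.mono fun k hk => hk.symm)).sqrt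
  simpa [Real.sqrt_sq (norm_nonneg _)] using this

/-- The multipliers of `H¹`: functions whose partial derivatives exist everywhere and which are
bounded by `C` together with their partial derivatives. -/
structure IsMultiplier (C : ℝ) (g : E n → ℝ) : Prop where
  bound : ∀ x, |g x| ≤ C
  hasPd : ∀ i x, HasPd i g x
  pd_bound : ∀ i x, |pd i g x| ≤ C

namespace IsMultiplier

variable {C : ℝ} {g : E n → ℝ}

lemma nonneg (hg : IsMultiplier C g) : 0 ≤ C := (abs_nonneg _).trans (hg.bound 0)

lemma abs_sub_le_line (hg : IsMultiplier C g) (i : Fin n) (x : E n) (s : ℝ) :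
    |g (x + s • dir i) - g x| ≤ C * |s| := by
  have := Convex.norm_image_sub_le_of_norm_hasDerivWithin_le (C := C) (s := univ)
    (f := fun s : ℝ => g (x + s • dir i)) (x := 0) (y := s)
    (fun t _ => (hasDerivAt_line (hg.hasPd i) x t).hasDerivWithinAt)
    (fun t _ => hg.pd_bound i _) convex_univ (mem_univ _) (mem_univ _)
  simpa using this

lemma abs_sub_le_sum (hg : IsMultiplier C g) (x y : E n) :
    |g y - g x| ≤ C * ∑ i, |y i - x i| := by
  have key : ∀ S : Finset (Fin n), |g (x + ∑ i ∈ S, (y i - x i) • dir i) - g x| ≤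
      C * ∑ i ∈ S, |y i - x i| := by
    intro S
    induction S using Finset.induction_on with
    | empty => simp
    | insert i S hi ih =>
      rw [Finset.sum_insert hi, Finset.sum_insert hi, mul_add]
      have h1 := hg.abs_sub_le_line i (x + ∑ i ∈ S, (y i - x i) • dir i) (y i - x i)
      rw [add_assoc, add_comm (∑ i ∈ S, (y i - x i) • dir i)] at h1
      calc _ ≤ _ := abs_sub_le _ (g (x + ∑ i ∈ S, (y i - x i) • dir i)) _
        _ ≤ _ := add_le_add h1 ih
  have hy : x + ∑ i, (y i - x i) • dir i = y := by
    ext j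
    simp [Pi.single_apply]
  have := key Finset.univ
  rwa [hy] at this

lemma continuous (hg : IsMultiplier C g) : Continuous g := by
  refine continuous_iff_continuousAt.2 fun x => ?_
  rw [ContinuousAt, tendsto_iff_norm_sub_tendsto_zero]
  refine squeeze_zero (fun _ => norm_nonneg _) (fun y => hg.abs_sub_le_sum x y) ?_
  have : Continuous fun y : E n => C * ∑ i, |y i - x i| := by fun_prop
  simpa using this.tendsto x

lemma measurable (hg : IsMultiplier C g) : Measurable g := hg.continuous.measurable

lemma measurable_pd (hg : IsMultiplier C g) (i : Fin n) : Measurable (pd i g) :=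
  measurable_lineDeriv hg.continuous

lemma shift_mulOp (hg : IsMultiplier C g) (i : Fin n) (s : ℝ) (u : H0 n) :
    shift i s (mulOp g u) = mulOp (fun x => g (x + s • dir i)) (shift i s u) := by
  refine Lp.ext ?_
  filter_upwards [coeFn_shift i s (mulOp g u), coeFn_shift i s u,
    (quasiMeasurePreserving_shift i s).ae (coeFn_mulOp hg.measurable hg.bound u),
    coeFn_mulOp (g := fun x => g (x + s • dir i)) (hg.measurable.comp (by fun_prop))
      (fun x => hg.bound _) (shift i s u)] with x h1 h2 h3 h4
  rw [h1, h3, h4, h2]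

/-- The commutator of a translation and a multiplier is of the order of the step. -/
lemma shift_mulOp_sub (hg : IsMultiplier C g) (i : Fin n) (s : ℝ) (u : H0 n) :
    shift i s (mulOp g u) - mulOp g (shift i s u) =
      mulOp (fun x => g (x + s • dir i) - g x) (shift i s u) := by
  rw [hg.shift_mulOp]
  refine Lp.ext ?_
  filter_upwards [Lp.coeFn_sub (mulOp (fun x => g (x + s • dir i)) (shift i s u))
      (mulOp g (shift i s u)), coeFn_mulOp hg.measurable hg.bound (shift i s u),
    coeFn_mulOp (g := fun x => g (x + s • dir i)) (hg.measurable.comp (by fun_prop))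
      (fun x => hg.bound _) (shift i s u),
    coeFn_mulOp (g := fun x => g (x + s • dir i) - g x)
      ((hg.measurable.comp (by fun_prop)).sub hg.measurable)
      (fun x => hg.abs_sub_le_line i x s) (shift i s u)] with x h1 h2 h3 h4
  rw [h1, Pi.sub_apply, h2, h3, h4, sub_mul]

lemma norm_shift_mulOp_sub_le (hg : IsMultiplier C g) (i : Fin n) (s : ℝ) (u : H0 n) :
    ‖shift i s (mulOp g u) - mulOp g (shift i s u)‖ ≤ C * |s| * ‖u‖ := by
  rw [hg.shift_mulOp_sub]
  refine (norm_mulOp_le ((hg.measurable.comp (by fun_prop)).sub hg.measurable)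
    (fun x => hg.abs_sub_le_line i x s) _).trans_eq ?_
  rw [LinearIsometry.norm_map]

/-- The product rule. -/
lemma hasWeakPd_mulOp (hg : IsMultiplier C g) {i : Fin n} {u w : H0 n} (h : HasWeakPd i u w) :
    HasWeakPd i (mulOp g u) (mulOp g w + mulOp (pd i g) u) := by
  rw [hasWeakPd_iff_hasDerivAt, hasDerivAt_iff_tendsto_slope_zero] at h ⊢
  simp only [zero_add, shift_zero] at h ⊢
  -- The difference quotient of `g u` is `(gu)ₛ - gu = g ((u)ₛ - u) + [(gu)ₛ - g (u)ₛ]`.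
  have e : ∀ s : ℝ, s⁻¹ • (shift i s (mulOp g u) - mulOp g u) =
      mulOp g (s⁻¹ • (shift i s u - u)) +
        (mulOp (fun x => s⁻¹ * (g (x + s • dir i) - g x)) (shift i s u - u) +
          mulOp (fun x => s⁻¹ * (g (x + s • dir i) - g x)) u) := by
    intro s
    have h1 : mulOp (fun x => s⁻¹ * (g (x + s • dir i) - g x)) (shift i s u) =
        s⁻¹ • mulOp (fun x => g (x + s • dir i) - g x) (shift i s u) := by
      have hm : Measurable fun x => g (x + s • dir i) - g x :=
        (hg.measurable.comp (by fun_prop)).sub hg.measurable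
      refine Lp.ext ?_
      filter_upwards [coeFn_mulOp hm (fun x => hg.abs_sub_le_line i x s) (shift i s u),
        coeFn_mulOp (g := fun x => s⁻¹ * (g (x + s • dir i) - g x)) (hm.const_mul _)
          (C := |s⁻¹| * (C * |s|)) (fun x => by
            rw [abs_mul]
            exact mul_le_mul_of_nonneg_left (hg.abs_sub_le_line i x s) (abs_nonneg _))
          (shift i s u),
        Lp.coeFn_smul s⁻¹ (mulOp (fun x => g (x + s • dir i) - g x) (shift i s u))] with x a1 a2 a3
      rw [a2, a3, Pi.smul_apply, a1, smul_eq_mul, mul_assoc]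
    rw [← map_add, sub_add_cancel, h1, ← hg.shift_mulOp_sub, map_smul, ← smul_add, map_sub]
    congr 1
    abel
  have hq : ∀ s : ℝ, s ≠ 0 → ∀ x, |s⁻¹ * (g (x + s • dir i) - g x)| ≤ C := by
    intro s hs x
    rw [abs_mul, abs_inv]
    have := hg.abs_sub_le_line i x s
    rw [inv_mul_le_iff₀ (abs_pos.2 hs)]
    linarith
  have hqm : ∀ s : ℝ, Measurable fun x => s⁻¹ * (g (x + s • dir i) - g x) := fun s =>
    ((hg.measurable.comp (by fun_prop)).sub hg.measurable).const_mul _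
  have hne : ∀ᶠ s : ℝ in 𝓝[≠] 0, s ≠ 0 := self_mem_nhdsWithin
  have l1 : Tendsto (fun s : ℝ => mulOp g (s⁻¹ • (shift i s u - u))) (𝓝[≠] 0)
      (𝓝 (mulOp g w)) := ((mulOp g).continuous.tendsto w).comp h
  have l2 : Tendsto (fun s : ℝ =>
      mulOp (fun x => s⁻¹ * (g (x + s • dir i) - g x)) (shift i s u - u)) (𝓝[≠] 0) (𝓝 0) := by
    refine squeeze_zero_norm' (a := fun s => C * ‖shift i s u - u‖) ?_ ?_
    · filter_upwards [hne] with s hs using norm_mulOp_le (hqm s) (hq s hs) _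
    · have : Continuous fun s => C * ‖shift i s u - u‖ :=
        continuous_const.mul (((continuous_shift i u).sub continuous_const).norm)
      have h0 := (this.tendsto 0).mono_left (nhdsWithin_le_nhds (s := {0}ᶜ))
      simpa [shift_zero] using h0
  have l3 : Tendsto (fun s : ℝ => mulOp (fun x => s⁻¹ * (g (x + s • dir i) - g x)) u) (𝓝[≠] 0)
      (𝓝 (mulOp (pd i g) u)) := by
    refine tendsto_mulOp (Eventually.of_forall hqm) (hne.mono hq) (hg.measurable_pd i)
      (hg.pd_bound i) (fun x => ?_) u
    have := (hasDerivAt_iff_tendsto_slope_zero.1 (hasDerivAt_line (hg.hasPd i) x 0))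
    simpa using this
  have := l1.add (l2.add l3)
  rw [zero_add] at this
  exact this.congr fun s => (e s).symm

end IsMultiplier

/-- Multiplication by a multiplier, as an operator on `H¹`. The value is `0` for all other
functions. -/
def mulH1 (g : E n → ℝ) : H1 n →L[ℝ] H1 n :=
  open Classical in
  if h : ∃ C, IsMultiplier C g then
    H1.lift (mulOp g ∘L toH0) (fun i => mulOp g ∘L wpd i + mulOp (pd i g) ∘L toH0)
      fun u i => h.choose_spec.hasWeakPd_mulOp (hasWeakPd_wpd i u)
  else 0

namespace IsMultiplier

variable {C : ℝ} {g : E n → ℝ}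

lemma toH0_mulH1 (hg : IsMultiplier C g) (u : H1 n) : toH0 (mulH1 g u) = mulOp g (toH0 u) := by
  rw [mulH1, dif_pos ⟨C, hg⟩]
  rfl

lemma wpd_mulH1 (hg : IsMultiplier C g) (i : Fin n) (u : H1 n) :
    wpd i (mulH1 g u) = mulOp g (wpd i u) + mulOp (pd i g) (toH0 u) := by
  rw [mulH1, dif_pos ⟨C, hg⟩]
  rfl

lemma norm_mulH1_le (hg : IsMultiplier C g) : ‖mulH1 g‖ ≤ C + n * (2 * C) := by
  have hC := hg.nonneg
  refine ContinuousLinearMap.opNorm_le_bound _ (by positivity) fun u => ?_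
  refine (H1.norm_le _).trans ?_
  rw [add_mul]
  refine add_le_add ?_ ?_
  · rw [hg.toH0_mulH1]
    refine (norm_mulOp_le hg.measurable hg.bound _).trans ?_
    gcongr
    exact norm_toH0_le u
  · have : ∀ i ∈ (Finset.univ : Finset (Fin n)), ‖wpd i (mulH1 g u)‖ ≤ 2 * C * ‖u‖ := by
      intro i _
      rw [hg.wpd_mulH1]
      refine (norm_add_le _ _).trans ?_
      have h1 := norm_mulOp_le hg.measurable hg.bound (wpd i u)
      have h2 := norm_mulOp_le (hg.measurable_pd i) (hg.pd_bound i) (toH0 u)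
      have h3 := mul_le_mul_of_nonneg_left (norm_wpd_le i u) hC
      have h4 := mul_le_mul_of_nonneg_left (norm_toH0_le u) hC
      linarith
    refine (Finset.sum_le_sum this).trans_eq ?_
    simp
    ring

end IsMultiplier

end Multiplication

/-! ### First order operators and their finite difference approximations -/

noncomputable section Generators

variable {n : ℕ}

/-- The central difference quotient with step `h` in direction `i`, on `L₂(ℝⁿ)`. -/
def diffOp (i : Fin n) (h : ℝ) : H0 n →L[ℝ] H0 n :=
  (2 * h)⁻¹ • ((shift i h).toContinuousLinearMap - (shift i (-h)).toContinuousLinearMap)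

lemma diffOp_apply (i : Fin n) (h : ℝ) (u : H0 n) :
    diffOp i h u = (2 * h)⁻¹ • (shift i h u - shift i (-h) u) := rfl

lemma inner_diffOp_left (i : Fin n) (h : ℝ) (u v : H0 n) :
    ⟪diffOp i h u, v⟫ = -⟪u, diffOp i h v⟫ := by
  rw [diffOp_apply, diffOp_apply, real_inner_smul_left, real_inner_smul_right, inner_sub_left,
    inner_sub_right, inner_shift_left, inner_shift_left, neg_neg]
  ring

lemma HasWeakPd.diffOp {j : Fin n} {u w : H0 n} (hu : HasWeakPd j u w) (i : Fin n) (h : ℝ) :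
    HasWeakPd j (diffOp i h u) (diffOp i h w) := by
  have h1 := ((hu.shift i h).add ((hu.shift i (-h)).smul (-1))).smul (2 * h)⁻¹
  rw [diffOp_apply, diffOp_apply, sub_eq_add_neg, sub_eq_add_neg]
  simpa only [neg_one_smul] using h1

lemma HasWeakPd.norm_diffOp_le {i : Fin n} {u w : H0 n} (hu : HasWeakPd i u w) (h : ℝ) :
    ‖Transport.diffOp i h u‖ ≤ ‖w‖ := by
  rcases eq_or_ne h 0 with rfl | h0
  · simp [diffOp_apply]
  rw [diffOp_apply, norm_smul, norm_inv,
    inv_mul_le_iff₀ (norm_pos_iff.2 (mul_ne_zero two_ne_zero h0))]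
  calc ‖Transport.shift i h u - Transport.shift i (-h) u‖
      = ‖(Transport.shift i h u - u) - (Transport.shift i (-h) u - u)‖ := by congr 1; abel
    _ ≤ ‖w‖ * |h| + ‖w‖ * |-h| :=
        (norm_sub_le _ _).trans (add_le_add (hu.norm_shift_sub_le h) (hu.norm_shift_sub_le (-h)))
    _ = ‖2 * h‖ * ‖w‖ := by
        rw [abs_neg, norm_mul, Real.norm_eq_abs, Real.norm_eq_abs, abs_two]; ring

lemma HasWeakPd.tendsto_diffOp {i : Fin n} {u w : H0 n} (hu : HasWeakPd i u w) :
    Tendsto (fun h => Transport.diffOp i h u) (𝓝[≠] 0) (𝓝 w) := by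
  have h1 := hasDerivAt_iff_tendsto_slope_zero.1 ((hasWeakPd_iff_hasDerivAt i u w).1 hu)
  simp only [zero_add, shift_zero] at h1
  have hneg : Tendsto (fun h : ℝ => -h) (𝓝[≠] 0) (𝓝[≠] 0) := by
    refine tendsto_nhdsWithin_iff.2 ⟨?_, ?_⟩
    · simpa using (continuous_neg.tendsto (0 : ℝ)).mono_left nhdsWithin_le_nhds
    · filter_upwards [self_mem_nhdsWithin] with h hh
      simpa using hh
  have h2 := ((h1.add (h1.comp hneg)).const_smul (2 : ℝ)⁻¹)
  have h3 : (2 : ℝ)⁻¹ • (w + w) = w := by rw [← two_smul ℝ w, smul_smul]; norm_num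
  rw [h3] at h2
  refine h2.congr fun h => ?_
  simp only [Function.comp_apply]
  rw [diffOp_apply, mul_inv, inv_neg, neg_smul, ← sub_eq_add_neg, ← smul_sub, smul_smul]
  congr 1
  abel

/-- Up to a bounded error, a multiplier commutes with difference quotients. As the latter are
skew-symmetric, their composition is quasi-dissipative, uniformly in the step. -/
lemma IsMultiplier.abs_inner_mulOp_diffOp_le {C : ℝ} {g : E n → ℝ} (hg : IsMultiplier C g)
    (i : Fin n) (h : ℝ) (u : H0 n) : |⟪u, mulOp g (diffOp i h u)⟫| ≤ C * ‖u‖ ^ 2 := by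
  have hC := hg.nonneg
  rcases eq_or_ne h 0 with rfl | h0
  · simp only [diffOp_apply, mul_zero, inv_zero, zero_smul, map_zero, inner_zero_right, abs_zero]
    positivity
  have e : ⟪u, mulOp g (diffOp i h u)⟫ = -⟪u, diffOp i h (mulOp g u)⟫ := by
    rw [← inner_mulOp_left hg.measurable hg.bound, real_inner_comm, inner_diffOp_left]
  have e2 : 2 * ⟪u, mulOp g (diffOp i h u)⟫ =
      -⟪u, diffOp i h (mulOp g u) - mulOp g (diffOp i h u)⟫ := by
    rw [inner_sub_right]; linarith
  have e3 : diffOp i h (mulOp g u) - mulOp g (diffOp i h u) = (2 * h)⁻¹ •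
      ((shift i h (mulOp g u) - mulOp g (shift i h u)) -
        (shift i (-h) (mulOp g u) - mulOp g (shift i (-h) u))) := by
    rw [diffOp_apply, diffOp_apply, map_smul, map_sub, ← smul_sub]
    congr 1
    abel
  have e4 : ‖diffOp i h (mulOp g u) - mulOp g (diffOp i h u)‖ ≤ C * ‖u‖ := by
    rw [e3, norm_smul, norm_inv,
    inv_mul_le_iff₀ (norm_pos_iff.2 (mul_ne_zero two_ne_zero h0))]
    refine (norm_sub_le _ _).trans ((add_le_add (hg.norm_shift_mulOp_sub_le i h u)
      (hg.norm_shift_mulOp_sub_le i (-h) u)).trans_eq ?_)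
    rw [abs_neg, norm_mul, Real.norm_eq_abs, Real.norm_eq_abs, abs_two]; ring
  have e5 : |2 * ⟪u, mulOp g (diffOp i h u)⟫| ≤ ‖u‖ * (C * ‖u‖) := by
    rw [e2, abs_neg]
    exact (abs_real_inner_le_norm _ _).trans (mul_le_mul_of_nonneg_left e4 (norm_nonneg _))
  rw [abs_mul, abs_two] at e5
  nlinarith [abs_nonneg ⟪u, mulOp g (diffOp i h u)⟫]

/-- The central difference quotient on `H¹`. -/
def diffH1 (i : Fin n) (h : ℝ) : H1 n →L[ℝ] H1 n :=
  H1.lift (diffOp i h ∘L toH0) (fun j => diffOp i h ∘L wpd j)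
    fun u j => (hasWeakPd_wpd j u).diffOp i h

/-- The first order operator `u ↦ ∑ᵢ bᵢ ∂ᵢu + c u` from `H¹` to `L₂`. -/
def firstOrderOp (b : Fin n → E n → ℝ) (c : E n → ℝ) : H1 n →L[ℝ] H0 n :=
  ∑ i, mulOp (b i) ∘L wpd i + mulOp c ∘L toH0

/-- The finite difference approximation `u ↦ ∑ᵢ bᵢ Dᵢʰu + c u` of `firstOrderOp b c`, as a bounded
operator on `H¹`. -/
def approxOp (b : Fin n → E n → ℝ) (c : E n → ℝ) (h : ℝ) : H1 n →L[ℝ] H1 n :=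
  ∑ i, mulH1 (b i) ∘L diffH1 i h + mulH1 c

lemma firstOrderOp_apply (b : Fin n → E n → ℝ) (c : E n → ℝ) (u : H1 n) :
    firstOrderOp b c u = ∑ i, mulOp (b i) (wpd i u) + mulOp c (toH0 u) := by
  simp [firstOrderOp]

lemma approxOp_apply (b : Fin n → E n → ℝ) (c : E n → ℝ) (h : ℝ) (u : H1 n) :
    approxOp b c h u = ∑ i, mulH1 (b i) (diffH1 i h u) + mulH1 c u := by
  simp [approxOp]

section

variable {V : Type*} [NormedAddCommGroup V] [InnerProductSpace ℝ V]

lemma map_sum_add_eq {U : Type*} [NormedAddCommGroup U] [NormedSpace ℝ U] (L : U →L[ℝ] V)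
    {ι : Type*} [Fintype ι] {x : ι → U} {x' : ι → V} {y : U} {y' : V} (hx : ∀ i, L (x i) = x' i)
    (hy : L y = y') : L (∑ i, x i + y) = ∑ i, x' i + y' := by
  rw [map_add, map_sum, hy]
  simp only [hx]

lemma opNorm_sum_comp_add_le {ι : Type*} [Fintype ι] {X Y : ι → V →L[ℝ] V} {Z : V →L[ℝ] V}
    {a : ℝ} (hX : ∀ i, ‖X i‖ ≤ a) (hZ : ‖Z‖ ≤ a) :
    ‖∑ i, X i ∘L Y i + Z‖ ≤ ∑ i, a * ‖Y i‖ + a := by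
  refine (norm_add_le _ _).trans (add_le_add (norm_sum_le_of_le _ fun i _ => ?_) hZ)
  exact ((X i).opNorm_comp_le (Y i)).trans (mul_le_mul_of_nonneg_right (hX i) (norm_nonneg _))

lemma inner_sum_add_le {ι : Type*} [Fintype ι] {v y : V} {x : ι → V} {A B : ℝ}
    (hx : ∀ i, ⟪v, x i⟫ ≤ A) (hy : ⟪v, y⟫ ≤ B) :
    ⟪v, ∑ i, x i + y⟫ ≤ Fintype.card ι * A + B := by
  rw [inner_add_right, inner_sum]
  refine add_le_add ((Finset.sum_le_sum fun i _ => hx i).trans_eq ?_) hy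
  simp

lemma inner_sum_add_eq {ι : Type*} [Fintype ι] {u v y y' : V} {x x' : ι → V}
    (hx : ∀ i, ⟪x i, v⟫ = -⟪u, x' i⟫) (hy : ⟪y, v⟫ = ⟪u, y'⟫) :
    ⟪∑ i, x i + y, v⟫ = ⟪u, -∑ i, x' i + y'⟫ := by
  rw [inner_add_left, inner_add_right, sum_inner, inner_neg_right, inner_sum, hy,
    ← Finset.sum_neg_distrib]
  exact congrArg₂ _ (Finset.sum_congr rfl fun i _ => hx i) rfl

end

section

variable {C : ℝ} {b : Fin n → E n → ℝ} {c : E n → ℝ}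

lemma norm_firstOrderOp_le (hb : ∀ i, IsMultiplier C (b i)) (hc : IsMultiplier C c) :
    ‖firstOrderOp b c‖ ≤ n * C + C := by
  have hC := hc.nonneg
  refine ContinuousLinearMap.opNorm_le_bound _ (by positivity) fun u => ?_
  rw [firstOrderOp_apply, add_mul]
  refine (norm_add_le _ _).trans (add_le_add ((norm_sum_le _ _).trans ?_) ?_)
  · refine (Finset.sum_le_sum (g := fun _ => C * ‖u‖) fun i _ => ?_).trans_eq (by simp; ring)
    exact (norm_mulOp_le (hb i).measurable (hb i).bound _).trans
      (mul_le_mul_of_nonneg_left (norm_wpd_le i u) hC)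
  · exact (norm_mulOp_le hc.measurable hc.bound _).trans
      (mul_le_mul_of_nonneg_left (norm_toH0_le u) hC)

lemma norm_approxOp_le (hb : ∀ i, IsMultiplier C (b i)) (hc : IsMultiplier C c) (h : ℝ) :
    ‖approxOp b c h‖ ≤ ∑ i, (C + n * (2 * C)) * ‖diffH1 (n := n) i h‖ + (C + n * (2 * C)) := by
  exact opNorm_sum_comp_add_le (fun i => (hb i).norm_mulH1_le) hc.norm_mulH1_le

lemma toH0_approxOp (hb : ∀ i, IsMultiplier C (b i)) (hc : IsMultiplier C c) (h : ℝ) (u : H1 n) :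
    toH0 (approxOp b c h u) =
      ∑ i, mulOp (b i) (diffOp i h (toH0 u)) + mulOp c (toH0 u) := by
  rw [approxOp_apply]
  exact map_sum_add_eq toH0 (fun i => (hb i).toH0_mulH1 (diffH1 i h u)) (hc.toH0_mulH1 u)

lemma wpd_approxOp (hb : ∀ i, IsMultiplier C (b i)) (hc : IsMultiplier C c) (h : ℝ) (j : Fin n)
    (u : H1 n) :
    wpd j (approxOp b c h u) =
      ∑ i, (mulOp (b i) (diffOp i h (wpd j u)) + mulOp (pd j (b i)) (diffOp i h (toH0 u))) +
        (mulOp c (wpd j u) + mulOp (pd j c) (toH0 u)) := by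
  rw [approxOp_apply]
  exact map_sum_add_eq (wpd j) (fun i => (hb i).wpd_mulH1 j (diffH1 i h u)) (hc.wpd_mulH1 j u)

lemma inner_mulOp_le {g : E n → ℝ} (hm : Measurable g) (hg : ∀ x, |g x| ≤ C) {v w : H0 n} {R : ℝ}
    (hv : ‖v‖ ≤ R) (hw : ‖w‖ ≤ R) : ⟪v, mulOp g w⟫ ≤ C * R ^ 2 := by
  have hC : 0 ≤ C := (abs_nonneg _).trans (hg 0)
  have hR : 0 ≤ R := (norm_nonneg _).trans hv
  calc ⟪v, mulOp g w⟫ ≤ ‖v‖ * ‖mulOp g w‖ := real_inner_le_norm _ _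
    _ ≤ R * (C * R) := by
        refine mul_le_mul hv ((norm_mulOp_le hm hg w).trans ?_) (norm_nonneg _) hR
        gcongr
    _ = C * R ^ 2 := by ring

/-- The approximations are quasi-dissipative on `H¹`, uniformly in the step `h`. -/
lemma inner_approxOp_le (hb : ∀ i, IsMultiplier C (b i)) (hc : IsMultiplier C c) (h : ℝ)
    (u : H1 n) :
    ⟪u, approxOp b c h u⟫ ≤ (n * C + C + n * (n * (2 * C) + 2 * C)) * ‖u‖ ^ 2 := by
  have hC := hc.nonneg
  have hbD : ∀ (i : Fin n) (v : H0 n), ‖v‖ ≤ ‖u‖ →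
      ⟪v, mulOp (b i) (diffOp i h v)⟫ ≤ C * ‖u‖ ^ 2 := fun i v hv =>
    (le_abs_self _).trans (((hb i).abs_inner_mulOp_diffOp_le i h v).trans (by gcongr))
  have h0 : ⟪toH0 u, toH0 (approxOp b c h u)⟫ ≤ n * (C * ‖u‖ ^ 2) + C * ‖u‖ ^ 2 := by
    rw [toH0_approxOp hb hc]
    have := inner_sum_add_le (fun i => hbD i _ (norm_toH0_le u))
      (inner_mulOp_le hc.measurable hc.bound (norm_toH0_le u) (norm_toH0_le u))
    rwa [Fintype.card_fin] at this
  have hj : ∀ j, ⟪wpd j u, wpd j (approxOp b c h u)⟫ ≤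
      n * (2 * C * ‖u‖ ^ 2) + 2 * C * ‖u‖ ^ 2 := by
    intro j
    rw [wpd_approxOp hb hc]
    have h1 : ∀ i, ⟪wpd j u, mulOp (b i) (diffOp i h (wpd j u)) +
        mulOp (pd j (b i)) (diffOp i h (toH0 u))⟫ ≤ 2 * C * ‖u‖ ^ 2 := by
      intro i
      rw [inner_add_right]
      have h1 := hbD i (wpd j u) (norm_wpd_le j u)
      have h2 := inner_mulOp_le ((hb i).measurable_pd j) ((hb i).pd_bound j) (norm_wpd_le j u)
        (((hasWeakPd_wpd i u).norm_diffOp_le h).trans (norm_wpd_le i u))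
      linarith
    have h2 : ⟪wpd j u, mulOp c (wpd j u) + mulOp (pd j c) (toH0 u)⟫ ≤ 2 * C * ‖u‖ ^ 2 := by
      rw [inner_add_right]
      have h1 := inner_mulOp_le hc.measurable hc.bound (norm_wpd_le j u) (norm_wpd_le j u)
      have h2 := inner_mulOp_le (hc.measurable_pd j) (hc.pd_bound j) (norm_wpd_le j u)
        (norm_toH0_le u)
      linarith
    have := inner_sum_add_le h1 h2
    rwa [Fintype.card_fin] at this
  rw [H1.inner_eq]
  calc _ ≤ (n * (C * ‖u‖ ^ 2) + C * ‖u‖ ^ 2) +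
        ∑ _j : Fin n, (n * (2 * C * ‖u‖ ^ 2) + 2 * C * ‖u‖ ^ 2) :=
        add_le_add h0 (Finset.sum_le_sum fun j _ => hj j)
    _ = _ := by simp; ring

/-- The formal adjoint of `approxOp b c h`, applied to `ζ ∈ H¹`. -/
def approxAdj (b : Fin n → E n → ℝ) (c : E n → ℝ) (h : ℝ) (ζ : H1 n) : H0 n :=
  -∑ i, diffOp i h (toH0 (mulH1 (b i) ζ)) + mulOp c (toH0 ζ)

/-- The formal adjoint of `firstOrderOp b c`, applied to `ζ ∈ H¹`. -/
def firstOrderAdj (b : Fin n → E n → ℝ) (c : E n → ℝ) (ζ : H1 n) : H0 n :=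
  -∑ i, wpd i (mulH1 (b i) ζ) + mulOp c (toH0 ζ)

lemma inner_approxOp_left (hb : ∀ i, IsMultiplier C (b i)) (hc : IsMultiplier C c) (h : ℝ)
    (u ζ : H1 n) : ⟪toH0 (approxOp b c h u), toH0 ζ⟫ = ⟪toH0 u, approxAdj b c h ζ⟫ := by
  rw [toH0_approxOp hb hc]
  refine inner_sum_add_eq (fun i => ?_) (inner_mulOp_left hc.measurable hc.bound _ _)
  rw [(hb i).toH0_mulH1, inner_mulOp_left (hb i).measurable (hb i).bound, inner_diffOp_left]

lemma inner_firstOrderOp_left (hb : ∀ i, IsMultiplier C (b i)) (hc : IsMultiplier C c)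
    (u ζ : H1 n) : ⟪firstOrderOp b c u, toH0 ζ⟫ = ⟪toH0 u, firstOrderAdj b c ζ⟫ := by
  rw [firstOrderOp_apply]
  refine inner_sum_add_eq (fun i => ?_) (inner_mulOp_left hc.measurable hc.bound _ _)
  rw [inner_mulOp_left (hb i).measurable (hb i).bound, ← (hb i).toH0_mulH1,
    (hasWeakPd_wpd i u).inner_eq_neg (hasWeakPd_wpd i (mulH1 (b i) ζ))]

lemma norm_approxAdj_le (hb : ∀ i, IsMultiplier C (b i)) (hc : IsMultiplier C c) (h : ℝ)
    (ζ : H1 n) : ‖approxAdj b c h ζ‖ ≤ (n * (C + n * (2 * C)) + C) * ‖ζ‖ := by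
  have hC := hc.nonneg
  rw [approxAdj, add_mul]
  refine (norm_add_le _ _).trans (add_le_add ?_ ?_)
  · rw [norm_neg]
    refine (norm_sum_le _ _).trans ((Finset.sum_le_sum (g := fun _ => (C + n * (2 * C)) * ‖ζ‖)
      fun i _ => ?_).trans_eq (by simp; ring))
    refine ((hasWeakPd_wpd i (mulH1 (b i) ζ)).norm_diffOp_le h).trans ((norm_wpd_le i _).trans ?_)
    exact (mulH1 (b i)).le_of_opNorm_le (hb i).norm_mulH1_le ζ
  · exact (norm_mulOp_le hc.measurable hc.bound _).trans
      (mul_le_mul_of_nonneg_left (norm_toH0_le ζ) hC)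

lemma tendsto_approxAdj (b : Fin n → E n → ℝ) (c : E n → ℝ) (ζ : H1 n) :
    Tendsto (fun h => approxAdj b c h ζ) (𝓝[≠] 0) (𝓝 (firstOrderAdj b c ζ)) :=
  ((tendsto_finsetSum _ fun i _ =>
    (hasWeakPd_wpd i (mulH1 (b i) ζ)).tendsto_diffOp).neg).add_const _

/-- Integration by parts in the transport term: `⟪u, b ∂ᵢu⟫ = -½ ⟪u, (∂ᵢb) u⟫`. -/
lemma IsMultiplier.two_mul_inner_mulOp_wpd {g : E n → ℝ} (hg : IsMultiplier C g) (i : Fin n)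
    (u : H1 n) :
    2 * ⟪toH0 u, mulOp g (wpd i u)⟫ = -⟪toH0 u, mulOp (pd i g) (toH0 u)⟫ := by
  have h1 := (hasWeakPd_wpd i u).inner_eq_neg (hasWeakPd_wpd i (mulH1 g u))
  rw [hg.toH0_mulH1, hg.wpd_mulH1, inner_add_right, ← inner_mulOp_left hg.measurable hg.bound,
    real_inner_comm] at h1
  linarith

end

end Generators

/-! ### Time-dependent coefficients -/

section TimeMeasurability

/-- A map into a separable metric space is measurable if all distances to fixed points are. -/
lemma measurable_of_measurable_dist {α X : Type*} [MeasurableSpace α] [PseudoMetricSpace X]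
    [SecondCountableTopology X] [MeasurableSpace X] [BorelSpace X] {F : α → X}
    (h : ∀ a, Measurable fun t => dist (F t) a) : Measurable F := by
  refine measurable_of_isOpen fun U hU => ?_
  obtain ⟨S, hS, hSc, hSU⟩ := TopologicalSpace.isOpen_biUnion_countable
    {q : X × ℝ | Metric.ball q.1 q.2 ⊆ U} (fun q => Metric.ball q.1 q.2)
    fun q _ => Metric.isOpen_ball
  have hU' : U = ⋃ q ∈ S, Metric.ball q.1 q.2 := by
    rw [hSU]
    refine Subset.antisymm (fun x hx => ?_) (iUnion₂_subset fun q hq => hq)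
    obtain ⟨r, hr, hrU⟩ := Metric.isOpen_iff.1 hU x hx
    exact mem_iUnion₂.2 ⟨(x, r), hrU, Metric.mem_ball_self hr⟩
  rw [hU', preimage_iUnion₂]
  exact MeasurableSet.biUnion hSc fun q _ => measurableSet_lt (h q.1) measurable_const

variable {n : ℕ}

lemma ae_ae_of_ae_prod_Icc {a b : ℝ} {p : E n × ℝ → Prop}
    (h : ∀ᵐ z ∂((volume : Measure (E n × ℝ)).restrict (univ ×ˢ Icc a b)), p z) :
    ∀ᵐ t ∂(volume.restrict (Icc a b)), ∀ᵐ x : E n, p (x, t) := by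
  rw [Measure.volume_eq_prod, ← Measure.prod_restrict, Measure.restrict_univ] at h
  have h1 := (Measure.measurePreserving_swap (μ := (volume : Measure ℝ).restrict (Icc a b))
    (ν := (volume : Measure (E n)))).quasiMeasurePreserving.ae h
  exact Measure.ae_ae_of_ae_prod h1

/-- Multiplication by a jointly measurable bounded function depends measurably on time. -/
lemma aestronglyMeasurable_mulOp {a b C : ℝ} {g : ℝ → E n → ℝ}
    (hg : AEMeasurable (fun z : E n × ℝ => g z.2 z.1)
      ((volume : Measure (E n × ℝ)).restrict (univ ×ˢ Icc a b)))
    (hm : ∀ t ∈ Icc a b, Measurable (g t)) (hb : ∀ t ∈ Icc a b, ∀ x, |g t x| ≤ C) (u : H0 n) :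
    AEStronglyMeasurable (fun t => mulOp (g t) u) (volume.restrict (Icc a b)) := by
  let _ : MeasurableSpace (H0 n) := borel (H0 n)
  have : BorelSpace (H0 n) := ⟨rfl⟩
  rcases lt_or_ge b a with hab | hab
  · rw [Icc_eq_empty (not_le.2 hab), Measure.restrict_empty]
    exact aestronglyMeasurable_zero_measure _
  have hC : 0 ≤ C := (abs_nonneg _).trans (hb a (left_mem_Icc.2 hab) 0)
  -- A globally measurable representative with the same bound.
  set G : E n × ℝ → ℝ := fun z => max (-C) (min C (hg.mk _ z)) with hG
  have hGm : Measurable G := measurable_const.max (measurable_const.min hg.measurable_mk)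
  have hGb : ∀ z, |G z| ≤ C := fun z => abs_le.2
    ⟨le_max_left _ _, max_le (by linarith) (min_le_left _ _)⟩
  have hGt : ∀ t, Measurable fun x => G (x, t) := fun t => hGm.comp measurable_prodMk_right
  have hmeas : Measurable fun t => mulOp (fun x => G (x, t)) u := by
    refine measurable_of_measurable_dist fun w => ?_
    have hsq : ∀ t, dist (mulOp (fun x => G (x, t)) u) w =
        √(∫ x, (G (x, t) * u x - w x) ^ 2) := by
      intro t
      rw [dist_eq_norm, ← Real.sqrt_sq (norm_nonneg (mulOp (fun x => G (x, t)) u - w)),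
        ← real_inner_self_eq_norm_sq, L2.inner_def]
      congr 1
      refine integral_congr_ae ?_
      filter_upwards [coeFn_mulOp (hGt t) (fun x => hGb _) u,
        Lp.coeFn_sub (mulOp (fun x => G (x, t)) u) w] with x h1 h2
      rw [h2, Pi.sub_apply, h1, real_inner_self_eq_norm_sq, Real.norm_eq_abs, sq_abs]
    simp only [hsq]
    refine Measurable.sqrt ?_
    have h1 : StronglyMeasurable fun z : ℝ × E n => (G (z.2, z.1) * u z.2 - w z.2) ^ 2 := by
      have hu := (Lp.stronglyMeasurable u).measurable
      have hw := (Lp.stronglyMeasurable w).measurable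
      exact (((hGm.comp measurable_swap).mul (hu.comp measurable_snd)).sub
        (hw.comp measurable_snd)).pow_const 2 |>.stronglyMeasurable
    exact (h1.integral_prod_right' (ν := (volume : Measure (E n)))).measurable
  refine hmeas.stronglyMeasurable.aestronglyMeasurable.congr ?_
  filter_upwards [ae_ae_of_ae_prod_Icc hg.ae_eq_mk, ae_restrict_mem measurableSet_Icc] with t h1 h2
  refine Lp.ext ?_
  filter_upwards [coeFn_mulOp (hGt t) (fun x => hGb _) u, coeFn_mulOp (hm t h2) (hb t h2) u, h1]
    with x e1 e2 e3
  rw [e1, e2]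
  congr 1
  have := abs_le.1 (hb t h2 x)
  simp only [hG]
  rw [← e3, min_eq_right this.2, max_eq_right this.1]

/-- A jointly measurable function which is Lipschitz in `x` is measurable in `t` for every `x`. -/
lemma aemeasurable_of_lipschitz {a b C : ℝ} {g : ℝ → E n → ℝ}
    (hg : AEMeasurable (fun z : E n × ℝ => g z.2 z.1)
      ((volume : Measure (E n × ℝ)).restrict (univ ×ˢ Icc a b)))
    (hc : ∀ t ∈ Icc a b, Continuous (g t))
    (hl : ∀ t ∈ Icc a b, ∀ x y, |g t y - g t x| ≤ C * dist y x) (x : E n) :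
    AEMeasurable (fun t => g t x) (volume.restrict (Icc a b)) := by
  -- `g t x` is the limit of the averages of `g t` over small balls around `x`.
  set r : ℕ → ℝ := fun k => 1 / ((k : ℝ) + 1) with hr
  have hr0 : ∀ k, 0 < r k := fun k => Nat.one_div_pos_of_nat
  have hrlim : Tendsto r atTop (𝓝 0) := tendsto_one_div_add_atTop_nhds_zero_nat
  refine aemeasurable_of_tendsto_metrizable_ae (u := atTop)
    (f := fun k t => ⨍ y in Metric.ball x (r k), g t y) (fun k => ?_) ?_
  · have h1 : AEStronglyMeasurable (fun z : ℝ × E n => g z.1 z.2)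
        ((volume.restrict (Icc a b)).prod (volume.restrict (Metric.ball x (r k)))) := by
      rw [Measure.volume_eq_prod, ← Measure.prod_restrict, Measure.restrict_univ] at hg
      exact (hg.aestronglyMeasurable.prod_swap).mono_measure
        (Measure.prod_mono le_rfl Measure.restrict_le_self)
    have h2 : AEMeasurable (fun t => ∫ y in Metric.ball x (r k), g t y)
        (volume.restrict (Icc a b)) := h1.integral_prod_right'.aemeasurable
    simp only [setAverage_eq, smul_eq_mul]
    exact h2.const_mul _
  · filter_upwards [ae_restrict_mem measurableSet_Icc] with t ht
    rw [tendsto_iff_norm_sub_tendsto_zero]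
    refine squeeze_zero (fun _ => norm_nonneg _) (g := fun k => |C| * r k) (fun k => ?_) ?_
    · have hμ0 : (volume (Metric.ball x (r k))).toReal ≠ 0 :=
        (ENNReal.toReal_pos (Metric.measure_ball_pos volume x (hr0 k)).ne'
          measure_ball_lt_top.ne).ne'
      have hi : IntegrableOn (g t) (Metric.ball x (r k)) :=
        ((hc t ht).locallyIntegrable.integrableOn_isCompact
          (isCompact_closedBall x (r k))).mono_set Metric.ball_subset_closedBall
      have e : (⨍ y in Metric.ball x (r k), g t y) - g t x =
          (volume (Metric.ball x (r k))).toReal⁻¹ •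
            ∫ y in Metric.ball x (r k), (g t y - g t x) := by
        rw [integral_sub hi (integrableOn_const measure_ball_lt_top.ne), setAverage_eq,
          setIntegral_const]
        simp only [smul_eq_mul, Measure.real]
        rw [mul_sub, ← mul_assoc _ _ (g t x), inv_mul_cancel₀ hμ0, one_mul]
      rw [e, norm_smul, norm_inv, Real.norm_of_nonneg ENNReal.toReal_nonneg,
        inv_mul_le_iff₀ (lt_of_le_of_ne ENNReal.toReal_nonneg hμ0.symm)]
      refine (norm_setIntegral_le_of_norm_le_const (C := |C| * r k) measure_ball_lt_top
        fun y hy => ?_).trans_eq (mul_comm _ _)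
      rw [Real.norm_eq_abs]
      refine (hl t ht x y).trans ?_
      exact mul_le_mul (le_abs_self C) (Metric.mem_ball.1 hy).le dist_nonneg (abs_nonneg _)
    · simpa using hrlim.const_mul |C|

lemma aestronglyMeasurable_piLp {α ι V : Type*} [MeasurableSpace α] {μ : Measure α} [Fintype ι]
    [NormedAddCommGroup V] [SecondCountableTopology V] {F : α → PiLp 2 (fun _ : ι => V)}
    (h : ∀ o, AEStronglyMeasurable (fun t => F t o) μ) : AEStronglyMeasurable F μ := by
  let _ : MeasurableSpace V := borel V
  have : BorelSpace V := ⟨rfl⟩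
  rw [← (PiLp.homeomorph 2 fun _ : ι => V).isEmbedding.aestronglyMeasurable_comp_iff,
    aestronglyMeasurable_iff_aemeasurable]
  exact aemeasurable_pi_iff.2 fun o => (h o).aemeasurable

lemma aestronglyMeasurable_H1 {α : Type*} [MeasurableSpace α] {μ : Measure α} {F : α → H1 n}
    (h0 : AEStronglyMeasurable (fun t => toH0 (F t)) μ)
    (h : ∀ i, AEStronglyMeasurable (fun t => wpd i (F t)) μ) : AEStronglyMeasurable F μ := by
  rw [← Topology.IsEmbedding.subtypeVal.aestronglyMeasurable_comp_iff]
  refine aestronglyMeasurable_piLp fun o => ?_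
  cases o with
  | none => exact h0
  | some i => exact h i

lemma aestronglyMeasurable_sum_add {α ι V : Type*} [MeasurableSpace α] {μ : Measure α} [Fintype ι]
    [NormedAddCommGroup V] {F : ι → α → V} {G : α → V} (hF : ∀ i, AEStronglyMeasurable (F i) μ)
    (hG : AEStronglyMeasurable G μ) : AEStronglyMeasurable (fun t => ∑ i, F i t + G t) μ :=
  (Finset.aestronglyMeasurable_fun_sum _ fun i _ => hF i).add hG

/-- Time-dependent multipliers: for all `t` in the set `I` of times, `g t` is a multiplier with
constant `C`, and the operators of multiplication by `g t` and by its partial derivatives are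
strongly measurable in `t`. -/
structure IsMultiplierFamily (I : Set ℝ) (C : ℝ) (g : ℝ → E n → ℝ) : Prop where
  isMultiplier : ∀ t ∈ I, IsMultiplier C (g t)
  meas : ∀ u, AEStronglyMeasurable (fun t => mulOp (g t) u) (volume.restrict I)
  meas_pd : ∀ j u, AEStronglyMeasurable (fun t => mulOp (pd j (g t)) u) (volume.restrict I)

lemma IsMultiplierFamily.aestronglyMeasurable_mulH1 {I : Set ℝ} (hI : MeasurableSet I) {C : ℝ}
    {g : ℝ → E n → ℝ} (hg : IsMultiplierFamily I C g) (u : H1 n) :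
    AEStronglyMeasurable (fun t => mulH1 (g t) u) (volume.restrict I) := by
  refine aestronglyMeasurable_H1 ((hg.meas (toH0 u)).congr ?_) fun j =>
    ((hg.meas (wpd j u)).add (hg.meas_pd j (toH0 u))).congr ?_
  · filter_upwards [ae_restrict_mem hI] with t ht
    exact ((hg.isMultiplier t ht).toH0_mulH1 u).symm
  · filter_upwards [ae_restrict_mem hI] with t ht
    exact ((hg.isMultiplier t ht).wpd_mulH1 j u).symm

/-- On `H¹`, the adjoints of the approximations converge strongly to the adjoint of the transport
operator, with uniform bounds. -/
lemma exists_transport_adjoint {a b C : ℝ} {β : Fin n → ℝ → E n → ℝ}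
    {c : ℝ → E n → ℝ} (hβ : ∀ i, IsMultiplierFamily (Icc a b) C (β i))
    (hc : IsMultiplierFamily (Icc a b) C c) {r : ℕ → ℝ} (hr : Tendsto r atTop (𝓝[≠] 0))
    (ζ : H1 n) : ∃ (M : ℝ) (y : ℕ → ℝ → H0 n) (y' : ℝ → H0 n),
      (∀ k, AEStronglyMeasurable (y k) (volume.restrict (Icc a b))) ∧
      (∀ k, ∀ᵐ t ∂((volume : Measure ℝ).restrict (Icc a b)), ‖y k t‖ ≤ M) ∧
      (∀ᵐ t ∂((volume : Measure ℝ).restrict (Icc a b)),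
        Tendsto (fun k => y k t) atTop (𝓝 (y' t))) ∧
      (∀ k, ∀ᵐ t ∂((volume : Measure ℝ).restrict (Icc a b)), ∀ u : H1 n,
        ⟪toH0 (approxOp (fun i => β i t) (c t) (r k) u), toH0 ζ⟫ = ⟪toH0 u, y k t⟫) ∧
      (∀ᵐ t ∂((volume : Measure ℝ).restrict (Icc a b)), ∀ u : H1 n,
        ⟪firstOrderOp (fun i => β i t) (c t) u, toH0 ζ⟫ = ⟪toH0 u, y' t⟫) := by
  have hβt : ∀ t ∈ Icc a b, ∀ i, IsMultiplier C (β i t) := fun t ht i =>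
    (hβ i).isMultiplier t ht
  have hct : ∀ t ∈ Icc a b, IsMultiplier C (c t) := hc.isMultiplier
  have hmem : ∀ᵐ t ∂((volume : Measure ℝ).restrict (Icc a b)), t ∈ Icc a b :=
    ae_restrict_mem measurableSet_Icc
  refine ⟨(n * (C + n * (2 * C)) + C) * ‖ζ‖, fun k t => approxAdj (fun i => β i t) (c t) (r k) ζ,
    fun t => firstOrderAdj (fun i => β i t) (c t) ζ, fun k => ?_, fun k => ?_, ?_, fun k => ?_, ?_⟩
  · have h1 : ∀ i, AEStronglyMeasurable (fun t => diffOp i (r k) (toH0 (mulH1 (β i t) ζ)))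
        (volume.restrict (Icc a b)) := fun i =>
      ((diffOp i (r k)) ∘L toH0).continuous.comp_aestronglyMeasurable
        ((hβ i).aestronglyMeasurable_mulH1 measurableSet_Icc ζ)
    simp only [approxAdj, ← Finset.sum_neg_distrib]
    exact aestronglyMeasurable_sum_add (fun i => (h1 i).neg) (hc.meas _)
  · exact hmem.mono fun t ht => norm_approxAdj_le (hβt t ht) (hct t ht) _ ζ
  · exact Eventually.of_forall fun t => (tendsto_approxAdj _ _ ζ).comp hr
  · exact hmem.mono fun t ht u => inner_approxOp_left (hβt t ht) (hct t ht) _ u ζ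
  · exact hmem.mono fun t ht u => inner_firstOrderOp_left (hβt t ht) (hct t ht) u ζ

/-- Existence for the transport equation `∂u/∂t = ∑ᵢ bᵢ ∂ᵢu + c u + φ`, `u(a) = ρ`, with
coefficients that are multipliers of `H¹`. -/
theorem exists_transport {a b C : ℝ} (hab : a ≤ b) {β : Fin n → ℝ → E n → ℝ} {c : ℝ → E n → ℝ}
    (hβ : ∀ i, IsMultiplierFamily (Icc a b) C (β i)) (hc : IsMultiplierFamily (Icc a b) C c)
    (ρ : H1 n) {φ : ℝ → H1 n} (hφ : MemLp φ 2 (volume.restrict (Icc a b))) :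
    ∃ w : ℝ → H1 n, MemLp w 2 (volume.restrict (Icc a b)) ∧
      ∀ᵐ t ∂(volume.restrict (Icc a b)), toH0 (w t) =
        toH0 ρ + ∫ τ in a..t, (firstOrderOp (fun i => β i τ) (c τ) (w τ) + toH0 (φ τ)) := by
  have hβt : ∀ t ∈ Icc a b, ∀ i, IsMultiplier C (β i t) := fun t ht i =>
    (hβ i).isMultiplier t ht
  have hct : ∀ t ∈ Icc a b, IsMultiplier C (c t) := hc.isMultiplier
  have hC : 0 ≤ C := (hct a (left_mem_Icc.2 hab)).nonneg
  have hmem : ∀ᵐ t ∂((volume : Measure ℝ).restrict (Icc a b)), t ∈ Icc a b :=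
    ae_restrict_mem measurableSet_Icc
  let r : ℕ → ℝ := fun k => 1 / ((k : ℝ) + 1)
  have hrlim : Tendsto r atTop (𝓝[≠] 0) := tendsto_nhdsWithin_iff.2
    ⟨tendsto_one_div_add_atTop_nhds_zero_nat,
      Eventually.of_forall fun k => (Nat.one_div_pos_of_nat (n := k)).ne'⟩
  have hBm : ∀ v : H1 n, AEStronglyMeasurable (fun t => firstOrderOp (fun i => β i t) (c t) v)
      (volume.restrict (Icc a b)) := by
    intro v
    simp only [firstOrderOp_apply]
    exact aestronglyMeasurable_sum_add (fun i => (hβ i).meas _) (hc.meas _)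
  have hBb : ∀ᵐ t ∂((volume : Measure ℝ).restrict (Icc a b)),
      ‖firstOrderOp (fun i => β i t) (c t)‖ ≤ n * C + C :=
    hmem.mono fun t ht => norm_firstOrderOp_le (hβt t ht) (hct t ht)
  have hAm : ∀ k, ∀ v : H1 n, AEStronglyMeasurable
      (fun t => approxOp (fun i => β i t) (c t) (r k) v) (volume.restrict (Icc a b)) := by
    intro k v
    simp only [approxOp_apply]
    exact aestronglyMeasurable_sum_add
      (fun i => (hβ i).aestronglyMeasurable_mulH1 measurableSet_Icc _)
      (hc.aestronglyMeasurable_mulH1 measurableSet_Icc _)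
  have hAb : ∀ k, ∃ M, ∀ᵐ t ∂((volume : Measure ℝ).restrict (Icc a b)),
      ‖approxOp (fun i => β i t) (c t) (r k)‖ ≤ M := fun k =>
    ⟨_, hmem.mono fun t ht => norm_approxOp_le (hβt t ht) (hct t ht) (r k)⟩
  have hAd : ∀ k, ∀ᵐ t ∂((volume : Measure ℝ).restrict (Icc a b)), ∀ u : H1 n,
      ⟪u, approxOp (fun i => β i t) (c t) (r k) u⟫ ≤
        (n * C + C + n * (n * (2 * C) + 2 * C)) * ‖u‖ ^ 2 := fun k =>
    hmem.mono fun t ht u => inner_approxOp_le (hβt t ht) (hct t ht) (r k) u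
  have hl : 0 ≤ n * C + C + n * (n * (2 * C) + 2 * C) := by positivity
  refine exists_evolution (J := toH0) (B := fun t => firstOrderOp (fun i => β i t) (c t))
    (A := fun k t => approxOp (fun i => β i t) (c t) (r k))
    hab denseRange_toH0 hBm hBb hAm hAb hl hAd
    (fun ζ => exists_transport_adjoint hβ hc hrlim ζ) ρ hφ

end TimeMeasurability

/-! ### The coefficients of an admissible field -/

section Coefficients

variable {n : ℕ}

lemma hasPd_neg {i : Fin n} {g : E n → ℝ} {x : E n} (h : HasPd i g x) :
    HasPd i (fun y => -g y) x :=
  DifferentiableAt.fun_neg h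

lemma pd_neg (i : Fin n) (g : E n → ℝ) (x : E n) : pd i (fun y => -g y) x = -pd i g x :=
  deriv.fun_neg

lemma hasPd_sum {i : Fin n} {g : Fin n → E n → ℝ} {x : E n} (h : ∀ k, HasPd i (g k) x) :
    HasPd i (fun y => ∑ k, g k y) x :=
  DifferentiableAt.fun_sum fun k _ => h k

lemma pd_sum {i : Fin n} {g : Fin n → E n → ℝ} {x : E n} (h : ∀ k, HasPd i (g k) x) :
    pd i (fun y => ∑ k, g k y) x = ∑ k, pd i (g k) x :=
  deriv_fun_sum fun k _ => h k

lemma IsMultiplier.neg {C : ℝ} {g : E n → ℝ} (hg : IsMultiplier C g) :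
    IsMultiplier C fun x => -g x where
  bound x := by rw [abs_neg]; exact hg.bound x
  hasPd i x := hasPd_neg (hg.hasPd i x)
  pd_bound i x := by rw [pd_neg, abs_neg]; exact hg.pd_bound i x

lemma IsMultiplier.zero {C : ℝ} (hC : 0 ≤ C) : IsMultiplier C fun _ : E n => (0 : ℝ) where
  bound x := by simpa using hC
  hasPd i x := differentiableAt_const (0 : ℝ)
  pd_bound i x := by
    have : pd i (fun _ : E n => (0 : ℝ)) x = 0 := deriv_const _ (0 : ℝ)
    rw [this]; simpa using hC

lemma IsMultiplierFamily.neg {I : Set ℝ} (hI : MeasurableSet I) {C : ℝ} {g : ℝ → E n → ℝ}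
    (hg : IsMultiplierFamily I C g) : IsMultiplierFamily I C fun t x => -g t x where
  isMultiplier t ht := (hg.isMultiplier t ht).neg
  meas u := (hg.meas u).neg.congr <| (ae_restrict_mem hI).mono fun t ht =>
    (mulOp_neg (hg.isMultiplier t ht).measurable (hg.isMultiplier t ht).bound u).symm
  meas_pd j u := (hg.meas_pd j u).neg.congr <| (ae_restrict_mem hI).mono fun t ht => by
    have e : pd j (fun x => -g t x) = fun x => -pd j (g t) x := funext fun x => pd_neg j _ x
    simp only [e]
    exact (mulOp_neg ((hg.isMultiplier t ht).measurable_pd j)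
      ((hg.isMultiplier t ht).pd_bound j) u).symm

lemma IsMultiplierFamily.zero {I : Set ℝ} {C : ℝ} (hC : 0 ≤ C) :
    IsMultiplierFamily I C fun _ (_ : E n) => (0 : ℝ) where
  isMultiplier _ _ := IsMultiplier.zero hC
  meas _ := aestronglyMeasurable_const
  meas_pd _ _ := aestronglyMeasurable_const

lemma IsMultiplierFamily.mono {I I' : Set ℝ} (h : I' ⊆ I) {C : ℝ} {g : ℝ → E n → ℝ}
    (hg : IsMultiplierFamily I C g) : IsMultiplierFamily I' C g where
  isMultiplier t ht := hg.isMultiplier t (h ht)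
  meas u := (hg.meas u).mono_measure (Measure.restrict_mono_set _ h)
  meas_pd j u := (hg.meas_pd j u).mono_measure (Measure.restrict_mono_set _ h)

lemma measurePreserving_reflect (T : ℝ) : MeasurePreserving (fun t : ℝ => T - t)
    (volume.restrict (Icc 0 T)) (volume.restrict (Icc 0 T)) := by
  have h := (Measure.measurePreserving_sub_left (volume : Measure ℝ) T).restrict_preimage
    (measurableSet_Icc (a := (0 : ℝ)) (b := T))
  have e : (fun t : ℝ => T - t) ⁻¹' Icc 0 T = Icc 0 T := by
    ext t
    simp only [mem_preimage, mem_Icc]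
    constructor <;> rintro ⟨h1, h2⟩ <;> constructor <;> linarith
  rwa [e] at h

lemma IsMultiplierFamily.reflect {T C : ℝ} {g : ℝ → E n → ℝ}
    (hg : IsMultiplierFamily (Icc 0 T) C g) :
    IsMultiplierFamily (Icc 0 T) C fun t x => g (T - t) x where
  isMultiplier t ht := hg.isMultiplier (T - t) ⟨by linarith [ht.2], by linarith [ht.1]⟩
  meas u := (hg.meas u).comp_measurePreserving (measurePreserving_reflect T)
  meas_pd j u := (hg.meas_pd j u).comp_measurePreserving (measurePreserving_reflect T)

lemma IsMultiplierFamily.of_aemeasurable {a b C : ℝ} {g : ℝ → E n → ℝ}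
    (hg : ∀ t ∈ Icc a b, IsMultiplier C (g t))
    (hm : AEMeasurable (fun z : E n × ℝ => g z.2 z.1)
      ((volume : Measure (E n × ℝ)).restrict (univ ×ˢ Icc a b)))
    (hmd : ∀ j, AEMeasurable (fun z : E n × ℝ => pd j (g z.2) z.1)
      ((volume : Measure (E n × ℝ)).restrict (univ ×ˢ Icc a b))) :
    IsMultiplierFamily (Icc a b) C g where
  isMultiplier := hg
  meas := aestronglyMeasurable_mulOp hm (fun t ht => (hg t ht).measurable)
    fun t ht => (hg t ht).bound
  meas_pd j := aestronglyMeasurable_mulOp (g := fun t => pd j (g t)) (hmd j)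
    (fun t ht => (hg t ht).measurable_pd j) fun t ht => (hg t ht).pd_bound j

end Coefficients

section EnergyInequality

variable {n : ℕ} {C : ℝ}

lemma IsMultiplier.measurable_sum_pd {b : Fin n → E n → ℝ} (hb : ∀ i, IsMultiplier C (b i)) :
    Measurable fun x => ∑ i, pd i (b i) x :=
  Finset.measurable_sum _ fun i _ => (hb i).measurable_pd i

lemma mulOp_two_mul_sub {c d : E n → ℝ} {C₁ C₂ : ℝ} (hc : Measurable c) (hcb : ∀ x, |c x| ≤ C₁)
    (hd : Measurable d) (hdb : ∀ x, |d x| ≤ C₂) (u : H0 n) :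
    mulOp (fun x => 2 * c x - d x) u = (2 : ℝ) • mulOp c u - mulOp d u := by
  have hb : ∀ x, |2 * c x - d x| ≤ 2 * C₁ + C₂ := fun x => by
    have := abs_sub (2 * c x) (d x)
    rw [abs_mul, abs_two] at this
    linarith [hcb x, hdb x]
  refine Lp.ext ?_
  filter_upwards [coeFn_mulOp (g := fun x => 2 * c x - d x) ((hc.const_mul 2).sub hd) hb u,
    coeFn_mulOp hc hcb u,
    coeFn_mulOp hd hdb u, Lp.coeFn_smul (2 : ℝ) (mulOp c u),
    Lp.coeFn_sub ((2 : ℝ) • mulOp c u) (mulOp d u)] with x h1 h2 h3 h4 h5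
  simp only [h1, h5, Pi.sub_apply, h4, Pi.smul_apply, h2, h3, smul_eq_mul]
  ring

lemma inner_sum_add_le_of_two_smul_sub {ι V : Type*} [Fintype ι] [NormedAddCommGroup V]
    [InnerProductSpace ℝ V] {w z : V} {F G : ι → V} {D : ℝ}
    (h : ∀ i, 2 * ⟪w, F i⟫ = -⟪w, G i⟫)
    (hD : ⟪w, (2 : ℝ) • z - ∑ i, G i⟫ ≤ 2 * D * ‖w‖ ^ 2) :
    ⟪w, ∑ i, F i + z⟫ ≤ D * ‖w‖ ^ 2 := by
  have h1 : 2 * ⟪w, ∑ i, F i⟫ = -⟪w, ∑ i, G i⟫ := by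
    rw [inner_sum, inner_sum, Finset.mul_sum, ← Finset.sum_neg_distrib]
    exact Finset.sum_congr rfl fun i _ => h i
  rw [inner_sub_right, real_inner_smul_right] at hD
  rw [inner_add_right]
  linarith

/-- The energy inequality: integrating by parts, the first-order terms contribute
`-½ (∑ᵢ ∂ᵢbᵢ) u²`. -/
lemma inner_firstOrderOp_self_le {b : Fin n → E n → ℝ} {c : E n → ℝ}
    (hb : ∀ i, IsMultiplier C (b i)) (hc : IsMultiplier C c) {D : ℝ}
    (hD : ∀ x, |2 * c x - ∑ i, pd i (b i) x| ≤ 2 * D) (u : H1 n) :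
    ⟪toH0 u, firstOrderOp b c u⟫ ≤ D * ‖toH0 u‖ ^ 2 := by
  have hsm := IsMultiplier.measurable_sum_pd hb
  have hs : ∀ x, |∑ i, pd i (b i) x| ≤ ∑ _i : Fin n, C := fun x =>
    (Finset.abs_sum_le_sum_abs _ _).trans (Finset.sum_le_sum fun i _ => (hb i).pd_bound i x)
  have h2 : ⟪toH0 u, mulOp (fun x => 2 * c x - ∑ i, pd i (b i) x) (toH0 u)⟫ ≤
      2 * D * ‖toH0 u‖ ^ 2 :=
    (inner_mulOp_le ((hc.measurable.const_mul 2).sub hsm) hD le_rfl le_rfl).trans_eq (by ring)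
  rw [mulOp_two_mul_sub hc.measurable hc.bound hsm hs,
    mulOp_sum (fun i => (hb i).measurable_pd i) (fun i => (hb i).pd_bound i)] at h2
  rw [firstOrderOp_apply]
  exact inner_sum_add_le_of_two_smul_sub (fun i => (hb i).two_mul_inner_mulOp_wpd i u) h2

end EnergyInequality

section Admissible

variable {n : ℕ} {T : ℝ} {f : E n → ℝ → E n}

/-- The components of an admissible field and its divergence are multipliers of `H¹`. -/
lemma IsAdmissible.exists_isMultiplierFamily (hf : IsAdmissible n T f) :
    ∃ C, 0 ≤ C ∧ (∀ k, IsMultiplierFamily (Icc 0 T) C fun t x => f x t k) ∧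
      IsMultiplierFamily (Icc 0 T) C fun t x => divx f x t := by
  obtain ⟨C, hC⟩ := hf.bounded
  set M : ℝ := max C 0
  have hM : 0 ≤ M := le_max_right _ _
  have hCM : C ≤ M := le_max_left _ _
  have hMn : M ≤ (n + 1) * M := by nlinarith [Nat.cast_nonneg (α := ℝ) n]
  have hsum : ∀ F : Fin n → ℝ, (∀ i, |F i| ≤ C) → |∑ i, F i| ≤ (n + 1) * M := by
    intro F hF
    calc |∑ i, F i| ≤ ∑ i : Fin n, M := (Finset.abs_sum_le_sum_abs _ _).trans
          (Finset.sum_le_sum fun i _ => (hF i).trans hCM)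
      _ ≤ (n + 1) * M := by
          rw [Finset.sum_const, Finset.card_univ, Fintype.card_fin, nsmul_eq_mul]; linarith
  have hd : ∀ t ∈ Icc 0 T, ∀ j x, pd j (fun y => divx f y t) x =
      ∑ i, pd j (pd i fun y => f y t i) x := fun t ht j x =>
    pd_sum fun i => hf.exists_d2 t ht x i i j
  have h1 : ∀ k, ∀ t ∈ Icc 0 T, IsMultiplier ((n + 1) * M) fun x => f x t k := fun k t ht =>
    { bound := fun x => (hC t ht x k k k).1.trans (hCM.trans hMn)
      hasPd := fun i x => hf.exists_d1 t ht x k i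
      pd_bound := fun i x => (hC t ht x k i i).2.1.trans (hCM.trans hMn) }
  have h2 : ∀ t ∈ Icc 0 T, IsMultiplier ((n + 1) * M) fun x => divx f x t := fun t ht =>
    { bound := fun x => hsum _ fun i => (hC t ht x i i i).2.1
      hasPd := fun j x => hasPd_sum fun i => hf.exists_d2 t ht x i i j
      pd_bound := fun j x => by
        rw [hd t ht]
        exact hsum _ fun i => (hC t ht x i i j).2.2 }
  refine ⟨(n + 1) * M, by positivity, fun k => .of_aemeasurable (h1 k) (hf.measurable_f k)
    fun j => hf.measurable_d1 k j, .of_aemeasurable h2 ?_ fun j => ?_⟩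
  · exact Finset.aemeasurable_fun_sum _ fun i _ => hf.measurable_d1 i i
  · refine (Finset.aemeasurable_fun_sum Finset.univ fun i _ => hf.measurable_d2 i i j).congr ?_
    filter_upwards [ae_restrict_mem (MeasurableSet.univ.prod measurableSet_Icc)] with z hz
    exact (hd z.2 hz.2 j z.1).symm

lemma delta_nonneg (f : E n → ℝ → E n) (t : ℝ) : 0 ≤ delta f t :=
  mul_nonneg (by norm_num) (Real.iSup_nonneg fun _ => abs_nonneg _)

lemma delta_le {C t : ℝ} (h : IsMultiplier C fun x => divx f x t) : delta f t ≤ C := by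
  have h1 : ⨆ x, |divx f x t| ≤ C := ciSup_le h.bound
  have := h.nonneg
  unfold delta
  linarith

lemma abs_divx_le {C t : ℝ} (h : IsMultiplier C fun x => divx f x t) (x : E n) :
    |divx f x t| ≤ 2 * delta f t := by
  have h1 : |divx f x t| ≤ ⨆ x, |divx f x t| :=
    le_ciSup ⟨C, by rintro _ ⟨y, rfl⟩; exact h.bound y⟩ x
  unfold delta
  linarith

lemma IsAdmissible.integrable_delta (hf : IsAdmissible n T f) :
    Integrable (delta f) (volume.restrict (Icc 0 T)) := by
  obtain ⟨C, hC, -, hd⟩ := hf.exists_isMultiplierFamily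
  have hmem : ∀ᵐ t ∂((volume : Measure ℝ).restrict (Icc 0 T)), t ∈ Icc 0 T :=
    ae_restrict_mem measurableSet_Icc
  have hm : ∀ x, AEMeasurable (fun t => divx f x t) (volume.restrict (Icc 0 T)) := by
    refine aemeasurable_of_lipschitz (C := C * n) (g := fun t x => divx f x t)
      (Finset.aemeasurable_fun_sum _ fun i _ => hf.measurable_d1 i i)
      (fun t ht => (hd.isMultiplier t ht).continuous) fun t ht x y => ?_
    refine ((hd.isMultiplier t ht).abs_sub_le_sum x y).trans ?_
    rw [mul_assoc]
    refine mul_le_mul_of_nonneg_left ?_ hC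
    have h1 : ∀ i, |y i - x i| ≤ dist y x := fun i => by
      rw [dist_eq_norm]
      exact PiLp.norm_apply_le (y - x) i
    exact (Finset.sum_le_sum fun i _ => h1 i).trans_eq (by simp)
  refine Integrable.mono' (g := fun _ => C) (integrable_const _) ?_
    (hmem.mono fun t ht => by
      rw [Real.norm_of_nonneg (delta_nonneg f t)]
      exact delta_le (hd.isMultiplier t ht))
  -- By continuity, the supremum may be taken over a countable dense set.
  have h1 : AEMeasurable
      (fun t => (1 / 2 : ℝ) * ⨆ k, |divx f (TopologicalSpace.denseSeq (E n) k) t|)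
      (volume.restrict (Icc 0 T)) := by
    refine AEMeasurable.const_mul (AEMeasurable.iSup fun k => ?_) _
    exact continuous_abs.measurable.comp_aemeasurable (hm _)
  refine h1.aestronglyMeasurable.congr (hmem.mono fun t ht => ?_)
  have hmul := hd.isMultiplier t ht
  change (1 / 2 : ℝ) * _ = (1 / 2 : ℝ) * _
  congr 1
  have hbdd : BddAbove (range fun k => |divx f (TopologicalSpace.denseSeq (E n) k) t|) :=
    ⟨C, by rintro _ ⟨y, rfl⟩; exact hmul.bound _⟩
  refine le_antisymm (ciSup_le fun k => le_ciSup (f := fun x => |divx f x t|)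
    ⟨C, by rintro _ ⟨y, rfl⟩; exact hmul.bound y⟩ _) (ciSup_le fun x => ?_)
  have hcl : IsClosed {x | |divx f x t| ≤ ⨆ k, |divx f (TopologicalSpace.denseSeq (E n) k) t|} :=
    isClosed_le hmul.continuous.abs continuous_const
  exact (TopologicalSpace.denseRange_denseSeq (E n)).induction_on
    (p := fun x => |divx f x t| ≤ ⨆ k, |divx f (TopologicalSpace.denseSeq (E n) k) t|)
    x hcl fun k => le_ciSup hbdd k

end Admissible

/-! ### Extension of solution operators by density -/

section Extension

/-- A linear problem `Sol`, solvable for the data in the range of a dense map `J`, whose solutions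
are bounded by the data, is uniquely solvable for these data, and its solution operator has a
unique continuous extension to all data. -/
theorem existsUnique_and_exists_extension {X Y Z : Type*} [AddCommGroup X] [Module ℝ X]
    [NormedAddCommGroup Y] [NormedSpace ℝ Y] [NormedAddCommGroup Z] [NormedSpace ℝ Z]
    [CompleteSpace Z] (J : X →ₗ[ℝ] Y) (hJ : DenseRange J) {Sol : Y → Z → Prop} {K : ℝ}
    (hK : 0 ≤ K) (hadd : ∀ y y' z z', Sol y z → Sol y' z' → Sol (y + y') (z + z'))
    (hsmul : ∀ (c : ℝ) y z, Sol y z → Sol (c • y) (c • z))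
    (hle : ∀ y z, Sol y z → ‖z‖ ≤ K * ‖y‖) (hex : ∀ x, ∃ z, Sol (J x) z) :
    (∀ x, ∃! z, Sol (J x) z) ∧ ∃ L : Y →L[ℝ] Z, (∀ x, Sol (J x) (L (J x))) ∧
      (∀ L' : Y →L[ℝ] Z, (∀ x, Sol (J x) (L' (J x))) → L' = L) ∧ ‖L‖ ≤ K := by
  have huniq : ∀ y z z', Sol y z → Sol y z' → z = z' := by
    intro y z z' h h'
    have h1 := hle _ _ (hadd _ _ _ _ h (hsmul (-1) _ _ h'))
    have e1 : y + (-1 : ℝ) • y = 0 := by module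
    have e2 : z + (-1 : ℝ) • z' = z - z' := by module
    rw [e1, e2, norm_zero, mul_zero] at h1
    exact sub_eq_zero.1 (norm_le_zero_iff.1 h1)
  choose F hF using hex
  let FL : X →ₗ[ℝ] Z :=
    { toFun := F
      map_add' := fun x x' => huniq (J (x + x')) _ _ (hF _)
        ((map_add J x x').symm ▸ hadd _ _ _ _ (hF x) (hF x'))
      map_smul' := fun c x => huniq (J (c • x)) _ _ (hF _)
        ((map_smul J c x).symm ▸ hsmul c _ _ (hF x)) }
  have hFL : ∀ x, ‖FL x‖ ≤ K * ‖J x‖ := fun x => hle _ _ (hF x)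
  have hL : ∀ x, FL.extendOfNorm J (J x) = F x := fun x =>
    LinearMap.extendOfNorm_eq (f := FL) hJ ⟨K, hFL⟩ x
  refine ⟨fun x => ⟨F x, hF x, fun z hz => huniq _ _ _ hz (hF x)⟩, FL.extendOfNorm J,
    fun x => by rw [hL]; exact hF x, fun L' hL' => ?_, LinearMap.opNorm_extendOfNorm_le hJ hK hFL⟩
  exact (LinearMap.extendOfNorm_unique hJ K hFL L'
    (LinearMap.ext fun x => huniq _ _ _ (hL' x) (hF x))).symm

end Extension

section Density

lemma continuous_indicatorConstLp_const {V : Type*} [NormedAddCommGroup V] [NormedSpace ℝ V]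
    {α : Type*} [MeasurableSpace α] {μ : Measure α} {s : Set α} (hs : MeasurableSet s)
    (hμs : μ s ≠ ⊤) : Continuous fun c : V => indicatorConstLp 1 hs hμs c := by
  refine (LipschitzWith.of_dist_le_mul (K := (μ.real s).toNNReal) fun c c' => ?_).continuous
  rw [dist_eq_norm, dist_eq_norm, indicatorConstLp_sub, Real.coe_toNNReal _ measureReal_nonneg]
  refine norm_indicatorConstLp_le.trans_eq ?_
  simp [mul_comm]

variable {V W α : Type*} [NormedAddCommGroup V] [NormedSpace ℝ V] [NormedAddCommGroup W]
  [NormedSpace ℝ W] [MeasurableSpace α] {μ : Measure α} [IsFiniteMeasure μ]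

lemma memLp_one_comp (J : V →L[ℝ] W) (φ : Lp V 2 μ) : MemLp (fun t => J (φ t)) 1 μ :=
  (J.comp_memLp' (Lp.memLp φ)).mono_exponent (by norm_num)

/-- The map `L²(V) → L¹(W)` induced by a continuous linear map `J : V → W`. -/
noncomputable def lpIncl (μ : Measure α) [IsFiniteMeasure μ] (J : V →L[ℝ] W) :
    Lp V 2 μ →ₗ[ℝ] Lp W 1 μ where
  toFun φ := (memLp_one_comp J φ).toLp
  map_add' φ ψ := by
    refine Lp.ext ?_
    filter_upwards [(memLp_one_comp J (φ + ψ)).coeFn_toLp, (memLp_one_comp J φ).coeFn_toLp,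
      (memLp_one_comp J ψ).coeFn_toLp,
      Lp.coeFn_add (memLp_one_comp J φ).toLp (memLp_one_comp J ψ).toLp, Lp.coeFn_add φ ψ]
      with t h1 h2 h3 h4 h5
    rw [h4, Pi.add_apply, h1, h2, h3, h5, Pi.add_apply, map_add]
  map_smul' c φ := by
    refine Lp.ext ?_
    filter_upwards [(memLp_one_comp J (c • φ)).coeFn_toLp, (memLp_one_comp J φ).coeFn_toLp,
      Lp.coeFn_smul c (memLp_one_comp J φ).toLp, Lp.coeFn_smul c φ] with t h1 h2 h3 h4
    rw [RingHom.id_apply, h3, Pi.smul_apply, h1, h2, h4, Pi.smul_apply, map_smul]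

lemma denseRange_lpIncl {J : V →L[ℝ] W} (hJ : DenseRange J) : DenseRange (lpIncl μ J) := by
  set S : Submodule ℝ (Lp W 1 μ) := (LinearMap.range (lpIncl μ J)).topologicalClosure
  have hS : ∀ φ, lpIncl μ J φ ∈ S := fun φ => Submodule.le_topologicalClosure _ ⟨φ, rfl⟩
  intro ψ
  have hcoe : (S : Set (Lp W 1 μ)) = closure (range (lpIncl μ J)) := by
    rw [← LinearMap.coe_range]
    exact Submodule.topologicalClosure_coe _
  rw [← hcoe]
  refine Lp.induction (by norm_num) (motive := fun ψ => ψ ∈ S) ?_ ?_ ?_ ψ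
  · intro c A hA hμA
    rw [Lp.simpleFunc.coe_indicatorConst]
    refine hJ.induction_on (p := fun c => indicatorConstLp 1 hA hμA.ne c ∈ S) c
      ((Submodule.isClosed_topologicalClosure _).preimage
        (continuous_indicatorConstLp_const hA hμA.ne)) fun h => ?_
    have e : lpIncl μ J (indicatorConstLp 2 hA hμA.ne h) = indicatorConstLp 1 hA hμA.ne (J h) := by
      refine Lp.ext ?_
      filter_upwards [(memLp_one_comp J (indicatorConstLp 2 hA hμA.ne h)).coeFn_toLp,
        indicatorConstLp_coeFn (p := 1) (hs := hA) (hμs := hμA.ne) (c := J h),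
        indicatorConstLp_coeFn (p := 2) (hs := hA) (hμs := hμA.ne) (c := h)] with t h1 h2 h3
      rw [h2]
      refine h1.trans ?_
      rw [h3]
      by_cases ht : t ∈ A <;> simp [ht]
    rw [← e]
    exact hS _
  · intro f g hf hg _ hfS hgS
    exact S.add_mem hfS hgS
  · exact Submodule.isClosed_topologicalClosure _

end Density

/-! ### Mild solutions of initial and terminal value problems -/

section Mild

variable {H K : Type*} [NormedAddCommGroup H] [InnerProductSpace ℝ H] [NormedAddCommGroup K]
  [InnerProductSpace ℝ K] {a b : ℝ}

/-- `u ∈ C([a, b] → K)` satisfies `u(t) = ρ + ∫_{lo t}^{hi t} (P u + φ)`; here `w` is `u` as an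
element of `L²([a, b] → H)`, where `H` is embedded in `K` by `J`, and `g` is `P u`. The endpoints
`(a, t)` and `(t, b)` express an initial and a terminal value problem. -/
def IsMildSolution (J : H →L[ℝ] K) (P : ℝ → H →L[ℝ] K) (lo hi : Icc a b → Icc a b) (ρ : K)
    (φ : Lp K 1 ((volume : Measure ℝ).restrict (Icc a b))) (u : C(Icc a b, K)) : Prop :=
  ∃ (w : Lp H 2 ((volume : Measure ℝ).restrict (Icc a b)))
    (g : Lp K 1 ((volume : Measure ℝ).restrict (Icc a b))),
    (∀ᵐ t ∂((volume : Measure ℝ).restrict (Icc a b)), ∀ ht : t ∈ Icc a b,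
      u ⟨t, ht⟩ = J (w t)) ∧
    (∀ᵐ t ∂((volume : Measure ℝ).restrict (Icc a b)), g t = P t (w t)) ∧
    ∀ t : Icc a b, u t = ρ + ∫ τ in (lo t : ℝ)..(hi t), (g τ + φ τ)

variable {J : H →L[ℝ] K} {P : ℝ → H →L[ℝ] K} {lo hi : Icc a b → Icc a b}

lemma intervalIntegrable_of_mem_Icc {V : Type*} [NormedAddCommGroup V] {g : ℝ → V}
    (hg : Integrable g (volume.restrict (Icc a b))) (t t' : Icc a b) :
    IntervalIntegrable g volume t t' :=
  (intervalIntegrable_iff.2 (IntegrableOn.mono_set hg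
    (uIoc_subset_uIcc.trans (uIcc_subset_Icc t.2 t'.2))))

lemma intervalIntegral_congr_of_ae_Icc {V : Type*} [NormedAddCommGroup V] [NormedSpace ℝ V]
    {g g' : ℝ → V} (h : g =ᵐ[volume.restrict (Icc a b)] g') (t t' : Icc a b) :
    ∫ τ in (t : ℝ)..t', g τ = ∫ τ in (t : ℝ)..t', g' τ :=
  intervalIntegral.integral_congr_ae (ae_restrict_Icc_of_ae_uIoc h t.2 t'.2)

lemma IsMildSolution.add {ρ ρ' : K} {φ φ' : Lp K 1 ((volume : Measure ℝ).restrict (Icc a b))}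
    {u u' : C(Icc a b, K)} (h : IsMildSolution J P lo hi ρ φ u)
    (h' : IsMildSolution J P lo hi ρ' φ' u') :
    IsMildSolution J P lo hi (ρ + ρ') (φ + φ') (u + u') := by
  obtain ⟨w, g, h1, h2, h3⟩ := h
  obtain ⟨w', g', h1', h2', h3'⟩ := h'
  refine ⟨w + w', g + g', ?_, ?_, fun t => ?_⟩
  · filter_upwards [h1, h1', Lp.coeFn_add w w'] with t e1 e2 e3 ht
    rw [e3, Pi.add_apply, map_add, ← e1 ht, ← e2 ht, ContinuousMap.add_apply]
  · filter_upwards [h2, h2', Lp.coeFn_add w w', Lp.coeFn_add g g'] with t e1 e2 e3 e4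
    rw [e3, e4, Pi.add_apply, Pi.add_apply, map_add, e1, e2]
  · have hi1 : Integrable (fun τ => g τ + φ τ) (volume.restrict (Icc a b)) :=
      (L1.integrable_coeFn g).add (L1.integrable_coeFn φ)
    have hi2 : Integrable (fun τ => g' τ + φ' τ) (volume.restrict (Icc a b)) :=
      (L1.integrable_coeFn g').add (L1.integrable_coeFn φ')
    rw [ContinuousMap.add_apply, h3, h3', add_add_add_comm, ← intervalIntegral.integral_add
      (intervalIntegrable_of_mem_Icc hi1 _ _) (intervalIntegrable_of_mem_Icc hi2 _ _)]
    congr 1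
    refine intervalIntegral_congr_of_ae_Icc ?_ _ _
    filter_upwards [Lp.coeFn_add g g', Lp.coeFn_add φ φ'] with τ e1 e2
    rw [e1, e2, Pi.add_apply, Pi.add_apply, add_add_add_comm]

lemma IsMildSolution.smul (c : ℝ) {ρ : K} {φ : Lp K 1 ((volume : Measure ℝ).restrict (Icc a b))}
    {u : C(Icc a b, K)} (h : IsMildSolution J P lo hi ρ φ u) :
    IsMildSolution J P lo hi (c • ρ) (c • φ) (c • u) := by
  obtain ⟨w, g, h1, h2, h3⟩ := h
  refine ⟨c • w, c • g, ?_, ?_, fun t => ?_⟩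
  · filter_upwards [h1, Lp.coeFn_smul c w] with t e1 e3 ht
    rw [e3, Pi.smul_apply, map_smul, ← e1 ht, ContinuousMap.smul_apply]
  · filter_upwards [h2, Lp.coeFn_smul c w, Lp.coeFn_smul c g] with t e1 e3 e4
    rw [e3, e4, Pi.smul_apply, Pi.smul_apply, map_smul, e1]
  · rw [ContinuousMap.smul_apply, h3, smul_add, ← intervalIntegral.integral_smul]
    congr 1
    refine intervalIntegral_congr_of_ae_Icc ?_ _ _
    filter_upwards [Lp.coeFn_smul c g, Lp.coeFn_smul c φ] with τ e1 e2
    rw [e1, e2, Pi.smul_apply, Pi.smul_apply, smul_add]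

/-- The energy estimate for `u(t) = ρ + ∫_a^t (P u + φ)`. -/
lemma norm_le_of_integral_eq [CompleteSpace K] (hab : a ≤ b) {δ : ℝ → ℝ}
    (hδ : Integrable δ (volume.restrict (Icc a b))) (hδ0 : ∀ t, 0 ≤ δ t)
    (hP : ∀ᵐ t ∂((volume : Measure ℝ).restrict (Icc a b)), ∀ v,
      ⟪J v, P t v⟫ ≤ δ t * ‖J v‖ ^ 2) {w : ℝ → H} {g φ u : ℝ → K} {ρ : K}
    (hg : Integrable g (volume.restrict (Icc a b)))
    (hφ : Integrable φ (volume.restrict (Icc a b)))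
    (huw : ∀ᵐ t ∂((volume : Measure ℝ).restrict (Icc a b)), u t = J (w t))
    (hgw : ∀ᵐ t ∂((volume : Measure ℝ).restrict (Icc a b)), g t = P t (w t))
    (hu : ∀ t ∈ Icc a b, u t = ρ + ∫ τ in a..t, (g τ + φ τ)) {t : ℝ} (ht : t ∈ Icc a b) :
    ‖u t‖ ≤ Real.exp (∫ τ in a..b, δ τ) * (‖ρ‖ + ∫ τ, ‖φ τ‖ ∂(volume.restrict (Icc a b))) := by
  have hδI := intervalIntegrable_of_integrable_Icc hab hδ
  have hφI := intervalIntegrable_of_integrable_Icc hab hφ.norm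
  refine (evolution_norm_le hab (g := fun τ => g τ + φ τ) (ψ := fun τ => ‖φ τ‖) hδI hδ0 hφI
    (fun _ => norm_nonneg _) (intervalIntegrable_of_integrable_Icc hab (hg.add hφ)) hu ?_
    ht).trans ?_
  · filter_upwards [huw, hgw, hP] with τ h1 h2 h3
    rw [inner_add_right, h2, h1]
    exact add_le_add (h3 _) ((real_inner_le_norm _ _).trans_eq (mul_comm _ _))
  · have h1 : ∫ τ in a..t, δ τ ≤ ∫ τ in a..b, δ τ :=
      intervalIntegral.integral_mono_interval le_rfl ht.1 ht.2
        (Eventually.of_forall fun _ => hδ0 _) hδI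
    have h2 : ∫ τ in a..t, ‖φ τ‖ ≤ ∫ τ in a..b, ‖φ τ‖ :=
      intervalIntegral.integral_mono_interval le_rfl ht.1 ht.2
        (Eventually.of_forall fun _ => norm_nonneg _) hφI
    have h3 : 0 ≤ ∫ τ in a..t, ‖φ τ‖ :=
      intervalIntegral.integral_nonneg ht.1 fun _ _ => norm_nonneg _
    rw [intervalIntegral.integral_of_le hab (f := fun τ => ‖φ τ‖), ← integral_Icc_eq_integral_Ioc]
      at h2
    gcongr

lemma IsMildSolution.norm_le_of_initial [CompleteSpace K] (hab : a ≤ b) {δ : ℝ → ℝ}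
    (hδ : Integrable δ (volume.restrict (Icc a b))) (hδ0 : ∀ t, 0 ≤ δ t)
    (hP : ∀ᵐ t ∂((volume : Measure ℝ).restrict (Icc a b)), ∀ v,
      ⟪J v, P t v⟫ ≤ δ t * ‖J v‖ ^ 2) {ρ : K}
    {φ : Lp K 1 ((volume : Measure ℝ).restrict (Icc a b))} {u : C(Icc a b, K)}
    (h : IsMildSolution J P (fun _ => ⟨a, left_mem_Icc.2 hab⟩) id ρ φ u) :
    ‖u‖ ≤ Real.exp (∫ τ in a..b, δ τ) * (‖ρ‖ + ‖φ‖) := by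
  obtain ⟨w, g, h1, h2, h3⟩ := h
  refine (ContinuousMap.norm_le _ (by positivity)).2 fun t => ?_
  have := norm_le_of_integral_eq hab hδ hδ0 hP (u := fun t => u (projIcc a b hab t))
    (L1.integrable_coeFn g) (L1.integrable_coeFn φ) (w := w) (ρ := ρ) ?_ h2 ?_ t.2
  · rwa [projIcc_val, ← L1.norm_eq_integral_norm] at this
  · filter_upwards [h1, ae_restrict_mem measurableSet_Icc] with τ e1 e2
    rw [projIcc_of_mem hab e2, e1 e2]
  · intro τ hτ
    rw [projIcc_of_mem hab hτ, h3]
    rfl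

/-- The terminal value problem is reduced to the initial value problem by reversing time. -/
lemma IsMildSolution.norm_le_of_terminal [CompleteSpace K] (hb : 0 ≤ b) {δ : ℝ → ℝ}
    (hδ : Integrable δ (volume.restrict (Icc 0 b))) (hδ0 : ∀ t, 0 ≤ δ t)
    (hP : ∀ᵐ t ∂((volume : Measure ℝ).restrict (Icc 0 b)), ∀ v,
      ⟪J v, P t v⟫ ≤ δ t * ‖J v‖ ^ 2) {ρ : K}
    {φ : Lp K 1 ((volume : Measure ℝ).restrict (Icc 0 b))} {u : C(Icc 0 b, K)}
    (h : IsMildSolution J P id (fun _ => ⟨b, right_mem_Icc.2 hb⟩) ρ φ u) :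
    ‖u‖ ≤ Real.exp (∫ τ in (0 : ℝ)..b, δ τ) * (‖ρ‖ + ‖φ‖) := by
  obtain ⟨w, g, h1, h2, h3⟩ := h
  have hR := measurePreserving_reflect b
  have hae : ∀ {p : ℝ → Prop}, (∀ᵐ t ∂((volume : Measure ℝ).restrict (Icc 0 b)), p t) →
      ∀ᵐ t ∂((volume : Measure ℝ).restrict (Icc 0 b)), p (b - t) := fun hp =>
    hR.quasiMeasurePreserving.ae hp
  have hmem : ∀ {t}, t ∈ Icc 0 b → b - t ∈ Icc 0 b := fun ht =>
    ⟨by linarith [ht.2], by linarith [ht.1]⟩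
  refine (ContinuousMap.norm_le _ (by positivity)).2 fun t => ?_
  have := norm_le_of_integral_eq hb (P := fun t => P (b - t)) (δ := fun t => δ (b - t))
    (hR.integrable_comp_of_integrable hδ) (fun t => hδ0 _) (hae hP)
    (u := fun t => u (projIcc 0 b hb (b - t))) (g := fun t => g (b - t)) (φ := fun t => φ (b - t))
    (hR.integrable_comp_of_integrable (L1.integrable_coeFn g))
    (hR.integrable_comp_of_integrable (L1.integrable_coeFn φ)) (w := fun t => w (b - t)) (ρ := ρ)
    ?_ (hae h2) ?_ (hmem t.2)
  · rw [intervalIntegral.integral_comp_sub_left, sub_self, sub_zero] at this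
    have e : ∫ τ, ‖φ (b - τ)‖ ∂((volume : Measure ℝ).restrict (Icc 0 b)) = ‖φ‖ := by
      rw [L1.norm_eq_integral_norm]
      have hemb : MeasurableEmbedding fun t : ℝ => b - t :=
        (Homeomorph.subLeft b).measurableEmbedding
      exact hR.integral_comp hemb fun τ => ‖φ τ‖
    rw [e, sub_sub_cancel, projIcc_val] at this
    exact this
  · filter_upwards [hae h1, ae_restrict_mem measurableSet_Icc] with τ e1 e2
    rw [projIcc_of_mem hb (hmem e2), e1 (hmem e2)]
  · intro τ hτ
    rw [projIcc_of_mem hb (hmem hτ), h3]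
    congr 1
    rw [intervalIntegral.integral_comp_sub_left (fun τ => g τ + φ τ), sub_zero]
    rfl

lemma integrable_clm_apply {C : ℝ}
    (hPm : ∀ v, AEStronglyMeasurable (fun t => P t v) (volume.restrict (Icc a b)))
    (hPb : ∀ᵐ t ∂((volume : Measure ℝ).restrict (Icc a b)), ‖P t‖ ≤ C) {w : ℝ → H}
    (hw : MemLp w 2 (volume.restrict (Icc a b))) :
    Integrable (fun t => P t (w t)) (volume.restrict (Icc a b)) := by
  refine Integrable.mono' (g := fun t => C * ‖w t‖) ((hw.integrable (by norm_num)).norm.const_mul C)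
    (aestronglyMeasurable_clm_apply hPm hw.1) ?_
  filter_upwards [hPb] with t ht
  exact (P t).le_of_opNorm_le ht _

/-- An `L²([a, b] → H)` function satisfying the integral equation almost everywhere has a
continuous representative which is a mild solution. -/
lemma exists_isMildSolution {ρ : K} {φ : Lp K 1 ((volume : Measure ℝ).restrict (Icc a b))}
    (hcont : ∀ F : ℝ → K, Integrable F (volume.restrict (Icc a b)) →
      Continuous fun t : Icc a b => ∫ τ in (lo t : ℝ)..(hi t), F τ) {w : ℝ → H}
    (hw : MemLp w 2 (volume.restrict (Icc a b)))
    (hPw : Integrable (fun t => P t (w t)) (volume.restrict (Icc a b)))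
    (h : ∀ᵐ t ∂((volume : Measure ℝ).restrict (Icc a b)), ∀ ht : t ∈ Icc a b,
      J (w t) = ρ + ∫ τ in (lo ⟨t, ht⟩ : ℝ)..(hi ⟨t, ht⟩), (P τ (w τ) + φ τ)) :
    ∃ u, IsMildSolution J P lo hi ρ φ u := by
  have hφ := L1.integrable_coeFn φ
  have hg := hPw.coeFn_toL1
  refine ⟨⟨fun t => ρ + ∫ τ in (lo t : ℝ)..(hi t), (P τ (w τ) + φ τ),
    continuous_const.add (hcont _ (hPw.add hφ))⟩, hw.toLp, hPw.toL1, ?_, ?_, fun t => ?_⟩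
  · filter_upwards [h, hw.coeFn_toLp] with t e1 e2 ht
    rw [e2, e1 ht]
    rfl
  · filter_upwards [hg, hw.coeFn_toLp] with t e1 e2
    rw [e1, e2]
  · change ρ + _ = _
    congr 1
    refine intervalIntegral_congr_of_ae_Icc ?_ _ _
    filter_upwards [hg] with τ e1
    rw [e1]

lemma continuous_integral_left {V : Type*} [NormedAddCommGroup V] [NormedSpace ℝ V]
    (hab : a ≤ b) {F : ℝ → V} (hF : Integrable F (volume.restrict (Icc a b))) :
    Continuous fun t : Icc a b => ∫ τ in a..t, F τ := by
  have := intervalIntegral.continuousOn_primitive_interval (a := a) (b := b) (f := F)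
    (μ := volume) (by rw [uIcc_of_le hab]; exact hF)
  rw [uIcc_of_le hab] at this
  exact continuousOn_iff_continuous_domRestrict.1 this

lemma continuous_integral_right {V : Type*} [NormedAddCommGroup V] [NormedSpace ℝ V]
    (hab : a ≤ b) {F : ℝ → V} (hF : Integrable F (volume.restrict (Icc a b))) :
    Continuous fun t : Icc a b => ∫ τ in (t : ℝ)..b, F τ := by
  have := intervalIntegral.continuousOn_primitive_interval_left (a := a) (b := b) (f := F)
    (μ := volume) (by rw [uIcc_of_le hab]; exact hF)
  rw [uIcc_of_le hab] at this
  exact continuousOn_iff_continuous_domRestrict.1 this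

lemma exists_isMildSolution_initial (hab : a ≤ b) {w : ℝ → H} {ρ : K}
    {φ : Lp H 2 ((volume : Measure ℝ).restrict (Icc a b))}
    (hw : MemLp w 2 (volume.restrict (Icc a b)))
    (hPw : Integrable (fun t => P t (w t)) (volume.restrict (Icc a b)))
    (h : ∀ᵐ t ∂((volume : Measure ℝ).restrict (Icc a b)),
      J (w t) = ρ + ∫ τ in a..t, (P τ (w τ) + J (φ τ))) :
    ∃ u, IsMildSolution J P (fun _ => ⟨a, left_mem_Icc.2 hab⟩) id ρ (lpIncl _ J φ) u := by
  refine exists_isMildSolution (fun F hF => continuous_integral_left hab hF) hw hPw ?_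
  filter_upwards [h] with t e ht
  rw [e]
  congr 1
  refine intervalIntegral_congr_of_ae_Icc (a := a) (b := b) ?_ ⟨a, left_mem_Icc.2 hab⟩ ⟨t, ht⟩
  filter_upwards [(memLp_one_comp J φ).coeFn_toLp] with τ hτ
  exact congrArg (P τ (w τ) + ·) hτ.symm

/-- A solution of the time-reversed initial value problem yields a solution of the terminal value
problem. -/
lemma exists_isMildSolution_terminal (hb : 0 ≤ b) {w : ℝ → H}
    {φ : Lp H 2 ((volume : Measure ℝ).restrict (Icc 0 b))}
    (hw : MemLp (fun t => w (b - t)) 2 (volume.restrict (Icc 0 b)))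
    (hPw : Integrable (fun t => P t (w (b - t))) (volume.restrict (Icc 0 b)))
    (h : ∀ᵐ t ∂((volume : Measure ℝ).restrict (Icc 0 b)),
      J (w t) = J 0 + ∫ τ in (0 : ℝ)..t, (P (b - τ) (w τ) + J (φ (b - τ)))) :
    ∃ u, IsMildSolution J P id (fun _ => ⟨b, right_mem_Icc.2 hb⟩) 0 (lpIncl _ J φ) u := by
  refine exists_isMildSolution (fun F hF => continuous_integral_right hb hF) hw hPw ?_
  filter_upwards [(measurePreserving_reflect b).quasiMeasurePreserving.ae h] with t e ht
  have e1 : ∫ τ in (t : ℝ)..b, (P τ (w (b - τ)) + lpIncl _ J φ τ) =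
      ∫ τ in (t : ℝ)..b, (P τ (w (b - τ)) + J (φ τ)) := by
    refine intervalIntegral_congr_of_ae_Icc (a := 0) (b := b) ?_ ⟨t, ht⟩ ⟨b, right_mem_Icc.2 hb⟩
    filter_upwards [(memLp_one_comp J φ).coeFn_toLp] with τ hτ
    exact congrArg (P τ (w (b - τ)) + ·) hτ
  have e2 := intervalIntegral.integral_comp_sub_left (a := 0) (b := b - t)
    (fun τ => P τ (w (b - τ)) + J (φ τ)) b
  simp only [sub_sub_cancel, sub_zero] at e2
  rw [map_zero, zero_add] at e
  rw [zero_add]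
  exact e.trans (e2.trans e1.symm)

/-- Well-posedness of the initial value problem `u' = P u`, `u(a) = ρ`, given existence for smooth
data and the energy inequality. -/
theorem exists_initial_operator [CompleteSpace K] (hab : a ≤ b) (hJ : DenseRange J) {δ : ℝ → ℝ}
    (hδ : Integrable δ (volume.restrict (Icc a b))) (hδ0 : ∀ t, 0 ≤ δ t)
    (hP : ∀ᵐ t ∂((volume : Measure ℝ).restrict (Icc a b)), ∀ v,
      ⟪J v, P t v⟫ ≤ δ t * ‖J v‖ ^ 2) {Sol : K → C(Icc a b, K) → Prop}
    (hSol : ∀ ρ u, Sol ρ u ↔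
      IsMildSolution J P (fun _ => ⟨a, left_mem_Icc.2 hab⟩) id ρ 0 u)
    (hex : ∀ ρ, ∃ u, Sol (J ρ) u) :
    (∀ ρ, ∃! u, Sol (J ρ) u) ∧ ∃ L : K →L[ℝ] C(Icc a b, K), (∀ ρ, Sol (J ρ) (L (J ρ))) ∧
      (∀ L' : K →L[ℝ] C(Icc a b, K), (∀ ρ, Sol (J ρ) (L' (J ρ))) → L' = L) ∧
      ‖L‖ ≤ Real.exp (∫ t in a..b, δ t) := by
  refine existsUnique_and_exists_extension J.toLinearMap hJ (Real.exp_nonneg _)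
    (fun ρ ρ' u u' h h' => ?_) (fun c ρ u h => ?_) (fun ρ u h => ?_) hex
  · have := ((hSol _ _).1 h).add ((hSol _ _).1 h')
    rw [add_zero] at this
    exact (hSol _ _).2 this
  · have := ((hSol _ _).1 h).smul c
    rw [smul_zero] at this
    exact (hSol _ _).2 this
  · have := ((hSol _ _).1 h).norm_le_of_initial hab hδ hδ0 hP
    rwa [norm_zero, add_zero] at this

/-- Well-posedness of the terminal value problem `u' + P u = -φ`, `u(b) = 0`, given existence for
smooth data and the energy inequality. -/
theorem exists_terminal_operator [CompleteSpace K] (hb : 0 ≤ b) (hJ : DenseRange J) {δ : ℝ → ℝ}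
    (hδ : Integrable δ (volume.restrict (Icc 0 b))) (hδ0 : ∀ t, 0 ≤ δ t)
    (hP : ∀ᵐ t ∂((volume : Measure ℝ).restrict (Icc 0 b)), ∀ v,
      ⟪J v, P t v⟫ ≤ δ t * ‖J v‖ ^ 2)
    {Sol : Lp K 1 ((volume : Measure ℝ).restrict (Icc 0 b)) → C(Icc 0 b, K) → Prop}
    (hSol : ∀ φ u, Sol φ u ↔
      IsMildSolution J P id (fun _ => ⟨b, right_mem_Icc.2 hb⟩) 0 φ u)
    (hex : ∀ φ, ∃ u, Sol (lpIncl _ J φ) u) :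
    (∀ φ, ∃! u, Sol (lpIncl _ J φ) u) ∧
    ∃ L : Lp K 1 ((volume : Measure ℝ).restrict (Icc 0 b)) →L[ℝ] C(Icc 0 b, K),
      (∀ φ, Sol (lpIncl _ J φ) (L (lpIncl _ J φ))) ∧
      (∀ L' : Lp K 1 ((volume : Measure ℝ).restrict (Icc 0 b)) →L[ℝ] C(Icc 0 b, K),
        (∀ φ, Sol (lpIncl _ J φ) (L' (lpIncl _ J φ))) → L' = L) ∧
      ‖L‖ ≤ Real.exp (∫ t in (0 : ℝ)..b, δ t) := by
  refine existsUnique_and_exists_extension (lpIncl _ J) (denseRange_lpIncl hJ) (Real.exp_nonneg _)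
    (fun φ φ' u u' h h' => ?_) (fun c φ u h => ?_) (fun φ u h => ?_) hex
  · have := ((hSol _ _).1 h).add ((hSol _ _).1 h')
    rw [add_zero] at this
    exact (hSol _ _).2 this
  · have := ((hSol _ _).1 h).smul c
    rw [smul_zero] at this
    exact (hSol _ _).2 this
  · have := ((hSol _ _).1 h).norm_le_of_terminal hb hδ hδ0 hP
    rwa [norm_zero, zero_add] at this

end Mild

/-! ### The backward and the forward problem -/

section WellPosedness

variable {n : ℕ} {s T C : ℝ} {f : E n → ℝ → E n}

/-- The operator `A(·, t)`. -/
noncomputable def opA (f : E n → ℝ → E n) (t : ℝ) : H1 n →L[ℝ] H0 n :=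
  firstOrderOp (fun i x => f x t i) fun _ => 0

/-- The operator `A*(·, t) = -∑ᵢ fᵢ ∂ᵢ - div f`. -/
noncomputable def opAstar (f : E n → ℝ → E n) (t : ℝ) : H1 n →L[ℝ] H0 n :=
  firstOrderOp (fun i x => -f x t i) fun x => -divx f x t

lemma coeFn_sum_Lp {ι : Type*} [Fintype ι] (F : ι → H0 n) :
    ∀ᵐ x, (∑ i, F i) x = ∑ i, F i x := by
  filter_upwards [Lp.coeFn_finsetSum Finset.univ F] with x hx
  rw [hx, Finset.sum_apply]

lemma isA_iff {t : ℝ} (hf : ∀ i, IsMultiplier C fun x => f x t i) (u : H1 n) (g : H0 n) :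
    IsA f t u g ↔ g = opA f t u := by
  have e : opA f t u = ∑ i, mulOp (fun x => f x t i) (wpd i u) := by
    rw [opA, firstOrderOp_apply, mulOp_zero, add_zero]
  have h : ∀ᵐ x, opA f t u x = ∑ i, f x t i * wpd i u x := by
    have h1 : ∀ᵐ x, ∀ i, mulOp (fun x => f x t i) (wpd i u) x = f x t i * wpd i u x :=
      ae_all_iff.2 fun i => coeFn_mulOp (hf i).measurable (hf i).bound (wpd i u)
    rw [e]
    filter_upwards [h1, coeFn_sum_Lp fun i => mulOp (fun x => f x t i) (wpd i u)]
      with x h1 h2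
    rw [h2]
    exact Finset.sum_congr rfl fun i _ => h1 i
  constructor
  · intro hg
    refine Lp.ext ?_
    filter_upwards [hg, h] with x h1 h2
    rw [h1, h2]
  · rintro rfl
    exact h

/-- An element of `H¹` is determined by the underlying function. -/
lemma wpd_eq_of_toH0_eq {z z' : H1 n} (h : toH0 z = toH0 z') (i : Fin n) :
    wpd i z = wpd i z' := by
  have h1 := (hasWeakPd_iff_hasDerivAt i _ _).1 (hasWeakPd_wpd i z)
  have h2 := (hasWeakPd_iff_hasDerivAt i _ _).1 (hasWeakPd_wpd i z')
  rw [h] at h1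
  exact h1.unique h2

lemma neg_sum_add_eq {V : Type*} [AddCommGroup V] {ι : Type*} [Fintype ι] (F G : ι → V) :
    ∑ i, -F i + -∑ i, G i = -∑ i, (F i + G i) := by
  rw [Finset.sum_add_distrib, Finset.sum_neg_distrib, neg_add]

lemma opAstar_apply {t : ℝ} (hf : ∀ i, IsMultiplier C fun x => f x t i)
    (hd : IsMultiplier C fun x => divx f x t) (u : H1 n) :
    opAstar f t u = -∑ i, wpd i (mulH1 (fun x => f x t i) u) := by
  have h1 : ∀ i, wpd i (mulH1 (fun x => f x t i) u) =
      mulOp (fun x => f x t i) (wpd i u) + mulOp (pd i fun x => f x t i) (toH0 u) := fun i =>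
    (hf i).wpd_mulH1 i u
  have h2 : ∀ i, mulOp (fun x => -f x t i) (wpd i u) = -mulOp (fun x => f x t i) (wpd i u) :=
    fun i => mulOp_neg (hf i).measurable (hf i).bound _
  have h3 : mulOp (fun x => divx f x t) (toH0 u) =
      ∑ i, mulOp (pd i fun x => f x t i) (toH0 u) :=
    mulOp_sum (fun i => (hf i).measurable_pd i) (fun i => (hf i).pd_bound i) _
  rw [opAstar, firstOrderOp_apply, mulOp_neg hd.measurable hd.bound, h3]
  simp only [h1, h2]
  exact neg_sum_add_eq _ _

/-- By the product rule, `A*` is the first-order operator `opAstar`. -/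
lemma isAstar_iff {t : ℝ} (hf : ∀ i, IsMultiplier C fun x => f x t i)
    (hd : IsMultiplier C fun x => divx f x t) (u : H1 n) (g : H0 n) :
    IsAstar f t u g ↔ g = opAstar f t u := by
  have h0 : ∀ i, ∀ᵐ x, toH0 (mulH1 (fun x => f x t i) u) x = f x t i * toH0 u x := fun i => by
    rw [(hf i).toH0_mulH1]
    exact coeFn_mulOp (hf i).measurable (hf i).bound _
  rw [opAstar_apply hf hd]
  constructor
  · rintro ⟨z, hz, rfl⟩
    have e : ∀ i, wpd i (z i) = wpd i (mulH1 (fun x => f x t i) u) := fun i => by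
      refine wpd_eq_of_toH0_eq (Lp.ext ?_) i
      filter_upwards [hz i, h0 i] with x h1 h2
      rw [h1, h2]
    simp only [e]
  · rintro rfl
    exact ⟨_, h0, rfl⟩

lemma inner_opA_le {t : ℝ} (hf : ∀ i, IsMultiplier C fun x => f x t i)
    (hd : IsMultiplier C fun x => divx f x t) (u : H1 n) :
    ⟪toH0 u, opA f t u⟫ ≤ delta f t * ‖toH0 u‖ ^ 2 := by
  refine inner_firstOrderOp_self_le hf (.zero hd.nonneg) (fun x => ?_) u
  rw [mul_zero, zero_sub, abs_neg]
  exact abs_divx_le hd x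

lemma inner_opAstar_le {t : ℝ} (hf : ∀ i, IsMultiplier C fun x => f x t i)
    (hd : IsMultiplier C fun x => divx f x t) (u : H1 n) :
    ⟪toH0 u, opAstar f t u⟫ ≤ delta f t * ‖toH0 u‖ ^ 2 := by
  refine inner_firstOrderOp_self_le (fun i => (hf i).neg) hd.neg (fun x => ?_) u
  have e : 2 * -divx f x t - ∑ i, pd i (fun x => -f x t i) x = -divx f x t := by
    simp only [pd_neg, Finset.sum_neg_distrib, divx]
    ring
  rw [e, abs_neg]
  exact abs_divx_le hd x

lemma integrable_firstOrderOp {a b : ℝ} {β : Fin n → ℝ → E n → ℝ}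
    {c : ℝ → E n → ℝ} (hβ : ∀ i, IsMultiplierFamily (Icc a b) C (β i))
    (hc : IsMultiplierFamily (Icc a b) C c) {w : ℝ → H1 n}
    (hw : MemLp w 2 (volume.restrict (Icc a b))) :
    Integrable (fun t => firstOrderOp (fun i => β i t) (c t) (w t))
      (volume.restrict (Icc a b)) := by
  refine integrable_clm_apply (C := n * C + C) (fun v => ?_)
    ((ae_restrict_mem measurableSet_Icc).mono fun t ht =>
      norm_firstOrderOp_le (fun i => (hβ i).isMultiplier t ht) (hc.isMultiplier t ht)) hw
  simp only [firstOrderOp_apply]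
  exact aestronglyMeasurable_sum_add (fun i => (hβ i).meas _) (hc.meas _)

lemma solvesForward_iff (hf : ∀ t ∈ Icc s T, ∀ i, IsMultiplier C fun x => f x t i)
    (hd : ∀ t ∈ Icc s T, IsMultiplier C fun x => divx f x t) (hsT : s ≤ T) (ρ : H0 n)
    (p : C0 n s T) : SolvesForward f ρ p ↔
      IsMildSolution toH0 (opAstar f) (fun _ => ⟨s, left_mem_Icc.2 hsT⟩) id ρ 0 p := by
  have h1 : ∀ (w : X1 n s T) (g : X01 n s T),
      (∀ᵐ t ∂((volume : Measure ℝ).restrict (Icc s T)), IsAstar f t (w t) (g t)) ↔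
      ∀ᵐ t ∂((volume : Measure ℝ).restrict (Icc s T)), g t = opAstar f t (w t) := fun w g =>
    eventually_congr ((ae_restrict_mem measurableSet_Icc).mono fun t ht =>
      isAstar_iff (hf t ht) (hd t ht) (w t) (g t))
  have h2 : ∀ (g : X01 n s T) (t : Icc s T), ∫ τ in s..(t : ℝ), g τ =
      ∫ τ in s..(t : ℝ), (g τ + (0 : X01 n s T) τ) := fun g t => by
    refine intervalIntegral_congr_of_ae_Icc (a := s) (b := T) ?_ ⟨s, left_mem_Icc.2 hsT⟩ t
    filter_upwards [Lp.coeFn_zero (H0 n) 1 ((volume : Measure ℝ).restrict (Icc s T))] with τ hτ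
    rw [hτ, Pi.zero_apply, add_zero]
  unfold SolvesForward IsMildSolution
  simp only [h1, h2, id]

lemma solvesBackward_iff (hf : ∀ t ∈ Icc 0 T, ∀ i, IsMultiplier C fun x => f x t i)
    (hT : 0 ≤ T) (φ : X01 n 0 T) (v : C0 n 0 T) : SolvesBackward f φ v ↔
      IsMildSolution toH0 (opA f) id (fun _ => ⟨T, right_mem_Icc.2 hT⟩) 0 φ v := by
  have h1 : ∀ (w : X1 n 0 T) (g : X01 n 0 T),
      (∀ᵐ t ∂((volume : Measure ℝ).restrict (Icc 0 T)), IsA f t (w t) (g t)) ↔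
      ∀ᵐ t ∂((volume : Measure ℝ).restrict (Icc 0 T)), g t = opA f t (w t) := fun w g =>
    eventually_congr ((ae_restrict_mem measurableSet_Icc).mono fun t ht =>
      isA_iff (hf t ht) (w t) (g t))
  unfold SolvesBackward IsMildSolution
  simp only [h1, id, zero_add]

lemma exists_solvesForward (hsT : s ≤ T)
    (hf : ∀ k, IsMultiplierFamily (Icc s T) C fun t x => f x t k)
    (hd : IsMultiplierFamily (Icc s T) C fun t x => divx f x t) (ρ : H1 n) :
    ∃ p : C0 n s T, SolvesForward f (toH0 ρ) p := by
  have hβ := fun k => (hf k).neg measurableSet_Icc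
  have hc := hd.neg measurableSet_Icc
  obtain ⟨w, hw, h⟩ := exists_transport hsT hβ hc ρ (Lp.memLp (0 : X1 n s T))
  obtain ⟨p, hp⟩ := exists_isMildSolution_initial (P := opAstar f) hsT hw
    (integrable_firstOrderOp hβ hc hw) h
  rw [map_zero] at hp
  exact ⟨p, (solvesForward_iff (fun t ht i => (hf i).isMultiplier t ht) hd.isMultiplier hsT _ _).2
    hp⟩

lemma exists_solvesBackward (hT : 0 ≤ T) (hC : 0 ≤ C)
    (hf : ∀ k, IsMultiplierFamily (Icc 0 T) C fun t x => f x t k) (φ : X1 n 0 T) :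
    ∃ v : C0 n 0 T, SolvesBackward f (incl φ) v := by
  have hR := measurePreserving_reflect T
  have hc : IsMultiplierFamily (Icc 0 T) C fun _ (_ : E n) => (0 : ℝ) := .zero hC
  obtain ⟨w, hw, h⟩ := exists_transport hT (fun k => (hf k).reflect) hc 0
    ((Lp.memLp φ).comp_measurePreserving hR)
  have hw' : MemLp (fun t => w (T - t)) 2 (volume.restrict (Icc 0 T)) :=
    hw.comp_measurePreserving hR
  obtain ⟨v, hv⟩ := exists_isMildSolution_terminal (P := opA f) hT hw'
    (integrable_firstOrderOp hf hc hw') h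
  exact ⟨v, (solvesBackward_iff (fun t ht i => (hf i).isMultiplier t ht) hT _ _).2 hv⟩

/-- Unique solvability of `∂v/∂t + A v = -φ`, `v(T) = 0`, and extension of the solution operator. -/
theorem wellPosed_backward (hT : 0 ≤ T) (hC : 0 ≤ C)
    (hf : ∀ k, IsMultiplierFamily (Icc 0 T) C fun t x => f x t k)
    (hd : IsMultiplierFamily (Icc 0 T) C fun t x => divx f x t)
    (hδ : Integrable (delta f) (volume.restrict (Icc 0 T))) :
    (∀ φ : X1 n 0 T, ∃! v : C0 n 0 T, SolvesBackward f (incl φ) v) ∧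
    (∃ L : X01 n 0 T →L[ℝ] C0 n 0 T,
      (∀ φ : X1 n 0 T, SolvesBackward f (incl φ) (L (incl φ))) ∧
      (∀ L' : X01 n 0 T →L[ℝ] C0 n 0 T,
        (∀ φ : X1 n 0 T, SolvesBackward f (incl φ) (L' (incl φ))) → L' = L) ∧
      ‖L‖ ≤ Real.exp (∫ t in (0 : ℝ)..T, delta f t)) := by
  have hft : ∀ t ∈ Icc 0 T, ∀ i, IsMultiplier C fun x => f x t i := fun t ht i =>
    (hf i).isMultiplier t ht
  have hP : ∀ᵐ t ∂((volume : Measure ℝ).restrict (Icc 0 T)), ∀ u : H1 n,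
      ⟪toH0 u, opA f t u⟫ ≤ delta f t * ‖toH0 u‖ ^ 2 :=
    (ae_restrict_mem measurableSet_Icc).mono fun t ht u =>
      inner_opA_le (hft t ht) (hd.isMultiplier t ht) u
  exact exists_terminal_operator (J := toH0) (Sol := SolvesBackward f) hT denseRange_toH0 hδ
    (delta_nonneg f) hP (solvesBackward_iff hft hT) (exists_solvesBackward hT hC hf)

/-- Unique solvability of `∂p/∂t = A* p`, `p(s) = ρ`, and extension of the solution operator. -/
theorem wellPosed_forward (hsT : s ≤ T)
    (hf : ∀ k, IsMultiplierFamily (Icc s T) C fun t x => f x t k)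
    (hd : IsMultiplierFamily (Icc s T) C fun t x => divx f x t)
    (hδ : Integrable (delta f) (volume.restrict (Icc s T))) :
    (∀ ρ : H1 n, ∃! p : C0 n s T, SolvesForward f (toH0 ρ) p) ∧
    (∃ Ls : H0 n →L[ℝ] C0 n s T,
      (∀ ρ : H1 n, SolvesForward f (toH0 ρ) (Ls (toH0 ρ))) ∧
      (∀ Ls' : H0 n →L[ℝ] C0 n s T,
        (∀ ρ : H1 n, SolvesForward f (toH0 ρ) (Ls' (toH0 ρ))) → Ls' = Ls) ∧
      ‖Ls‖ ≤ Real.exp (∫ t in s..T, delta f t)) := by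
  have hft : ∀ t ∈ Icc s T, ∀ i, IsMultiplier C fun x => f x t i := fun t ht i =>
    (hf i).isMultiplier t ht
  have hP : ∀ᵐ t ∂((volume : Measure ℝ).restrict (Icc s T)), ∀ u : H1 n,
      ⟪toH0 u, opAstar f t u⟫ ≤ delta f t * ‖toH0 u‖ ^ 2 :=
    (ae_restrict_mem measurableSet_Icc).mono fun t ht u =>
      inner_opAstar_le (hft t ht) (hd.isMultiplier t ht) u
  exact exists_initial_operator (J := toH0) (Sol := SolvesForward f) hsT denseRange_toH0 hδ
    (delta_nonneg f) hP (solvesForward_iff hft hd.isMultiplier hsT)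
    (exists_solvesForward hsT hf hd)

end WellPosedness

end Transport

theorem lemma1p1 (n : ℕ) (T : ℝ) (hT : 0 < T) (f : E n → ℝ → E n) (hf : IsAdmissible n T f) :
    -- the integral of `δ_f` makes sense
    IntervalIntegrable (delta f) MeasureTheory.volume 0 T ∧
    -- the operator `L` is defined on `L²([0, T] → H¹)`, and extends continuously
    (∀ φ : X1 n 0 T, ∃! v : C0 n 0 T, SolvesBackward f (incl φ) v) ∧
    (∃ L : X01 n 0 T →L[ℝ] C0 n 0 T,
      (∀ φ : X1 n 0 T, SolvesBackward f (incl φ) (L (incl φ))) ∧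
      (∀ L' : X01 n 0 T →L[ℝ] C0 n 0 T,
        (∀ φ : X1 n 0 T, SolvesBackward f (incl φ) (L' (incl φ))) → L' = L) ∧
      ‖L‖ ≤ Real.exp (∫ t in (0 : ℝ)..T, delta f t)) ∧
    -- the operator `𝓛_s*` is defined on `H¹`, and extends continuously
    ∀ s ∈ Set.Icc 0 T,
      (∀ ρ : H1 n, ∃! p : C0 n s T, SolvesForward f (toH0 ρ) p) ∧
      (∃ Ls : H0 n →L[ℝ] C0 n s T,
        (∀ ρ : H1 n, SolvesForward f (toH0 ρ) (Ls (toH0 ρ))) ∧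
        (∀ Ls' : H0 n →L[ℝ] C0 n s T,
          (∀ ρ : H1 n, SolvesForward f (toH0 ρ) (Ls' (toH0 ρ))) → Ls' = Ls) ∧
        ‖Ls‖ ≤ Real.exp (∫ t in s..T, delta f t)) := by
  refine hf.exists_isMultiplierFamily.elim fun C h => ?_
  have hδ := hf.integrable_delta
  have key := wellPosed_backward hT.le h.1 h.2.1 h.2.2 hδ
  exact ⟨intervalIntegrable_of_integrable_Icc hT.le hδ, key.1, key.2, fun s hs =>
    have hsub : Icc s T ⊆ Icc 0 T := Icc_subset_Icc hs.1 le_rfl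
    wellPosed_forward hs.2 (fun k => (h.2.1 k).mono hsub) (h.2.2.mono hsub)
      (MeasureTheory.IntegrableOn.mono_set hδ hsub)⟩
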